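/- Let $p$ be a prime and let $k$ be a commutative ring containing a field of characteristic $p$. All gradings are by $\mathbb Z$ and cohomological, and $(\Sigma M)^n=M^{n+1}$. **Restricted graded Lie algebras.** A graded Lie algebra is a graded $k$-module $L$ with a bilinear bracket $L^i\times L^j\to L^{i+j}$ and a reduced square $(-)^{[2]}:L^{n}\to L^{2n}$ for $n$ odd, such that for homogeneous elements $[x,y]=-(-1)^{|x||y|}[y,x]$; $[x,x]=0$ for $|x|$ even; $[x,[y,z]]=[[x,y],z]+(-1)^{|x||y|}[y,[x,z]]$; and, for $x,y$ of the same odd degree, $[x,[x,x]]=0$, $(x+y)^{[2]}=x^{[2]}+y^{[2]}+[x,y]$, $(\alpha x)^{[2]}=\alpha^2x^{[2]}$ for $\alpha\in k$, and $[x^{[2]},z]=[x,[x,z]]$ for all $z$. It is restricted if it carries operations $(-)^{[p]}:L^{n}\to L^{pn}$ for $n$ even with $(\alpha x)^{[p]}=\alpha^px^{[p]}$, $[x^{[p]},z]=(\mathrm{ad}\,x)^p(z)$ for all $z$, and $(x+y)^{[p]}=x^{[p]}+y^{[p]}+\sum_{i=1}^{p-1}s_i(x,y)$, where $i\,s_i(x,y)$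 is the coefficient of $t^{i-1}$ in $\mathrm{ad}(tx+y)^{p-1}(x)$. A homomorphism is a degree-preserving linear map that commutes with the bracket, $(-)^{[2]}$ and $(-)^{[p]}$. **$B_\infty$-algebras.** A $B_\infty$-algebra is a graded $k$-module $C$ with a product $*$ (of degree $0$) and a differential $d$ (of degree $1$) on the bar construction $BC=\bigoplus_{n\ge 0}(\Sigma C)^{\otimes n}$ that make $BC$, with the deconcatenation coproduct and the unit $1\in(\Sigma C)^{\otimes 0}$, a dg bialgebra (hence a dg Hopf algebra). A map of $B_\infty$-algebras $C\to D$ is a map of dg bialgebras $BC\to BD$. Let $\pi:BC\to\Sigma C$ be the projection, $H^*(C)$ the cohomology of $C$ for the differential $\pi d|_{\Sigma C}$, and $x\circ y=\pi(x*y)$ for $x,y\in\Sigma C$. **Hochschild cochains.** For a small $k$-linear dg category $A$ write ${}_bA_a$ for the complex of morphisms from $a$ to $b$. Let $C^*(A,A)$ be the Hochschild cochain complex: an element of $C^{n+1}(A,A)=(\Sigma C^*(A,A))^n$ is a family, over all $r\ge0$ and all objects $a_0,\dots,a_r$, of linear maps ${}_{a_r}A_{a_{r-1}}\otimes\cdots\otimes{}_{a_1}A_{a_0}\to{}_{a_r}A_{a_0}$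 of degree $n+1-r$. For $x$ and $y$ of degrees $|x|,|y|$ in $\Sigma C^*(A,A)$, put $$(x\circ y)(f_1,\dots,f_r)=\sum_{j,s}(-1)^{|y|\sum_{l\le j}(|f_l|-1)}\,x(f_1,\dots,f_j,y(f_{j+1},\dots,f_{j+s}),f_{j+s+1},\dots,f_r).$$ The differential is $\partial x=m\circ x-(-1)^{|x|}x\circ m$, where $m(f)=df$, $m(f,g)=(-1)^{|f|}fg$, and $m$ vanishes on strings of other lengths. Write $HH^*(A,A)$ for the cohomology of this complex. A dg functor $\phi:A\to B$ that is fully faithful (an isomorphism on complexes of morphisms) induces the restriction $\phi^*:C^*(B,B)\to C^*(A,A)$, $(\phi^*x)(f_1,\dots,f_r)=\phi^{-1}\bigl(x(\phi f_1,\dots,\phi f_r)\bigr)$. **Theorem.** 1. Let $C$ be a $B_\infty$-algebra. Then $\Sigma H^*(C)$ has a unique restricted graded Lie algebra structure given on classes of cocycles by $[x,y]=x\circ y-(-1)^{|x||y|}y\circ x$, by $x^{[2]}=x\circ x$ for $|x|$ odd, and by letting $x^{[p]}$ for $|x|$ even be the class of $\pi$ of the $p$-th power of $x$ in the algebra $(BC,*)$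 (degrees taken in $\Sigma C$). In particular these operations are well defined on cohomology. If the product of $BC$ comes from brace operations $x\{y_1,\dots,y_s\}$ alone, that is, if $\pi(u*v)=0$ for $u\in(\Sigma C)^{\otimes m}$, $v\in(\Sigma C)^{\otimes n}$ with $m\ge2$, $n\ge1$, then $x^{[p]}$ is represented by $((x\circ x)\circ\cdots)\circ x$ with $p$ occurrences of $x$. 2. A map of $B_\infty$-algebras $C\to D$ induces, through its linear part $\Sigma C\to\Sigma D$, a homomorphism $\Sigma H^*(C)\to\Sigma H^*(D)$ of restricted graded Lie algebras. 3. Let $A$ be a small dg category over $k$. Then $\Sigma HH^*(A,A)$ has a unique restricted graded Lie algebra structure given on classes of cocycles by $[x,y]=x\circ y-(-1)^{|x||y|}y\circ x$, by $x^{[2]}=x\circ x$ for $|x|$ odd, and by $x^{[p]}=((x\circ x)\circ\cdots)\circ x$ ($p$ occurrences of $x$) for $|x|$ even. If $\phi:A\to B$ is a fully faithful dg functor between small dg categories, then $\phi^*$ induces a homomorphism $\Sigma HH^*(B,B)\to\Sigma HH^*(A,A)$ of restricted graded Lie algebras. -/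

import Mathlib

open scoped TensorProduct DirectSum

universe u v w v' w'

noncomputable section

/-! ## Graded modules, cohomology -/

section Graded

variable {k : Type u} [CommRing k] {M : Type v} [AddCommGroup M] [Module k M]

/-- For an (internally) graded module `M = ⨁ i, gr i` and a function `ε` from degrees to signs,
the linear endomorphism of `M` that multiplies the homogeneous elements of degree `i` by `ε i`. -/
def gradedSign (gr : ℤ → Submodule k M) (h : DirectSum.IsInternal gr) (ε : ℤ → ℤˣ) :
    M →ₗ[k] M :=
  (DirectSum.coeLinearMap gr ∘ₗ
    DirectSum.lmap (fun i => (((ε i : ℤˣ) : ℤ) : k) • (LinearMap.id : gr i →ₗ[k] gr i))) ∘ₗ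
    (LinearEquiv.ofBijective (DirectSum.coeLinearMap gr)
      (show Function.Bijective (DirectSum.coeLinearMap gr) from h)).symm.toLinearMap

theorem gradedSign_apply (gr : ℤ → Submodule k M) (h : DirectSum.IsInternal gr) (ε : ℤ → ℤˣ)
    (i : ℤ) (x : M) (hx : x ∈ gr i) : gradedSign gr h ε x = ε i • x := by
  have h1 : (LinearEquiv.ofBijective (DirectSum.coeLinearMap gr)
      (show Function.Bijective (DirectSum.coeLinearMap gr) from h)).symm x
      = DirectSum.lof k ℤ (fun i => gr i) i ⟨x, hx⟩ := by
    rw [LinearEquiv.symm_apply_eq, LinearEquiv.ofBijective_apply]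
    exact (DirectSum.coeLinearMap_lof gr i ⟨x, hx⟩).symm
  simp only [gradedSign, LinearMap.comp_apply, LinearEquiv.coe_coe, h1, DirectSum.lmap_lof,
    DirectSum.coeLinearMap_lof, LinearMap.smul_apply, LinearMap.id_apply]
  rw [Units.smul_def, ← Int.cast_smul_eq_zsmul k]
  rfl

/-- The cocycles of degree `n` of the graded pieces `gr n` of an ambient module `M`, with
differential `δ n` on the piece of degree `n`. -/
abbrev cocycles (gr : ℤ → Submodule k M) (δ : ℤ → M →ₗ[k] M) (n : ℤ) : Submodule k M :=
  gr n ⊓ LinearMap.ker (δ n)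

/-- The cohomology in degree `n`: cocycles in `gr n` modulo the image of `gr (n - 1)`. -/
abbrev gradedCohomology (gr : ℤ → Submodule k M) (δ : ℤ → M →ₗ[k] M) (n : ℤ) : Type v :=
  (cocycles gr δ n) ⧸
    ((gr (n - 1)).map (δ (n - 1))).comap (cocycles gr δ n).subtype

/-- The cohomology class of a cocycle. -/
abbrev cohClass (gr : ℤ → Submodule k M) (δ : ℤ → M →ₗ[k] M) (n : ℤ) (x : cocycles gr δ n) :
    gradedCohomology gr δ n :=
  Submodule.Quotient.mk x

end Graded

/-! ## Restricted graded Lie algebras -/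

section Lie

/-- The coefficient of `t ^ i` in `ad (t x + y) ^ n (x)`, for a bilinear bracket `br`. -/
def adCoeff {k : Type u} [CommRing k] {T : Type v} [AddCommGroup T] [Module k T]
    (br : T →ₗ[k] T →ₗ[k] T) (x y : T) : ℕ → ℕ → T
  | 0, 0 => x
  | 0, _ + 1 => 0
  | n + 1, 0 => br y (adCoeff br x y n 0)
  | n + 1, i + 1 => br x (adCoeff br x y n i) + br y (adCoeff br x y n (i + 1))

/-- Jacobson's Lie polynomial `s_i (x, y)` for `1 ≤ i < p`: `i` times it is the coefficient of
`t ^ (i - 1)` in `ad (t x + y) ^ (p - 1) (x)`. (The integer `i` is a unit when the ground ring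
has prime characteristic `p`.) -/
def jacobsonPoly {k : Type u} [CommRing k] (p : ℕ) {T : Type v} [AddCommGroup T] [Module k T]
    (br : T →ₗ[k] T →ₗ[k] T) (i : ℕ) (x y : T) : T :=
  Ring.inverse (i : k) • adCoeff br x y (p - 1) (i - 1)

/-- A restricted graded Lie algebra structure (for the prime `p`) on a `ℤ`-graded `k`-module
`L`: a graded Lie algebra, given by a bracket and a reduced square on odd elements, with a
`p`-power operation on even elements. Equations between elements of different graded pieces are
read in the total module `⨁ n, L n`. -/
@[ext]
structure RestrictedGradedLie (k : Type u) [CommRing k] (p : ℕ) (L : ℤ → Type v)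
    [∀ n, AddCommGroup (L n)] [∀ n, Module k (L n)] where
  /-- the bracket -/
  bracket : (⨁ n, L n) →ₗ[k] (⨁ n, L n) →ₗ[k] (⨁ n, L n)
  /-- the reduced square `x ↦ x^[2]` on elements of odd degree -/
  sq : ∀ n : ℤ, Odd n → L n → L (2 * n)
  /-- the `p`-power operation `x ↦ x^[p]` on elements of even degree -/
  pow : ∀ n : ℤ, Even n → L n → L (p * n)
  bracket_degree : ∀ (i j : ℤ) (x : L i) (y : L j), ∃ z : L (i + j),
    bracket (DirectSum.lof k ℤ L i x) (DirectSum.lof k ℤ L j y) = DirectSum.lof k ℤ L (i + j) z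
  bracket_antisymm : ∀ (i j : ℤ) (x : L i) (y : L j),
    bracket (DirectSum.lof k ℤ L i x) (DirectSum.lof k ℤ L j y)
      = -((i * j).negOnePow • bracket (DirectSum.lof k ℤ L j y) (DirectSum.lof k ℤ L i x))
  bracket_self : ∀ (i : ℤ), Even i → ∀ x : L i,
    bracket (DirectSum.lof k ℤ L i x) (DirectSum.lof k ℤ L i x) = 0
  jacobi : ∀ (i j l : ℤ) (x : L i) (y : L j) (z : L l),
    bracket (DirectSum.lof k ℤ L i x)
        (bracket (DirectSum.lof k ℤ L j y) (DirectSum.lof k ℤ L l z))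
      = bracket (bracket (DirectSum.lof k ℤ L i x) (DirectSum.lof k ℤ L j y))
          (DirectSum.lof k ℤ L l z)
        + (i * j).negOnePow • bracket (DirectSum.lof k ℤ L j y)
            (bracket (DirectSum.lof k ℤ L i x) (DirectSum.lof k ℤ L l z))
  jacobi_self : ∀ (i : ℤ), Odd i → ∀ x : L i,
    bracket (DirectSum.lof k ℤ L i x)
      (bracket (DirectSum.lof k ℤ L i x) (DirectSum.lof k ℤ L i x)) = 0
  sq_smul : ∀ (i : ℤ) (hi : Odd i) (a : k) (x : L i), sq i hi (a • x) = a ^ 2 • sq i hi x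
  sq_add : ∀ (i : ℤ) (hi : Odd i) (x y : L i),
    DirectSum.lof k ℤ L (2 * i) (sq i hi (x + y))
      = DirectSum.lof k ℤ L (2 * i) (sq i hi x) + DirectSum.lof k ℤ L (2 * i) (sq i hi y)
        + bracket (DirectSum.lof k ℤ L i x) (DirectSum.lof k ℤ L i y)
  bracket_sq : ∀ (i : ℤ) (hi : Odd i) (x : L i) (z : ⨁ n, L n),
    bracket (DirectSum.lof k ℤ L (2 * i) (sq i hi x)) z
      = bracket (DirectSum.lof k ℤ L i x) (bracket (DirectSum.lof k ℤ L i x) z)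
  pow_smul : ∀ (i : ℤ) (hi : Even i) (a : k) (x : L i), pow i hi (a • x) = a ^ p • pow i hi x
  /-- `ad (x^[p]) = (ad x) ^ p` -/
  bracket_pow : ∀ (i : ℤ) (hi : Even i) (x : L i) (z : ⨁ n, L n),
    bracket (DirectSum.lof k ℤ L (p * i) (pow i hi x)) z
      = (bracket (DirectSum.lof k ℤ L i x))^[p] z
  /-- `(x + y)^[p] = x^[p] + y^[p] + ∑_{0 < i < p} s_i (x, y)` -/
  pow_add : ∀ (i : ℤ) (hi : Even i) (x y : L i),
    DirectSum.lof k ℤ L (p * i) (pow i hi (x + y))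
      = DirectSum.lof k ℤ L (p * i) (pow i hi x) + DirectSum.lof k ℤ L (p * i) (pow i hi y)
        + ∑ j ∈ Finset.Ico 1 p,
            jacobsonPoly p bracket j (DirectSum.lof k ℤ L i x) (DirectSum.lof k ℤ L i y)

/-- A degree-preserving linear map `f` is a homomorphism of restricted graded Lie algebras: it
preserves the bracket, the reduced square and the `p`-power operation. -/
structure IsRestrictedLieHom {k : Type u} [CommRing k] {p : ℕ} {L : ℤ → Type v} {L' : ℤ → Type w}
    [∀ n, AddCommGroup (L n)] [∀ n, Module k (L n)]
    [∀ n, AddCommGroup (L' n)] [∀ n, Module k (L' n)]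
    (R : RestrictedGradedLie k p L) (S : RestrictedGradedLie k p L')
    (f : ∀ n, L n →ₗ[k] L' n) : Prop where
  map_bracket : ∀ x y : ⨁ n, L n,
    DirectSum.lmap f (R.bracket x y) = S.bracket (DirectSum.lmap f x) (DirectSum.lmap f y)
  map_sq : ∀ (n : ℤ) (hn : Odd n) (x : L n), f (2 * n) (R.sq n hn x) = S.sq n hn (f n x)
  map_pow : ∀ (n : ℤ) (hn : Even n) (x : L n), f (p * n) (R.pow n hn x) = S.pow n hn (f n x)

/-- The restricted graded Lie structure `R` on the cohomology of `(gr, δ)` is the one given on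
cocycles by the following formulas, all of which are required to produce cocycles:
* `[x, y] = x ∘ y - (-1)^{|x||y|} y ∘ x`, where `x ∘ y = circ |y| x y`;
* `x^[2] = x ∘ x` for `|x|` odd;
* `x^[p] = pw |x| x` for `|x|` even. -/
structure IsInducedBy {k : Type u} [CommRing k] {p : ℕ} {M : Type v} [AddCommGroup M] [Module k M]
    {gr : ℤ → Submodule k M} {δ : ℤ → M →ₗ[k] M}
    (R : RestrictedGradedLie k p (gradedCohomology gr δ))
    (circ : ℤ → M → M → M) (pw : ℤ → M → M) : Prop where
  bracket : ∀ (i j : ℤ) (x : cocycles gr δ i) (y : cocycles gr δ j),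
    ∃ h : circ j x y - (i * j).negOnePow • circ i y x ∈ cocycles gr δ (i + j),
      R.bracket (DirectSum.lof k ℤ (gradedCohomology gr δ) i (cohClass gr δ i x))
          (DirectSum.lof k ℤ (gradedCohomology gr δ) j (cohClass gr δ j y))
        = DirectSum.lof k ℤ (gradedCohomology gr δ) (i + j) (cohClass gr δ (i + j) ⟨_, h⟩)
  sq : ∀ (n : ℤ) (hn : Odd n) (x : cocycles gr δ n),
    ∃ h : circ n x x ∈ cocycles gr δ (2 * n),
      R.sq n hn (cohClass gr δ n x) = cohClass gr δ (2 * n) ⟨_, h⟩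
  pow : ∀ (n : ℤ) (hn : Even n) (x : cocycles gr δ n),
    ∃ h : pw n x ∈ cocycles gr δ (p * n),
      R.pow n hn (cohClass gr δ n x) = cohClass gr δ (p * n) ⟨_, h⟩

/-- The degreewise linear maps `f` between the cohomologies of `(gr, δ)` and `(gr', δ')` are
induced by the map `F` on representatives (in particular `F` sends cocycles to cocycles). -/
def IsInducedMap {k : Type u} [CommRing k] {M : Type v} [AddCommGroup M] [Module k M]
    {M' : Type w} [AddCommGroup M'] [Module k M']
    {gr : ℤ → Submodule k M} {δ : ℤ → M →ₗ[k] M} {gr' : ℤ → Submodule k M'} {δ' : ℤ → M' →ₗ[k] M'}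
    (f : ∀ n, gradedCohomology gr δ n →ₗ[k] gradedCohomology gr' δ' n) (F : M → M') : Prop :=
  ∀ (n : ℤ) (x : cocycles gr δ n), ∃ h : F x ∈ cocycles gr' δ' n,
    f n (cohClass gr δ n x) = cohClass gr' δ' n ⟨_, h⟩

end Lie

/-! ## The bar construction and `B_∞`-algebras -/

section Bar

variable (k : Type u) [CommRing k] (C : Type v) [AddCommGroup C] [Module k C]

/-- The auxiliary algebra map that records how left multiplication by a tensor acts on pairs
`(Δ a, a)`: a letter `x` acts by `(t, a) ↦ ((x ⊗ 1) t + 1 ⊗ x a, x a)`. -/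
def deconcatAux : TensorAlgebra k C →ₐ[k]
    Module.End k ((TensorAlgebra k C ⊗[k] TensorAlgebra k C) × TensorAlgebra k C) :=
  TensorAlgebra.lift k
    { toFun := fun x =>
        LinearMap.inl k _ _ ∘ₗ LinearMap.rTensorHom (TensorAlgebra k C)
            (LinearMap.mul k (TensorAlgebra k C) (TensorAlgebra.ι k x)) ∘ₗ LinearMap.fst k _ _
          + LinearMap.inl k _ _ ∘ₗ TensorProduct.mk k (TensorAlgebra k C) (TensorAlgebra k C) 1 ∘ₗ
            LinearMap.mul k (TensorAlgebra k C) (TensorAlgebra.ι k x) ∘ₗ LinearMap.snd k _ _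
          + LinearMap.inr k _ _ ∘ₗ
            LinearMap.mul k (TensorAlgebra k C) (TensorAlgebra.ι k x) ∘ₗ LinearMap.snd k _ _
      map_add' := fun x y => by
        simp only [map_add, LinearMap.add_comp, LinearMap.comp_add]
        abel
      map_smul' := fun c x => by
        simp only [map_smul, LinearMap.smul_comp, LinearMap.comp_smul, smul_add, RingHom.id_apply] }

/-- The deconcatenation coproduct `Δ (x_1 ⋯ x_n) = ∑_i (x_1 ⋯ x_i) ⊗ (x_{i+1} ⋯ x_n)` of the
tensor coalgebra; see `deconcat_prod`. -/
def deconcat : TensorAlgebra k C →ₗ[k] TensorAlgebra k C ⊗[k] TensorAlgebra k C where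
  toFun a := (deconcatAux k C a (1 ⊗ₜ 1, 1)).1
  map_add' a b := by simp
  map_smul' c a := by simp

theorem deconcatAux_snd (w : List C) :
    (deconcatAux k C (w.map (TensorAlgebra.ι k)).prod (1 ⊗ₜ 1, 1)).2
      = (w.map (TensorAlgebra.ι k)).prod := by
  induction w with
  | nil => simp
  | cons x w ih =>
    rw [List.map_cons, List.prod_cons, map_mul, Module.End.mul_apply]
    simp [deconcatAux] at ih ⊢
    rw [ih]

theorem deconcat_prod (w : List C) :
    deconcat k C (w.map (TensorAlgebra.ι k)).prod
      = ∑ i ∈ Finset.range (w.length + 1),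
          ((w.take i).map (TensorAlgebra.ι k)).prod ⊗ₜ[k]
            ((w.drop i).map (TensorAlgebra.ι k)).prod := by
  induction w with
  | nil => simp [deconcat]
  | cons x w ih =>
    have h2 := deconcatAux_snd k C w
    rw [List.length_cons, Finset.sum_range_succ']
    simp only [List.take_succ_cons, List.drop_succ_cons, List.map_cons, List.prod_cons,
      List.take_zero, List.drop_zero, List.map_nil, List.prod_nil]
    have h1 : (deconcatAux k C (w.map (TensorAlgebra.ι k)).prod (1 ⊗ₜ 1, 1)).1 = _ := ih
    change (deconcatAux k C (TensorAlgebra.ι k x * (w.map (TensorAlgebra.ι k)).prod)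
      (1 ⊗ₜ 1, 1)).1 = _
    rw [map_mul, Module.End.mul_apply]
    generalize deconcatAux k C (w.map (TensorAlgebra.ι k)).prod (1 ⊗ₜ 1, 1) = z at h1 h2
    obtain ⟨t, a⟩ := z
    simp only at h1 h2
    subst h1 h2
    simp [deconcatAux, map_sum]

variable {k C}

/-- Homogeneous words in the letters of `ΣC`: a letter of degree `n` in `ΣC` is an element of
degree `n + 1` of `C` (cohomological grading). -/
abbrev HomWord (gr : ℤ → Submodule k C) : Type v := List (Σ n : ℤ, gr (n + 1))

/-- The element `[x_1 | ⋯ | x_n]` of the bar construction `⨁ n, (ΣC)^{⊗ n}`. -/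
def HomWord.toBar {gr : ℤ → Submodule k C} (w : HomWord gr) : TensorAlgebra k C :=
  (w.map fun l => TensorAlgebra.ι k (l.2 : C)).prod

/-- The degree of a word: the sum of the degrees of its letters in `ΣC`. -/
def HomWord.deg {gr : ℤ → Submodule k C} (w : HomWord gr) : ℤ := (w.map fun l => l.1).sum

/-- The homogeneous elements of degree `n` of the bar construction. -/
def barGr (gr : ℤ → Submodule k C) (n : ℤ) : Submodule k (TensorAlgebra k C) :=
  Submodule.span k {a | ∃ w : HomWord gr, w.deg = n ∧ w.toBar = a}

/-- A `B_∞`-algebra structure on the graded module `C = ⨁ n, gr n` (cohomological grading): a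
product `hmul` and a differential `d` on the bar construction `BC = ⨁ n, (ΣC)^{⊗ n}`, with its
deconcatenation coproduct, its counit and its unit `1 ∈ (ΣC)^{⊗ 0}`, that make `BC` a differential
graded bialgebra. (Being connected, `BC` then has an antipode, so that it is a dg Hopf algebra.)
The underlying module of `BC` is that of the tensor algebra of `C`; the multiplication of that
algebra is concatenation of words and is not the product `hmul`. -/
structure BInfStructure (k : Type u) [CommRing k] {C : Type v} [AddCommGroup C] [Module k C]
    (gr : ℤ → Submodule k C) where
  /-- the product of `BC` -/
  hmul : TensorAlgebra k C →ₗ[k] TensorAlgebra k C →ₗ[k] TensorAlgebra k C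
  /-- the differential of `BC` -/
  d : TensorAlgebra k C →ₗ[k] TensorAlgebra k C
  hmul_mem : ∀ (i j : ℤ), ∀ a ∈ barGr gr i, ∀ b ∈ barGr gr j, hmul a b ∈ barGr gr (i + j)
  one_hmul : ∀ a, hmul 1 a = a
  hmul_one : ∀ a, hmul a 1 = a
  hmul_assoc : ∀ a b c, hmul (hmul a b) c = hmul a (hmul b c)
  counit_hmul : ∀ a b, TensorAlgebra.algebraMapInv (hmul a b)
    = TensorAlgebra.algebraMapInv a * TensorAlgebra.algebraMapInv b
  /-- the coproduct is multiplicative, with the Koszul sign -/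
  comul_hmul : ∀ u v : HomWord gr, deconcat k C (hmul u.toBar v.toBar)
    = ∑ i ∈ Finset.range (u.length + 1), ∑ j ∈ Finset.range (v.length + 1),
        (HomWord.deg (u.drop i) * HomWord.deg (v.take j)).negOnePow •
          (hmul (HomWord.toBar (u.take i)) (HomWord.toBar (v.take j)) ⊗ₜ[k]
            hmul (HomWord.toBar (u.drop i)) (HomWord.toBar (v.drop j)))
  d_mem : ∀ (i : ℤ), ∀ a ∈ barGr gr i, d a ∈ barGr gr (i + 1)
  d_d : ∀ a, d (d a) = 0
  counit_d : ∀ a, TensorAlgebra.algebraMapInv (d a) = 0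
  /-- `d` is a coderivation -/
  comul_d : ∀ u : HomWord gr, deconcat k C (d u.toBar)
    = ∑ i ∈ Finset.range (u.length + 1),
        (d (HomWord.toBar (u.take i)) ⊗ₜ[k] HomWord.toBar (u.drop i)
          + (HomWord.deg (u.take i)).negOnePow •
              (HomWord.toBar (u.take i) ⊗ₜ[k] d (HomWord.toBar (u.drop i))))
  /-- `d` is a derivation -/
  d_hmul : ∀ (u : HomWord gr) (b : TensorAlgebra k C), d (hmul u.toBar b)
    = hmul (d u.toBar) b + u.deg.negOnePow • hmul u.toBar (d b)

namespace BInfStructure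

variable {gr : ℤ → Submodule k C}

/-- The graded pieces of `ΣC`. -/
abbrev sgr (_X : BInfStructure k gr) (n : ℤ) : Submodule k C := gr (n + 1)

/-- The differential of `ΣC`: the restriction of the differential of `BC` to words of length
one, followed by the projection to words of length one. -/
def m₁ (X : BInfStructure k gr) : C →ₗ[k] C :=
  TensorAlgebra.ιInv ∘ₗ X.d ∘ₗ TensorAlgebra.ι k

/-- The shifted cohomology `(ΣH(C))^n = H^{n+1}(C)`. -/
abbrev shiftedCohomology (X : BInfStructure k gr) (n : ℤ) : Type v :=
  gradedCohomology X.sgr (fun _ => X.m₁) n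

/-- The circle product `x ∘ y = x{y}`: the component of `[x] * [y]` in `ΣC`. -/
def circ (X : BInfStructure k gr) (x y : C) : C :=
  TensorAlgebra.ιInv (X.hmul (TensorAlgebra.ι k x) (TensorAlgebra.ι k y))

/-- The powers of `[x]` for the product of `BC`. -/
def barPow (X : BInfStructure k gr) (x : C) : ℕ → TensorAlgebra k C
  | 0 => 1
  | n + 1 => X.hmul (barPow X x n) (TensorAlgebra.ι k x)

/-- The component in `ΣC` of the `n`-th power of `[x]` in `BC`. -/
def power (X : BInfStructure k gr) (n : ℕ) (x : C) : C := TensorAlgebra.ιInv (X.barPow x n)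

/-- The iterated circle product `((x ∘ x) ∘ ⋯) ∘ x` with `n + 1` occurrences of `x`. -/
def iterCirc (X : BInfStructure k gr) (x : C) : ℕ → C
  | 0 => x
  | n + 1 => X.circ (iterCirc X x n) x

/-- The product of `BC` comes from brace operations `x{y_1, …, y_s}` alone: the component in `ΣC`
of the product of a word of length at least two with a nonempty word vanishes. -/
def IsBrace (X : BInfStructure k gr) : Prop :=
  ∀ u v : HomWord gr, 2 ≤ u.length → 1 ≤ v.length →
    TensorAlgebra.ιInv (X.hmul u.toBar v.toBar) = 0

/-- The restricted graded Lie structure `R` on `ΣH(C)` is the one induced by the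
`B_∞`-structure: `[x, y] = x ∘ y - (-1)^{|x||y|} y ∘ x`, `x^[2] = x ∘ x`, and `x^[p]` is the
`p`-th power of the primitive element `[x]` in the algebra `BC`. -/
def Induces (X : BInfStructure k gr) {p : ℕ} (R : RestrictedGradedLie k p X.shiftedCohomology) :
    Prop :=
  IsInducedBy R (fun _ => X.circ) (fun _ => X.power p)

end BInfStructure

/-- A map of `B_∞`-algebras from `C` to `D`: a map of dg bialgebras `BC → BD`. -/
structure BInfHom {k : Type u} [CommRing k] {C : Type v} [AddCommGroup C] [Module k C]
    {D : Type w} [AddCommGroup D] [Module k D]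
    {gr : ℤ → Submodule k C} {gr' : ℤ → Submodule k D}
    (X : BInfStructure k gr) (Y : BInfStructure k gr') where
  /-- the map of bar constructions -/
  toFun : TensorAlgebra k C →ₗ[k] TensorAlgebra k D
  map_mem : ∀ (i : ℤ), ∀ a ∈ barGr gr i, toFun a ∈ barGr gr' i
  map_one : toFun 1 = 1
  map_hmul : ∀ a b, toFun (X.hmul a b) = Y.hmul (toFun a) (toFun b)
  map_counit : ∀ a, TensorAlgebra.algebraMapInv (toFun a) = TensorAlgebra.algebraMapInv a
  map_comul : ∀ a, deconcat k D (toFun a) = TensorProduct.map toFun toFun (deconcat k C a)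
  map_d : ∀ a, toFun (X.d a) = Y.d (toFun a)

/-- The linear part `C → D` of a map of `B_∞`-algebras, which is the map of complexes that
induces the map on cohomology. -/
def BInfHom.linearPart {k : Type u} [CommRing k] {C : Type v} [AddCommGroup C] [Module k C]
    {D : Type w} [AddCommGroup D] [Module k D]
    {gr : ℤ → Submodule k C} {gr' : ℤ → Submodule k D}
    {X : BInfStructure k gr} {Y : BInfStructure k gr'} (F : BInfHom X Y) : C →ₗ[k] D :=
  TensorAlgebra.ιInv ∘ₗ F.toFun ∘ₗ TensorAlgebra.ι k

end Bar

/-! ## Dg categories and their Hochschild cochains -/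

/-- A small `k`-linear dg category. The complex of morphisms from `a` to `b` is `Hom b a` (target
first), with its internal grading `gr b a` and its differential `d` of degree one. -/
structure DGCat (k : Type u) [CommRing k] where
  Obj : Type v
  Hom : Obj → Obj → Type w
  [addCommGroup : ∀ b a, AddCommGroup (Hom b a)]
  [module : ∀ b a, Module k (Hom b a)]
  gr : ∀ b a, ℤ → Submodule k (Hom b a)
  isInternal : ∀ b a, DirectSum.IsInternal (gr b a)
  d : ∀ {b a}, Hom b a →ₗ[k] Hom b a
  d_mem : ∀ {b a} (i : ℤ), ∀ f ∈ gr b a i, d f ∈ gr b a (i + 1)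
  d_d : ∀ {b a} (f : Hom b a), d (d f) = 0
  /-- composition `f, g ↦ f g` (first `g`, then `f`) -/
  comp : ∀ {c b a}, Hom c b →ₗ[k] Hom b a →ₗ[k] Hom c a
  comp_mem : ∀ {c b a} (i j : ℤ), ∀ f ∈ gr c b i, ∀ g ∈ gr b a j, comp f g ∈ gr c a (i + j)
  id : ∀ a, Hom a a
  id_mem : ∀ a, id a ∈ gr a a 0
  id_comp : ∀ {b a} (f : Hom b a), comp (id b) f = f
  comp_id : ∀ {b a} (f : Hom b a), comp f (id a) = f
  assoc : ∀ {e c b a} (f : Hom e c) (g : Hom c b) (h : Hom b a),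
    comp (comp f g) h = comp f (comp g h)
  leibniz : ∀ {c b a} (i : ℤ), ∀ f ∈ gr c b i, ∀ g : Hom b a,
    d (comp f g) = comp (d f) g + i.negOnePow • comp f (d g)

attribute [instance] DGCat.addCommGroup DGCat.module

namespace DGCat

variable {k : Type u} [CommRing k]

/-- Strings of composable morphisms: the elements `f_1, …, f_r` of
`Hom a_0 a_1, Hom a_1 a_2, …, Hom a_{r-1} a_r`, for arbitrary objects in between. -/
inductive Str (A : DGCat.{u, v, w} k) : A.Obj → A.Obj → Type (max v w)
  | nil (a : A.Obj) : Str A a a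
  | cons {a b c : A.Obj} (f : A.Hom a b) (s : Str A b c) : Str A a c

variable {A : DGCat.{u, v, w} k}

/-- Concatenation of strings. -/
def Str.append {a b c : A.Obj} : A.Str a b → A.Str b c → A.Str a c
  | .nil _, t => t
  | .cons f s, t => .cons f (s.append t)

/-- All the ways to cut a string in two. -/
def Str.cuts {a c : A.Obj} : A.Str a c → List (Σ b : A.Obj, A.Str a b × A.Str b c)
  | .nil a => [⟨a, .nil a, .nil a⟩]
  | .cons f s => ⟨_, .nil _, .cons f s⟩ :: s.cuts.map fun z => ⟨z.1, .cons f z.2.1, z.2.2⟩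

/-- Multiply each entry `f` of a string by the sign `ε i`, where `i` is the degree of `f`. -/
def Str.signed {a b : A.Obj} (ε : ℤ → ℤˣ) : A.Str a b → A.Str a b
  | .nil a => .nil a
  | .cons f s => .cons (gradedSign _ (A.isInternal _ _) ε f) (s.signed ε)

/-- `s.HasDeg e`: the entries of `s` are homogeneous, of degrees `i_1, …, i_r` with
`e = ∑ (i_j - 1)`. -/
inductive Str.HasDeg : ∀ {a b : A.Obj}, A.Str a b → ℤ → Prop
  | nil (a : A.Obj) : HasDeg (.nil a) 0
  | cons {a b c : A.Obj} (i e : ℤ) (f : A.Hom a b) (s : A.Str b c) (hf : f ∈ A.gr a b i)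
      (hs : HasDeg s e) : HasDeg (.cons f s) (i - 1 + e)

/-- Families of functions that send each string from `a` to `b` to an element of `Hom a b`. The
Hochschild cochains are among these. -/
abbrev PreCochain (A : DGCat.{u, v, w} k) : Type (max v w) :=
  ∀ a b : A.Obj, A.Str a b → A.Hom a b

/-- The family `x` is linear in each entry of the string. -/
def IsMultilinear (x : A.PreCochain) : Prop :=
  ∀ (a b c e : A.Obj) (s : A.Str a b) (t : A.Str c e) (r : k) (f g : A.Hom b c),
    x a e (s.append (.cons (r • f + g) t))
      = r • x a e (s.append (.cons f t)) + x a e (s.append (.cons g t))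

/-- The Hochschild cochains of degree `n` for the shifted grading, that is, the module
`(ΣC)^n = C^{n+1}(A, A)`. Such a cochain is a family of multilinear maps, one for each sequence
`a_0, …, a_r` of objects, of `r` morphisms with values in `Hom a_0 a_r`, which raises the degree
by `n + 1 - r`. -/
def shiftedCochains (A : DGCat.{u, v, w} k) (n : ℤ) : Submodule k A.PreCochain where
  carrier := {x | IsMultilinear x ∧ ∀ (a b : A.Obj) (s : A.Str a b) (e : ℤ), s.HasDeg e →
    x a b s ∈ A.gr a b (e + n + 1)}
  add_mem' := by
    rintro x y ⟨hx, hx'⟩ ⟨hy, hy'⟩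
    refine ⟨fun a b c e s t r f g => ?_, fun a b s e h => ?_⟩
    · simp only [Pi.add_apply, hx a b c e, hy a b c e, smul_add]
      abel
    · exact Submodule.add_mem _ (hx' a b s e h) (hy' a b s e h)
  zero_mem' := ⟨fun a b c e s t r f g => by simp, fun a b s e h => Submodule.zero_mem _⟩
  smul_mem' := by
    rintro α x ⟨hx, hx'⟩
    refine ⟨fun a b c e s t r f g => ?_, fun a b s e h => ?_⟩
    · simp only [Pi.smul_apply, hx a b c e, smul_add, smul_comm α r]
    · exact Submodule.smul_mem _ _ (hx' a b s e h)

/-- The circle product `x ∘ y`, where `y` has degree `n` in the shifted grading. On a string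
`f_1, …, f_r` it is the sum over all substrings of
`(-1)^{n ∑_{l ≤ j} (|f_l| - 1)} x(f_1, …, f_j, y(f_{j+1}, …, f_{j+s}), f_{j+s+1}, …, f_r)`. -/
def circ (n : ℤ) (x y : A.PreCochain) : A.PreCochain := fun a b s =>
  (s.cuts.map fun z => (z.2.2.cuts.map fun z' =>
    x a b ((z.2.1.signed fun i => (n * (i - 1)).negOnePow).append
      (.cons (y z.1 z'.1 z'.2.1) z'.2.2))).sum).sum

/-- The structure cochain `m` of the dg category, of degree one in the shifted grading:
`m(f) = d f`, `m(f, g) = (-1)^{|f|} f g`, and `m` vanishes on strings of other lengths. -/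
def structureCochain (A : DGCat.{u, v, w} k) : A.PreCochain := fun _ _ s =>
  match s with
  | .nil _ => 0
  | .cons f (.nil _) => A.d f
  | .cons f (.cons g (.nil _)) =>
      A.comp (gradedSign _ (A.isInternal _ _) (fun i => i.negOnePow) f) g
  | .cons _ (.cons _ (.cons _ _)) => 0

theorem structureCochain_isMultilinear (A : DGCat.{u, v, w} k) :
    IsMultilinear A.structureCochain := by
  intro a b c e s t r f g
  cases s with
  | nil =>
    cases t with
    | nil => simp [Str.append, structureCochain]
    | cons f' t =>
      cases t with
      | nil => simp [Str.append, structureCochain]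
      | cons f'' t => simp [Str.append, structureCochain]
  | cons f' s =>
    cases s with
    | nil =>
      cases t with
      | nil => simp [Str.append, structureCochain]
      | cons f'' t => simp [Str.append, structureCochain]
    | cons f'' s =>
      cases s with
      | nil => simp [Str.append, structureCochain]
      | cons f''' s => simp [Str.append, structureCochain]

theorem list_sum_map_smul_add {ι M : Type*} [AddCommGroup M] [Module k M] (l : List ι) (r : k)
    (F G : ι → M) :
    (l.map fun i => r • F i + G i).sum = r • (l.map F).sum + (l.map G).sum := by
  induction l with
  | nil => simp
  | cons i l ih => simp only [List.map_cons, List.sum_cons, ih, smul_add]; abel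

theorem circ_linear_right (n : ℤ) (x y z : A.PreCochain) (hx : IsMultilinear x) (r : k) :
    circ n x (r • y + z) = r • circ n x y + circ n x z := by
  funext a b s
  simp only [circ, Pi.add_apply, Pi.smul_apply]
  rw [← list_sum_map_smul_add]
  congr 1
  refine List.map_congr_left fun q _ => ?_
  rw [← list_sum_map_smul_add]
  congr 1
  exact List.map_congr_left fun q' _ => hx _ _ _ _ _ _ _ _ _

theorem circ_linear_left (n : ℤ) (x y z : A.PreCochain) (r : k) :
    circ n (r • x + y) z = r • circ n x z + circ n y z := by
  funext a b s
  simp only [circ, Pi.add_apply, Pi.smul_apply]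
  rw [← list_sum_map_smul_add]
  congr 1
  refine List.map_congr_left fun q _ => ?_
  rw [← list_sum_map_smul_add]

/-- The Hochschild differential `∂ x = m ∘ x - (-1)^n x ∘ m` on cochains `x` of degree `n` in the
shifted grading. -/
def hochschildD (A : DGCat.{u, v, w} k) (n : ℤ) : A.PreCochain →ₗ[k] A.PreCochain where
  toFun x := circ n A.structureCochain x - n.negOnePow • circ 1 x A.structureCochain
  map_add' x y := by
    have h1 := circ_linear_right n A.structureCochain x y A.structureCochain_isMultilinear 1
    have h2 := circ_linear_left 1 x y A.structureCochain 1
    simp only [one_smul] at h1 h2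
    rw [h1, h2, smul_add]
    abel
  map_smul' r x := by
    have h0 := circ_linear_right n A.structureCochain 0 0 A.structureCochain_isMultilinear 1
    have h0' := circ_linear_left 1 0 0 A.structureCochain 1
    have h1 := circ_linear_right n A.structureCochain x 0 A.structureCochain_isMultilinear r
    have h2 := circ_linear_left 1 x 0 A.structureCochain r
    simp only [one_smul, add_zero, left_eq_add] at h0 h0'
    simp only [add_zero, h0, h0'] at h1 h2
    rw [h1, h2, smul_sub, RingHom.id_apply, smul_comm r]

/-- The shifted Hochschild cohomology `(ΣHH(A, A))^n = HH^{n+1}(A, A)`. -/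
abbrev shiftedHH (A : DGCat.{u, v, w} k) (n : ℤ) : Type (max v w) :=
  gradedCohomology A.shiftedCochains A.hochschildD n

/-- The iterated circle product `((x ∘ x) ∘ ⋯) ∘ x` with `m + 1` occurrences of `x`, where `x`
has degree `n` in the shifted grading. -/
def iterCirc (n : ℤ) (x : A.PreCochain) : ℕ → A.PreCochain
  | 0 => x
  | m + 1 => circ n (iterCirc n x m) x

/-- The restricted graded Lie structure `R` on `ΣHH(A, A)` is the one given on cocycles by the
Gerstenhaber bracket `[x, y] = x ∘ y - (-1)^{|x||y|} y ∘ x`, the reduced square `x^[2] = x ∘ x`,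
and the `p`-power operation `x^[p] = ((x ∘ x) ∘ ⋯) ∘ x` (with `p` occurrences of `x`). -/
def IsGerstenhaber (A : DGCat.{u, v, w} k) {p : ℕ} (R : RestrictedGradedLie k p A.shiftedHH) :
    Prop :=
  IsInducedBy R circ (fun n x => iterCirc n x (p - 1))

end DGCat

/-- A dg functor. -/
structure DGFunctor {k : Type u} [CommRing k] (A : DGCat.{u, v, w} k) (B : DGCat.{u, v', w'} k) where
  obj : A.Obj → B.Obj
  map : ∀ {b a : A.Obj}, A.Hom b a →ₗ[k] B.Hom (obj b) (obj a)
  map_mem : ∀ {b a : A.Obj} (i : ℤ), ∀ f ∈ A.gr b a i, map f ∈ B.gr (obj b) (obj a) i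
  map_d : ∀ {b a : A.Obj} (f : A.Hom b a), map (A.d f) = B.d (map f)
  map_id : ∀ a : A.Obj, map (A.id a) = B.id (obj a)
  map_comp : ∀ {c b a : A.Obj} (f : A.Hom c b) (g : A.Hom b a),
    map (A.comp f g) = B.comp (map f) (map g)

namespace DGFunctor

variable {k : Type u} [CommRing k] {A : DGCat.{u, v, w} k} {B : DGCat.{u, v', w'} k}

/-- A dg functor is fully faithful if it is bijective on complexes of morphisms. -/
def FullyFaithful (φ : DGFunctor A B) : Prop :=
  ∀ b a : A.Obj, Function.Bijective (φ.map : A.Hom b a →ₗ[k] B.Hom (φ.obj b) (φ.obj a))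

/-- The image of a string of composable morphisms. -/
def mapStr (φ : DGFunctor A B) {a b : A.Obj} : A.Str a b → B.Str (φ.obj a) (φ.obj b)
  | .nil a => .nil (φ.obj a)
  | .cons f s => .cons (φ.map f) (φ.mapStr s)

/-- The restriction `φ^*` of Hochschild cochains along a fully faithful dg functor:
`(φ^* x)(f_1, …, f_r) = φ⁻¹ (x (φ f_1, …, φ f_r))`. -/
def restrict (φ : DGFunctor A B) (hφ : φ.FullyFaithful) (x : B.PreCochain) : A.PreCochain :=
  fun a b s => (LinearEquiv.ofBijective φ.map (hφ a b)).symm (x (φ.obj a) (φ.obj b) (φ.mapStr s))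

end DGFunctor

end

/-!
# Restricted Lie structures on the cohomology of `B_∞`-algebras and of Hochschild cochains

In an associative graded algebra `U` over a ring of characteristic `p`, the graded commutator, the
square of odd elements and the `p`-th power of even elements form a restricted graded Lie algebra;
the only identities that are not immediate are `[x ^ p, z] = (ad x) ^ p z` (`Commute.sub_pow_prime`)
and Jacobson's formula for `(x + y) ^ p` (`add_pow_char_eq_add_jacobsonPoly`). Both parts of the
theorem are reduced to this case. An `AssocModel` embeds each graded piece of a complex in such a
`U` so that the differential is the commutator with an element `μ` and the bracket, the square and
the `p`-th power become those of `U`. All identities then hold on cocycles, and the operations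
descend to cohomology once squares and `p`-th powers of boundaries are known to be boundaries
(`AssocModel.existsUnique`). Maps compatible with the operations induce homomorphisms
(`exists_isInducedMap`).

For a `B_∞`-algebra `C`, the algebra `U` consists of the endomorphisms of `BC`, and an element `x`
of `C` acts by `*`-multiplication with the letter `[x]`. Letters are exactly the primitive elements
of `BC` (`eq_ι_of_primitive`). Graded commutators and squares of odd letters are primitive, and so
are `p`-th powers of even letters, because the binomial coefficients in the coproduct of a `p`-th
power vanish (`binomConv_prime`).

For Hochschild cochains, a cochain `x` acts on multilinear functions of strings of morphisms by
summing over all insertions of `x` (`insL`). With coefficients in the opposite algebra this action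
is an embedding, since the identity cochain returns `x`. It is determined by a Leibniz rule for the
splitting of strings together with its value on the identity (`eq_insL`), and as commutators, odd
squares and `p`-th powers of such operators satisfy a rule of the same form, they are again
insertion operators (`insL_bracket`, `insL_sq`, `insL_pow`).

There remain the boundaries. For the square of an odd boundary `a = ∂y` a primitive is written down
explicitly (`BInfStructure.circ_m₁_mem`, `DGCat.circ_hochschildD_mem`). For the `p`-th power of an
even boundary `a = ∂y`, consider the exponential generating function `g` of the powers of `a` and
the series `h` which it makes out of `y`. They satisfy a linear differential equation
`g' = G h + H g`, in which `G` deforms the differential and `G' = G H + H G`. If `u` solves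
`u' = h - H u` with `u 0 = 0`, then `g - G u` solves a homogeneous linear equation with zero initial
value, hence `g = G u` (`holonomy`, `eq_binomConv_holonomy`). Comparing coefficients of index `p`,
where only the extreme terms of a binomial convolution survive and `u 0 = 0`, shows that the `p`-th
power of `∂y` is `∂ u_p` (`BInfStructure.power_m₁_mem`, `DGCat.iterCirc_hochschildD_mem`). Working
with sequences of coefficients in place of power series avoids dividing by factorials.
-/

noncomputable section

/-! ### Binomial convolution -/

section Convolution

variable {k : Type*} [CommRing k] {P Q N : Type*} [AddCommGroup P] [Module k P]
  [AddCommGroup Q] [Module k Q] [AddCommGroup N] [Module k N]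

/-- The binomial convolution `n ↦ ∑ i, (n choose i) • B (a i) (b (n - i))` of two sequences along
a bilinear map, that is, the product of exponential generating functions. It is defined by the
product rule for the shift; see `binomConv_eq_sum`. -/
def binomConv (B : P →ₗ[k] Q →ₗ[k] N) : (ℕ → P) → (ℕ → Q) → ℕ → N
  | a, b, 0 => B (a 0) (b 0)
  | a, b, n + 1 => binomConv B (fun i => a (i + 1)) b n + binomConv B a (fun i => b (i + 1)) n

theorem binomConv_eq_sum (B : P →ₗ[k] Q →ₗ[k] N) (a : ℕ → P) (b : ℕ → Q) (n : ℕ) :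
    binomConv B a b n
      = ∑ i ∈ Finset.HasAntidiagonal.antidiagonal n, n.choose i.1 • B (a i.1) (b i.2) := by
  induction n generalizing a b with
  | zero => simp [binomConv]
  | succ n ih =>
    rw [binomConv, ih, ih, Finset.sum_antidiagonal_choose_succ_nsmul (fun i j => B (a i) (b j)),
      add_comm]
    congr 1
    refine Finset.sum_congr rfl fun i hi => ?_
    rw [Nat.choose_symm_of_eq_add (Finset.HasAntidiagonal.mem_antidiagonal.mp hi).symm]

theorem binomConv_congr {P' Q' : Type*} [AddCommGroup P'] [Module k P']
    [AddCommGroup Q'] [Module k Q'] (B : P →ₗ[k] Q →ₗ[k] N) (B' : P' →ₗ[k] Q' →ₗ[k] N)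
    (a : ℕ → P) (b : ℕ → Q) (a' : ℕ → P') (b' : ℕ → Q') (n : ℕ)
    (h : ∀ i j, i + j = n → B (a i) (b j) = B' (a' i) (b' j)) :
    binomConv B a b n = binomConv B' a' b' n := by
  rw [binomConv_eq_sum, binomConv_eq_sum]
  exact Finset.sum_congr rfl fun i hi => by
    rw [h _ _ (Finset.HasAntidiagonal.mem_antidiagonal.mp hi)]

theorem binomConv_add_left (B : P →ₗ[k] Q →ₗ[k] N) (a a' : ℕ → P) (b : ℕ → Q) (n : ℕ) :
    binomConv B (fun i => a i + a' i) b n = binomConv B a b n + binomConv B a' b n := by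
  simp only [binomConv_eq_sum, map_add, LinearMap.add_apply, smul_add, Finset.sum_add_distrib]

theorem binomConv_add_right (B : P →ₗ[k] Q →ₗ[k] N) (a : ℕ → P) (b b' : ℕ → Q) (n : ℕ) :
    binomConv B a (fun i => b i + b' i) n = binomConv B a b n + binomConv B a b' n := by
  simp only [binomConv_eq_sum, map_add, smul_add, Finset.sum_add_distrib]

theorem binomConv_sub_right (B : P →ₗ[k] Q →ₗ[k] N) (a : ℕ → P) (b b' : ℕ → Q) (n : ℕ) :
    binomConv B a (fun i => b i - b' i) n = binomConv B a b n - binomConv B a b' n := by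
  simp only [binomConv_eq_sum, map_sub, smul_sub, Finset.sum_sub_distrib]

theorem binomConv_assoc {R S O : Type*} [AddCommGroup R] [Module k R] [AddCommGroup S] [Module k S]
    [AddCommGroup O] [Module k O] (B : P →ₗ[k] Q →ₗ[k] N) (B₁ : N →ₗ[k] R →ₗ[k] O)
    (B₂ : Q →ₗ[k] R →ₗ[k] S) (B₃ : P →ₗ[k] S →ₗ[k] O)
    (h : ∀ x y z, B₁ (B x y) z = B₃ x (B₂ y z)) (a : ℕ → P) (b : ℕ → Q) (c : ℕ → R) (n : ℕ) :
    binomConv B₁ (binomConv B a b) c n = binomConv B₃ a (binomConv B₂ b c) n := by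
  induction n generalizing a b c with
  | zero => exact h _ _ _
  | succ n ih =>
    have e1 : (fun i => binomConv B a b (i + 1)) = fun i =>
      binomConv B (fun i => a (i + 1)) b i + binomConv B a (fun i => b (i + 1)) i := rfl
    have e2 : (fun i => binomConv B₂ b c (i + 1)) = fun i =>
      binomConv B₂ (fun i => b (i + 1)) c i + binomConv B₂ b (fun i => c (i + 1)) i := rfl
    rw [binomConv, binomConv, e1, e2, binomConv_add_left, binomConv_add_right, ih, ih, ih,
      add_assoc]

/-- The Leibniz formula for the iterates of an operator satisfying a product rule. -/
theorem iterate_bilin (B : P →ₗ[k] Q →ₗ[k] N) (D : N → N) (D₁ : P → P) (D₂ : Q → Q)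
    (hadd : ∀ x y, D (x + y) = D x + D y)
    (hD : ∀ x y, D (B x y) = B (D₁ x) y + B x (D₂ y)) (x : P) (y : Q) (n : ℕ) :
    D^[n] (B x y) = binomConv B (fun i => D₁^[i] x) (fun i => D₂^[i] y) n := by
  have hn : ∀ n x y, D^[n] (x + y) = D^[n] x + D^[n] y := by
    intro n
    induction n with
    | zero => intros; rfl
    | succ n ih => intro x y; simp only [Function.iterate_succ_apply, hadd, ih]
  induction n generalizing x y with
  | zero => rfl
  | succ n ih =>
    rw [Function.iterate_succ_apply, hD, hn, ih, ih]
    rfl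

/-- In characteristic `p` the inner binomial coefficients of a `p`-fold convolution vanish. -/
theorem binomConv_prime (p : ℕ) [Fact p.Prime] [CharP k p] (B : P →ₗ[k] Q →ₗ[k] N)
    (a : ℕ → P) (b : ℕ → Q) :
    binomConv B a b p = B (a p) (b 0) + B (a 0) (b p) := by
  have hp : p.Prime := Fact.out
  rw [binomConv_eq_sum, Finset.Nat.sum_antidiagonal_eq_sum_range_succ
    (fun i j => p.choose i • B (a i) (b j)), Finset.sum_range_succ, Finset.sum_range_eq_add_Ico _
    hp.pos, Finset.sum_eq_zero]
  · simp [add_comm]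
  · intro i hi
    rw [Finset.mem_Ico] at hi
    rw [← Nat.cast_smul_eq_nsmul k,
      (CharP.cast_eq_zero_iff k p _).2 (hp.dvd_choose_self (by omega) hi.2), zero_smul]

theorem map_binomConv {N' : Type*} [AddCommGroup N'] [Module k N'] (f : N →ₗ[k] N')
    (B : P →ₗ[k] Q →ₗ[k] N) (a : ℕ → P) (b : ℕ → Q) (n : ℕ) :
    f (binomConv B a b n) = binomConv (B.compr₂ f) a b n := by
  simp only [binomConv_eq_sum, map_sum, map_nsmul, LinearMap.compr₂_apply]

theorem binomConv_flip (B : P →ₗ[k] Q →ₗ[k] N) (a : ℕ → P) (b : ℕ → Q) (n : ℕ) :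
    binomConv B.flip b a n = binomConv B a b n := by
  induction n generalizing a b with
  | zero => rfl
  | succ n ih => rw [binomConv, binomConv, ih, ih, add_comm]

theorem binomConv_ite_left (B : P →ₗ[k] Q →ₗ[k] N) (x : P) (b : ℕ → Q) (n : ℕ) :
    binomConv B (fun i => if i = 0 then x else 0) b n = B x (b n) := by
  rw [binomConv_eq_sum, Finset.sum_eq_single (0, n)]
  · simp
  · rintro ⟨i, j⟩ hij h
    have hi : i ≠ 0 := by
      rintro rfl
      exact h (by simpa using hij)
    simp [hi]
  · simp

theorem binomConv_ite_right (B : P →ₗ[k] Q →ₗ[k] N) (a : ℕ → P) (y : Q) (n : ℕ) :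
    binomConv B a (fun i => if i = 0 then y else 0) n = B (a n) y := by
  rw [← binomConv_flip, binomConv_ite_left, LinearMap.flip_apply]

theorem binomConv_neg (B : P →ₗ[k] Q →ₗ[k] N) (a : ℕ → P) (b : ℕ → Q) (n : ℕ) :
    binomConv (-B) a b n = -binomConv B a b n := by
  simp only [binomConv_eq_sum, LinearMap.neg_apply, smul_neg, Finset.sum_neg_distrib]

end Convolution

/-! ### Holonomy of a gauge flow -/

section Holonomy

variable {k : Type*} [CommRing k] {C : Type*} [AddCommGroup C] [Module k C]

/-- The solution `u` of the differential equation `u' = h - H u`, `u 0 = 0`, in exponential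
generating functions. -/
def holonomy (h : ℕ → C) (H : ℕ → Module.End k C) : ℕ → C
  | 0 => 0
  | n + 1 => h n - ∑ i : Fin (n + 1), n.choose i • H (n - i) (holonomy h H i)

theorem holonomy_zero (h : ℕ → C) (H : ℕ → Module.End k C) : holonomy h H 0 = 0 := by
  rw [holonomy]

theorem holonomy_succ (h : ℕ → C) (H : ℕ → Module.End k C) (n : ℕ) :
    holonomy h H (n + 1) = h n - binomConv LinearMap.id H (holonomy h H) n := by
  rw [holonomy, Finset.sum_fin_eq_sum_range, binomConv_eq_sum,
    ← Finset.Nat.sum_antidiagonal_swap,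
    Finset.Nat.sum_antidiagonal_eq_sum_range_succ_mk]
  congr 1
  refine Finset.sum_congr rfl fun i hi => ?_
  rw [Finset.mem_range] at hi
  simp only [hi, dif_pos, Prod.swap, LinearMap.id_coe, id_eq]
  rw [Nat.choose_symm (by omega)]

theorem holonomy_mem (h : ℕ → C) (H : ℕ → Module.End k C) (S : ℕ → Submodule k C)
    (hh : ∀ n, h n ∈ S (n + 1)) (hH : ∀ i j, ∀ c ∈ S i, H j c ∈ S (i + j + 1)) (n : ℕ) :
    holonomy h H n ∈ S n := by
  induction n using Nat.strong_induction_on with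
  | _ n ih =>
    cases n with
    | zero => rw [holonomy]; exact zero_mem _
    | succ n =>
      rw [holonomy]
      refine sub_mem (hh n) (sum_mem fun i _ => nsmul_mem ?_ _)
      have := hH i (n - i) _ (ih i i.2)
      rwa [show (i : ℕ) + (n - i) + 1 = n + 1 by omega] at this

/-- If `g' = G h + H g` and `G' = G H + H G` on the coefficients of the holonomy `u`, then
`g = G u`; here `'` is the derivative of exponential generating functions. -/
theorem eq_binomConv_holonomy (g h : ℕ → C) (G H : ℕ → Module.End k C) (hg0 : g 0 = 0)
    (hg : ∀ n, g (n + 1) = binomConv LinearMap.id G h n + binomConv LinearMap.id H g n)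
    (hG : ∀ n i, G (n + 1) (holonomy h H i) = binomConv (LinearMap.mul k _) G H n (holonomy h H i)
      + binomConv (LinearMap.mul k _) H G n (holonomy h H i)) (n : ℕ) :
    g n = binomConv LinearMap.id G (holonomy h H) n := by
  set u := holonomy h H with hu
  induction n using Nat.strong_induction_on with
  | _ n ih =>
    cases n with
    | zero => rw [binomConv, hg0, hu, holonomy, map_zero]
    | succ n =>
      have hassoc : ∀ K L : ℕ → Module.End k C,
          binomConv LinearMap.id (binomConv (LinearMap.mul k _) K L) u n
            = binomConv LinearMap.id K (binomConv LinearMap.id L u) n := fun K L =>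
        binomConv_assoc _ _ _ _ (fun x y z => rfl) K L u n
      have e1 : binomConv LinearMap.id (fun i => G (i + 1)) u n
          = binomConv LinearMap.id G (binomConv LinearMap.id H u) n
            + binomConv LinearMap.id H (binomConv LinearMap.id G u) n := by
        rw [← hassoc, ← hassoc, ← binomConv_add_left]
        exact binomConv_congr _ _ _ _ _ _ _ fun i j _ => hG i j
      have e2 : (fun i => u (i + 1)) = fun i => h i - binomConv LinearMap.id H u i :=
        funext fun i => holonomy_succ h H i
      have e3 : binomConv LinearMap.id H (binomConv LinearMap.id G u) n
          = binomConv LinearMap.id H g n :=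
        binomConv_congr _ _ _ _ _ _ _ fun i j hij => by rw [ih j (by omega)]
      rw [binomConv, e1, e2, binomConv_sub_right, e3, hg]
      abel

end Holonomy

/-! ### Jacobson's formula -/

section Jacobson

variable {k : Type*} [CommRing k] {U : Type*} [Ring U] [Algebra k U]

/-- The commutator of an associative algebra as a bilinear map. -/
def commutatorMap (k : Type*) [CommRing k] (U : Type*) [Ring U] [Algebra k U] :
    U →ₗ[k] U →ₗ[k] U :=
  LinearMap.mul k U - (LinearMap.mul k U).flip

theorem commutatorMap_apply (x y : U) : commutatorMap k U x y = x * y - y * x := rfl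

theorem choose_prime_sub_one (k : Type*) [CommRing k] (p : ℕ) [Fact p.Prime] [CharP k p] (j : ℕ)
    (hj : j < p) : ((p - 1).choose j : k) = (-1) ^ j := by
  have hp : p.Prime := Fact.out
  induction j with
  | zero => simp
  | succ j ih =>
    have h1 : p.choose (j + 1) = (p - 1).choose j + (p - 1).choose (j + 1) := by
      conv_lhs => rw [← Nat.succ_pred_eq_of_pos hp.pos]
      exact Nat.choose_succ_succ _ _
    have h2 : ((p.choose (j + 1) : ℕ) : k) = 0 :=
      (CharP.cast_eq_zero_iff k p _).2 (hp.dvd_choose_self (by omega) hj)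
    rw [h1, Nat.cast_add, ih (by omega)] at h2
    rw [pow_succ]
    linear_combination h2

theorem Commute.sub_pow_prime_sub_one {k : Type*} [CommRing k] {E : Type*} [Ring E] [Algebra k E]
    (p : ℕ) [Fact p.Prime] [CharP k p] {a b : E} (h : Commute a b) :
    (a - b) ^ (p - 1) = ∑ i ∈ Finset.range p, a ^ i * b ^ (p - 1 - i) := by
  have hp : p.Prime := Fact.out
  rw [sub_eq_add_neg, h.neg_right.add_pow, Nat.sub_add_cancel hp.one_le]
  refine Finset.sum_congr rfl fun i hi => ?_
  rw [Finset.mem_range] at hi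
  rw [← Nat.choose_symm (by omega : i ≤ p - 1), mul_assoc,
    ← map_natCast (algebraMap k E), choose_prime_sub_one k p _ (by omega), map_pow, map_neg,
    map_one, ← (Commute.neg_one_right (-b)).mul_pow, mul_neg_one, neg_neg]

theorem Commute.sub_pow_prime {k : Type*} [CommRing k] {E : Type*} [Ring E] [Algebra k E]
    (p : ℕ) [Fact p.Prime] [CharP k p] {a b : E} (h : Commute a b) :
    (a - b) ^ p = a ^ p - b ^ p := by
  rw [← h.mul_geom_sum₂ p, ← Commute.sub_pow_prime_sub_one (k := k) p h, ← pow_succ',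
    Nat.sub_add_cancel (Fact.out : p.Prime).one_le]

open Polynomial in
theorem derivative_pow_eq_sum (z : U[X]) (n : ℕ) :
    derivative (z ^ n) = ∑ i ∈ Finset.range n, z ^ i * derivative z * z ^ (n - 1 - i) := by
  induction n with
  | zero => simp
  | succ n ih =>
    rw [pow_succ, derivative_mul, ih, Finset.sum_range_succ, Finset.sum_mul]
    congr 1
    · refine Finset.sum_congr rfl fun i hi => ?_
      rw [Finset.mem_range] at hi
      rw [mul_assoc, ← pow_succ, show n - 1 - i + 1 = n + 1 - 1 - i by omega]
    · simp

open Polynomial in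
theorem coeff_ad_iterate (x y : U) (n i : ℕ) :
    ((fun q : U[X] => (X * C x + C y) * q - q * (X * C x + C y))^[n] (C x)).coeff i
      = adCoeff (commutatorMap k U) x y n i := by
  induction n generalizing i with
  | zero => cases i <;> simp [adCoeff, coeff_C]
  | succ n ih =>
    rw [Function.iterate_succ_apply']
    generalize (fun q : U[X] => (X * C x + C y) * q - q * (X * C x + C y))^[n] (C x) = q at ih ⊢
    have e : (X * C x + C y) * q - q * (X * C x + C y)
        = X * (C x * q - q * C x) + (C y * q - q * C y) := by
      rw [add_mul, mul_add, mul_sub, ← mul_assoc q, ← X_mul (p := q), mul_assoc, mul_assoc]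
      abel
    rw [e, coeff_add, coeff_sub, coeff_C_mul, coeff_mul_C, ih]
    cases i with
    | zero => rw [mul_coeff_zero, coeff_X_zero, zero_mul, zero_add, adCoeff, commutatorMap_apply]
    | succ i =>
      rw [coeff_X_mul, coeff_sub, coeff_C_mul, coeff_mul_C, ih, adCoeff, commutatorMap_apply,
        commutatorMap_apply]

open Polynomial in
/-- Jacobson's formula, obtained by differentiating `(t x + y) ^ p` with respect to `t`. -/
theorem add_pow_char_eq_add_jacobsonPoly (p : ℕ) [Fact p.Prime] [CharP k p] (x y : U) :
    (x + y) ^ p = x ^ p + y ^ p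
      + ∑ j ∈ Finset.Ico 1 p, jacobsonPoly p (commutatorMap k U) j x y := by
  have hp : p.Prime := Fact.out
  set z : U[X] := X * C x + C y with hz
  have hdz : derivative z = C x := by simp [hz]
  have had : derivative (z ^ p) = (fun q : U[X] => z * q - q * z)^[p - 1] (C x) := by
    have hcomm : Commute (LinearMap.mulLeft k z) (LinearMap.mulRight k z) :=
      LinearMap.commute_mulLeft_right z z
    have h1 := congrArg (fun f : Module.End k U[X] => f (C x))
      (Commute.sub_pow_prime_sub_one (k := k) p hcomm)
    have h2 : ∀ n, ((LinearMap.mulLeft k z - LinearMap.mulRight k z) ^ n) (C x)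
        = (fun q : U[X] => z * q - q * z)^[n] (C x) := fun n => by
      rw [Module.End.pow_apply]; rfl
    simp only [h2] at h1
    rw [h1, derivative_pow_eq_sum, hdz, LinearMap.sum_apply]
    refine Finset.sum_congr rfl fun i hi => ?_
    rw [LinearMap.pow_mulLeft, LinearMap.pow_mulRight, Module.End.mul_apply,
      LinearMap.mulLeft_apply, LinearMap.mulRight_apply, mul_assoc]
  have hcoeff : ∀ j ∈ Finset.Ico 1 p,
      (z ^ p).coeff j = jacobsonPoly p (commutatorMap k U) j x y := by
    intro j hj
    rw [Finset.mem_Ico] at hj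
    obtain ⟨i, rfl⟩ : ∃ i, j = i + 1 := ⟨j - 1, by omega⟩
    have h1 := congrArg (fun q : U[X] => q.coeff i) had
    simp only [coeff_derivative] at h1
    rw [coeff_ad_iterate (k := k)] at h1
    have hu : IsUnit ((i + 1 : ℕ) : k) := by
      have hc : (i + 1).Coprime p := (Nat.coprime_of_lt_prime (by omega) hj.2 hp).symm
      have := (ZMod.isUnit_iff_coprime (i + 1) p).2 hc
      simpa using this.map (ZMod.castHom dvd_rfl k)
    rw [jacobsonPoly, Nat.add_sub_cancel, ← h1]
    have h3 : (z ^ p).coeff (i + 1) * ((i : U) + 1)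
        = ((i + 1 : ℕ) : k) • (z ^ p).coeff (i + 1) := by
      rw [Nat.cast_smul_eq_nsmul, nsmul_eq_mul, ← Nat.cast_succ, Nat.cast_commute]
    rw [h3, smul_smul, Ring.inverse_mul_cancel _ hu, one_smul]
  have hdeg : (z ^ p).natDegree < p + 1 := by
    have h1 : z.natDegree ≤ 1 := by
      rw [hz, (commute_X (C x)).eq]
      exact natDegree_linear_le
    have := natDegree_pow_le_of_le p h1
    omega
  have hev := eval₂_eq_sum_range' (RingHom.id U) hdeg (1 : U)
  have hev' : eval₂ (RingHom.id U) 1 (z ^ p) = (x + y) ^ p := by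
    have h1 := map_pow (eval₂RingHom' (RingHom.id U) (1 : U) fun a => Commute.one_right _) z p
    have h2 : eval₂RingHom' (RingHom.id U) (1 : U) (fun a => Commute.one_right _) z = x + y := by
      rw [hz, map_add, map_mul]
      simp [eval₂RingHom']
    rw [h2] at h1
    exact h1
  have h0 : (z ^ p).coeff 0 = y ^ p := by
    rw [← constantCoeff_apply, map_pow]
    simp [hz]
  have htop : (z ^ p).coeff p = x ^ p := by
    have h1 : z.natDegree ≤ 1 := by
      rw [hz, (commute_X (C x)).eq]
      exact natDegree_linear_le
    have := coeff_pow_of_natDegree_le (m := p) h1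
    rw [mul_one] at this
    rw [this]
    simp [hz]
  rw [← hev', hev, Finset.sum_range_succ, Finset.sum_range_eq_add_Ico _ hp.pos]
  simp only [RingHom.id_apply, one_pow, mul_one]
  rw [h0, htop, Finset.sum_congr rfl hcoeff]
  abel

end Jacobson

/-! ### Restricted Lie structures from associative models -/

section Model

variable {k : Type*} [CommRing k] {M : Type*} [AddCommGroup M] [Module k M]

/-- The complex `(gr, δ)` with the operations `circ` and `pw` is modelled on a subspace of an
associative algebra `U`: its graded pieces embed in `U` in such a way that the differential becomes
the graded commutator with an element `μ`, the antisymmetrization of `circ` becomes the graded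
commutator, and the squares and `p`-th powers are those of `U`. The last two conditions, that
the square and the `p`-th power of a boundary are again boundaries, do not follow from the
others. -/
structure AssocModel (p : ℕ) (gr : ℤ → Submodule k M) (δ : ℤ → M →ₗ[k] M)
    (circ : ℤ → M → M → M) (pw : ℤ → M → M) (U : Type*) [Ring U] [Algebra k U] where
  /-- the embedding of the graded pieces -/
  ρ : ∀ n, gr n →ₗ[k] U
  ρ_injective : ∀ n, Function.Injective (ρ n)
  /-- the element whose graded commutator is the differential -/
  μ : U
  ρ_d : ∀ (n : ℤ) (x : gr n), ∃ h : δ n x ∈ gr (n + 1),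
    ρ (n + 1) ⟨_, h⟩ = μ * ρ n x - n.negOnePow • (ρ n x * μ)
  ρ_bracket : ∀ (i j : ℤ) (x : gr i) (y : gr j),
    ∃ h : circ j x y - (i * j).negOnePow • circ i y x ∈ gr (i + j),
      ρ (i + j) ⟨_, h⟩ = ρ i x * ρ j y - (i * j).negOnePow • (ρ j y * ρ i x)
  ρ_sq : ∀ (n : ℤ) (_ : Odd n) (x : gr n), ∃ h : circ n x x ∈ gr (2 * n),
    ρ (2 * n) ⟨_, h⟩ = ρ n x ^ 2
  ρ_pow : ∀ (n : ℤ) (_ : Even n) (x : gr n), ∃ h : pw n x ∈ gr (p * n),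
    ρ (p * n) ⟨_, h⟩ = ρ n x ^ p
  sq_boundary : ∀ (n : ℤ) (_ : Odd n), ∀ y ∈ gr (n - 1),
    circ n (δ (n - 1) y) (δ (n - 1) y) ∈ (gr (2 * n - 1)).map (δ (2 * n - 1))
  pow_boundary : ∀ (n : ℤ) (_ : Even n), ∀ y ∈ gr (n - 1),
    pw n (δ (n - 1) y) ∈ (gr (p * n - 1)).map (δ (p * n - 1))

section Classes

variable (gr : ℤ → Submodule k M) (δ : ℤ → M →ₗ[k] M)

/-- The class of a cocycle in the total cohomology. -/
def totalClass (n : ℤ) : cocycles gr δ n →ₗ[k] ⨁ n, gradedCohomology gr δ n :=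
  DirectSum.lof k ℤ (gradedCohomology gr δ) n ∘ₗ Submodule.mkQ _

variable {gr δ}

theorem totalClass_apply (n : ℤ) (x : cocycles gr δ n) :
    totalClass gr δ n x = DirectSum.lof k ℤ (gradedCohomology gr δ) n (cohClass gr δ n x) := rfl

theorem totalClass_congr {n n' : ℤ} (h : n = n') {x : cocycles gr δ n} {x' : cocycles gr δ n'}
    (hx : (x : M) = x') : totalClass gr δ n x = totalClass gr δ n' x' := by
  subst h
  rw [Subtype.ext hx]

theorem cohClass_eq_iff {n : ℤ} {x x' : cocycles gr δ n} :
    cohClass gr δ n x = cohClass gr δ n x' ↔ (x - x' : M) ∈ (gr (n - 1)).map (δ (n - 1)) := by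
  rw [Submodule.Quotient.eq, Submodule.mem_comap]
  rfl

theorem totalClass_eq_zero {n : ℤ} {x : cocycles gr δ n}
    (h : (x : M) ∈ (gr (n - 1)).map (δ (n - 1))) : totalClass gr δ n x = 0 := by
  have : cohClass gr δ n x = 0 := (Submodule.Quotient.mk_eq_zero _).2 h
  rw [totalClass_apply, this, map_zero]

end Classes

theorem adCoeff_zero_right {T : Type*} [AddCommGroup T] [Module k T] (br : T →ₗ[k] T →ₗ[k] T)
    (x : T) (hx : br x x = 0) (n i : ℕ) : adCoeff br x 0 (n + 1) i = 0 := by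
  induction n generalizing i with
  | zero =>
    cases i with
    | zero => simp [adCoeff]
    | succ i => cases i <;> simp [adCoeff, hx]
  | succ n ih => cases i <;> simp [adCoeff, ih]

namespace AssocModel

variable {p : ℕ} {gr : ℤ → Submodule k M} {δ : ℤ → M →ₗ[k] M}
  {circ : ℤ → M → M → M} {pw : ℤ → M → M} {U : Type*} [Ring U] [Algebra k U]
  (m : AssocModel p gr δ circ pw U)

/-- The element `u` of the associative algebra represents the element `x` of degree `n`. -/
def Rep (n : ℤ) (x : M) (u : U) : Prop := ∃ h : x ∈ gr n, m.ρ n ⟨x, h⟩ = u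

/-- The bracket on representatives. -/
def preBracket (_m : AssocModel p gr δ circ pw U) (i j : ℤ) (x y : M) : M :=
  circ j x y - (i * j).negOnePow • circ i y x

variable {m}

theorem rep_coe {n : ℤ} (x : gr n) : m.Rep n x (m.ρ n x) := ⟨x.2, rfl⟩

theorem Rep.eq {n : ℤ} {x y : M} {u : U} (hx : m.Rep n x u) (hy : m.Rep n y u) : x = y := by
  obtain ⟨h, e⟩ := hx
  obtain ⟨h', e'⟩ := hy
  exact congrArg Subtype.val (m.ρ_injective n (e.trans e'.symm))

theorem Rep.cast {n n' : ℤ} {x : M} {u u' : U} (hx : m.Rep n x u) (h : n = n') (hu : u = u') :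
    m.Rep n' x u' := h ▸ hu ▸ hx

theorem Rep.add {n : ℤ} {x y : M} {u v : U} (hx : m.Rep n x u) (hy : m.Rep n y v) :
    m.Rep n (x + y) (u + v) := by
  obtain ⟨h, rfl⟩ := hx
  obtain ⟨h', rfl⟩ := hy
  exact ⟨add_mem h h', map_add (m.ρ n) ⟨x, h⟩ ⟨y, h'⟩⟩

theorem Rep.smul {n : ℤ} {x : M} {u : U} (a : k) (hx : m.Rep n x u) :
    m.Rep n (a • x) (a • u) := by
  obtain ⟨h, rfl⟩ := hx
  exact ⟨Submodule.smul_mem _ a h, map_smul (m.ρ n) a ⟨x, h⟩⟩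

theorem rep_zero (n : ℤ) : m.Rep n 0 0 := ⟨zero_mem _, map_zero (m.ρ n)⟩

theorem Rep.units_smul {n : ℤ} {x : M} {u : U} (ε : ℤˣ) (hx : m.Rep n x u) :
    m.Rep n (ε • x) (ε • u) := by
  rcases Int.units_eq_one_or ε with rfl | rfl
  · simpa using hx
  · simpa [Units.smul_def] using hx.smul (-1)

theorem Rep.d {n : ℤ} {x : M} {u : U} (hx : m.Rep n x u) :
    m.Rep (n + 1) (δ n x) (m.μ * u - n.negOnePow • (u * m.μ)) := by
  obtain ⟨h, rfl⟩ := hx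
  exact m.ρ_d n ⟨x, h⟩

theorem Rep.bracket {i j : ℤ} {x y : M} {u v : U} (hx : m.Rep i x u) (hy : m.Rep j y v) :
    m.Rep (i + j) (m.preBracket i j x y) (u * v - (i * j).negOnePow • (v * u)) := by
  obtain ⟨h, rfl⟩ := hx
  obtain ⟨h', rfl⟩ := hy
  exact m.ρ_bracket i j ⟨x, h⟩ ⟨y, h'⟩

theorem Rep.sq {n : ℤ} (hn : Odd n) {x : M} {u : U} (hx : m.Rep n x u) :
    m.Rep (2 * n) (circ n x x) (u ^ 2) := by
  obtain ⟨h, rfl⟩ := hx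
  exact m.ρ_sq n hn ⟨x, h⟩

theorem Rep.pow {n : ℤ} (hn : Even n) {x : M} {u : U} (hx : m.Rep n x u) :
    m.Rep (p * n) (pw n x) (u ^ p) := by
  obtain ⟨h, rfl⟩ := hx
  exact m.ρ_pow n hn ⟨x, h⟩

/-- An element is a cocycle when its representative commutes with `μ` in the graded sense. -/
theorem Rep.mem_cocycles {n : ℤ} {x : M} {u : U} (hx : m.Rep n x u)
    (hu : m.μ * u = n.negOnePow • (u * m.μ)) : x ∈ cocycles gr δ n := by
  refine ⟨hx.1, ?_⟩
  have h := hx.d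
  rw [hu, sub_self] at h
  exact h.eq (rep_zero _)

theorem Rep.mu_mul {n : ℤ} {x : M} {u : U} (hx : m.Rep n x u) (h : x ∈ cocycles gr δ n) :
    m.μ * u = n.negOnePow • (u * m.μ) := by
  obtain ⟨h1, e1⟩ := hx.d
  obtain ⟨h2, e2⟩ := rep_zero (m := m) (n + 1)
  have h0 : δ n x = 0 := h.2
  rw [← sub_eq_zero, ← e1, ← e2]
  congr 2

section Signs

theorem mu_mul_bracket {i j : ℤ} {u v μ : U} (hu : μ * u = i.negOnePow • (u * μ))
    (hv : μ * v = j.negOnePow • (v * μ)) :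
    μ * (u * v - (i * j).negOnePow • (v * u))
      = (i + j).negOnePow • ((u * v - (i * j).negOnePow • (v * u)) * μ) := by
  have h1 : ∀ ε : ℤˣ, ∀ a b : U, a * (ε • b) = ε • (a * b) := fun ε a b => mul_smul_comm ε a b
  have h2 : ∀ ε : ℤˣ, ∀ a b : U, (ε • a) * b = ε • (a * b) := fun ε a b => smul_mul_assoc ε a b
  have e1 : μ * (u * v) = (i + j).negOnePow • ((u * v) * μ) := by
    rw [← mul_assoc, hu, h2, mul_assoc, hv, h1, smul_smul, Int.negOnePow_add, mul_assoc]
  have e2 : μ * (v * u) = (i + j).negOnePow • ((v * u) * μ) := by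
    rw [← mul_assoc, hv, h2, mul_assoc, hu, h1, smul_smul, Int.negOnePow_add, mul_assoc,
      mul_comm j.negOnePow]
  rw [mul_sub, h1, e1, e2, sub_mul, h2, smul_sub, smul_comm]

theorem mu_mul_pow {i : ℤ} {u μ : U} (hu : μ * u = i.negOnePow • (u * μ)) (n : ℕ) :
    μ * u ^ n = (n * i).negOnePow • (u ^ n * μ) := by
  induction n with
  | zero => simp
  | succ n ih =>
    rw [pow_succ, ← mul_assoc, ih, smul_mul_assoc, mul_assoc, hu, mul_smul_comm, smul_smul,
      mul_assoc, Nat.cast_succ, add_mul, one_mul, Int.negOnePow_add]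

end Signs

theorem preBracket_mem_cocycles {i j : ℤ} (x : cocycles gr δ i) (y : cocycles gr δ j) :
    m.preBracket i j x y ∈ cocycles gr δ (i + j) := by
  have hx := rep_coe (m := m) ⟨x.1, x.2.1⟩
  have hy := rep_coe (m := m) ⟨y.1, y.2.1⟩
  exact (hx.bracket hy).mem_cocycles (mu_mul_bracket (hx.mu_mul x.2) (hy.mu_mul y.2))

theorem sq_mem_cocycles {n : ℤ} (hn : Odd n) (x : cocycles gr δ n)
    (m : AssocModel p gr δ circ pw U) :
    circ n x x ∈ cocycles gr δ (2 * n) := by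
  have hx := rep_coe (m := m) ⟨x.1, x.2.1⟩
  exact (hx.sq hn).mem_cocycles (mu_mul_pow (hx.mu_mul x.2) 2)

theorem pow_mem_cocycles {n : ℤ} (hn : Even n) (x : cocycles gr δ n)
    (m : AssocModel p gr δ circ pw U) : pw n x ∈ cocycles gr δ (p * n) := by
  have hx := rep_coe (m := m) ⟨x.1, x.2.1⟩
  exact (hx.pow hn).mem_cocycles (mu_mul_pow (hx.mu_mul x.2) p)

variable (m)

theorem preBracket_boundary_right {i j : ℤ} (x : cocycles gr δ i) {y : M} (hy : y ∈ gr (j - 1)) :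
    m.preBracket i j x (δ (j - 1) y) ∈ (gr (i + j - 1)).map (δ (i + j - 1)) := by
  have hx := rep_coe (m := m) ⟨x.1, x.2.1⟩
  have hy' := rep_coe (m := m) ⟨y, hy⟩
  have hb := ((hx.bracket hy').units_smul i.negOnePow).cast
    (show i + (j - 1) = i + j - 1 by ring) rfl
  refine ⟨_, hb.1, hb.d.eq ?_⟩
  have hμ := hx.mu_mul x.2
  refine (hx.bracket (hy'.d.cast (show j - 1 + 1 = j by ring) rfl)).cast (by ring) ?_
  have e1 : (i * (j - 1)).negOnePow = (i * j).negOnePow * i.negOnePow := by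
    rw [show i * (j - 1) = i * j - i by ring, Int.negOnePow_sub]
  have e2 : (i + j - 1).negOnePow = -(i.negOnePow * j.negOnePow) := by
    rw [Int.negOnePow_sub, Int.negOnePow_add, Int.negOnePow_one]; simp
  have e3 : (j - 1).negOnePow = -j.negOnePow := by
    rw [Int.negOnePow_sub, Int.negOnePow_one]; simp
  rw [e1, e2, e3]
  generalize m.ρ i _ = u at *
  generalize m.ρ (j - 1) _ = v at *
  generalize m.μ = μ at *
  generalize (i * j).negOnePow = s
  generalize j.negOnePow = t
  have hμ' : ∀ w, μ * (u * w) = i.negOnePow • (u * (μ * w)) := fun w => by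
    rw [← mul_assoc, hμ, smul_mul_assoc, mul_assoc]
  rcases Int.units_eq_one_or i.negOnePow with h | h <;> rw [h] at hμ hμ' ⊢ <;>
  rcases Int.units_eq_one_or s with rfl | rfl <;> rcases Int.units_eq_one_or t with rfl | rfl <;>
  simp only [one_smul, Units.neg_smul, mul_one, neg_mul, mul_neg, neg_neg, mul_sub,
    sub_mul, mul_assoc, hμ, hμ', smul_neg] <;> abel

theorem preBracket_antisymm (i j : ℤ) (x y : M) :
    m.preBracket i j x y = -((i * j).negOnePow • m.preBracket j i y x) := by
  rw [preBracket, preBracket, mul_comm j i, smul_sub, smul_smul]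
  simp

theorem preBracket_boundary_left {i j : ℤ} {x : M} (hx : x ∈ gr (i - 1)) (y : cocycles gr δ j) :
    m.preBracket i j (δ (i - 1) x) y ∈ (gr (i + j - 1)).map (δ (i + j - 1)) := by
  rw [preBracket_antisymm, ← Int.negOnePow_abs]
  have h := m.preBracket_boundary_right y hx
  rw [add_comm j i] at h
  rcases Int.units_eq_one_or (|i * j|).negOnePow with e | e <;> rw [e]
  · simpa using h
  · simpa [Units.neg_smul] using h

/-- The bracket of two cocycles, as a class. -/
def cocycleBracket (i j : ℤ) :
    cocycles gr δ i →ₗ[k] cocycles gr δ j →ₗ[k] gradedCohomology gr δ (i + j) :=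
  LinearMap.mk₂ k
    (fun x y => cohClass gr δ (i + j) ⟨m.preBracket i j x y, preBracket_mem_cocycles x y⟩)
    (fun x x' y => by
      rw [← Submodule.Quotient.mk_add]
      congr 1
      have hx := rep_coe (m := m) ⟨x.1, x.2.1⟩
      have hx' := rep_coe (m := m) ⟨x'.1, x'.2.1⟩
      have hy := rep_coe (m := m) ⟨y.1, y.2.1⟩
      refine Subtype.ext (((hx.add hx').bracket hy).eq
        (((hx.bracket hy).add (hx'.bracket hy)).cast rfl ?_))
      rw [add_mul, mul_add, smul_add]; abel)
    (fun a x y => by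
      rw [← Submodule.Quotient.mk_smul]
      congr 1
      have hx := rep_coe (m := m) ⟨x.1, x.2.1⟩
      have hy := rep_coe (m := m) ⟨y.1, y.2.1⟩
      refine Subtype.ext (((hx.smul a).bracket hy).eq (((hx.bracket hy).smul a).cast rfl ?_))
      rw [smul_mul_assoc, mul_smul_comm, smul_sub, smul_comm a])
    (fun x y y' => by
      rw [← Submodule.Quotient.mk_add]
      congr 1
      have hx := rep_coe (m := m) ⟨x.1, x.2.1⟩
      have hy := rep_coe (m := m) ⟨y.1, y.2.1⟩
      have hy' := rep_coe (m := m) ⟨y'.1, y'.2.1⟩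
      refine Subtype.ext ((hx.bracket (hy.add hy')).eq
        (((hx.bracket hy).add (hx.bracket hy')).cast rfl ?_))
      rw [add_mul, mul_add, smul_add]; abel)
    (fun a x y => by
      rw [← Submodule.Quotient.mk_smul]
      congr 1
      have hx := rep_coe (m := m) ⟨x.1, x.2.1⟩
      have hy := rep_coe (m := m) ⟨y.1, y.2.1⟩
      refine Subtype.ext ((hx.bracket (hy.smul a)).eq (((hx.bracket hy).smul a).cast rfl ?_))
      rw [smul_mul_assoc, mul_smul_comm, smul_sub, smul_comm a])

/-- The bracket of classes of degrees `i` and `j`. -/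
def cohBracket (i j : ℤ) :
    gradedCohomology gr δ i →ₗ[k] gradedCohomology gr δ j →ₗ[k] gradedCohomology gr δ (i + j) :=
  Submodule.liftQ _
    { toFun := fun x => Submodule.liftQ _ (m.cocycleBracket i j x) (by
        rintro y ⟨w, hw, hwy⟩
        rw [LinearMap.mem_ker]
        refine (Submodule.Quotient.mk_eq_zero _).2 ?_
        have h := m.preBracket_boundary_right x hw
        rw [hwy] at h
        exact h)
      map_add' := fun x x' => by
        refine Submodule.linearMap_qext _ (LinearMap.ext fun y => ?_)
        simp
      map_smul' := fun a x => by
        refine Submodule.linearMap_qext _ (LinearMap.ext fun y => ?_)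
        simp } (by
    rintro x ⟨w, hw, hwx⟩
    rw [LinearMap.mem_ker]
    refine Submodule.linearMap_qext _ (LinearMap.ext fun y => ?_)
    refine (Submodule.Quotient.mk_eq_zero _).2 ?_
    have h := m.preBracket_boundary_left hw y
    rw [hwx] at h
    exact h)

/-- The bracket on the total cohomology. -/
def totalBracket : (⨁ n, gradedCohomology gr δ n) →ₗ[k] (⨁ n, gradedCohomology gr δ n) →ₗ[k]
    ⨁ n, gradedCohomology gr δ n :=
  DirectSum.toModule k ℤ _ fun i => LinearMap.flip (DirectSum.toModule k ℤ _ fun j =>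
    LinearMap.flip ((m.cohBracket i j).compr₂ (DirectSum.lof k ℤ (gradedCohomology gr δ) (i + j))))

theorem totalBracket_lof (i j : ℤ) (c : gradedCohomology gr δ i) (c' : gradedCohomology gr δ j) :
    m.totalBracket (DirectSum.lof k ℤ (gradedCohomology gr δ) i c)
        (DirectSum.lof k ℤ (gradedCohomology gr δ) j c')
      = DirectSum.lof k ℤ (gradedCohomology gr δ) (i + j) (m.cohBracket i j c c') := by
  simp [totalBracket, DirectSum.toModule_lof]

theorem totalBracket_totalClass {i j : ℤ} (x : cocycles gr δ i) (y : cocycles gr δ j) :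
    m.totalBracket (totalClass gr δ i x) (totalClass gr δ j y)
      = totalClass gr δ (i + j) ⟨_, preBracket_mem_cocycles (m := m) x y⟩ := by
  rw [totalClass_apply, totalClass_apply, totalBracket_lof]
  rfl

/-- The total class `c` has a representing cocycle of degree `n` that is itself represented by
the element `u` of the associative algebra. -/
def Represents (n : ℤ) (u : U) (c : ⨁ n, gradedCohomology gr δ n) : Prop :=
  ∃ x : cocycles gr δ n, m.Rep n x u ∧ totalClass gr δ n x = c

variable {m}

theorem represents_totalClass {n : ℤ} (x : cocycles gr δ n) :
    m.Represents n (m.ρ n ⟨x, x.2.1⟩) (totalClass gr δ n x) := ⟨x, ⟨x.2.1, rfl⟩, rfl⟩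

theorem Represents.eq {n n' : ℤ} {u u' : U} {c c' : ⨁ n, gradedCohomology gr δ n}
    (h : m.Represents n u c) (h' : m.Represents n' u' c') (hn : n = n') (hu : u = u') :
    c = c' := by
  subst hn hu
  obtain ⟨x, hx, rfl⟩ := h
  obtain ⟨y, hy, rfl⟩ := h'
  exact totalClass_congr rfl (hx.eq hy)

theorem Represents.cast {n n' : ℤ} {u u' : U} {c : ⨁ n, gradedCohomology gr δ n}
    (h : m.Represents n u c) (hn : n = n') (hu : u = u') : m.Represents n' u' c :=
  hn ▸ hu ▸ h

theorem Represents.congr_class {n : ℤ} {u u' : U} {c c' : ⨁ n, gradedCohomology gr δ n}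
    (h : m.Represents n u c) (hu : u = u') (hc : c = c') : m.Represents n u' c' :=
  hu ▸ hc ▸ h

theorem represents_zero (n : ℤ) : m.Represents n 0 0 :=
  ⟨0, rep_zero n, map_zero _⟩

theorem Represents.add {n : ℤ} {u u' : U} {c c' : ⨁ n, gradedCohomology gr δ n}
    (h : m.Represents n u c) (h' : m.Represents n u' c') :
    m.Represents n (u + u') (c + c') := by
  obtain ⟨x, hx, rfl⟩ := h
  obtain ⟨y, hy, rfl⟩ := h'
  exact ⟨x + y, hx.add hy, map_add _ _ _⟩

theorem Represents.smul {n : ℤ} {u : U} {c : ⨁ n, gradedCohomology gr δ n} (a : k)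
    (h : m.Represents n u c) : m.Represents n (a • u) (a • c) := by
  obtain ⟨x, hx, rfl⟩ := h
  exact ⟨a • x, hx.smul a, map_smul _ _ _⟩

theorem Represents.units_smul {n : ℤ} {u : U} {c : ⨁ n, gradedCohomology gr δ n} (ε : ℤˣ)
    (h : m.Represents n u c) : m.Represents n (ε • u) (ε • c) := by
  rcases Int.units_eq_one_or ε with rfl | rfl
  · simpa using h
  · refine (h.smul (-1)).congr_class ?_ ?_
    · rw [neg_one_smul, Units.neg_smul, one_smul]
    · rw [Units.neg_smul, one_smul]
      exact neg_one_smul k c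

theorem Represents.sum {n : ℤ} {ι : Type*} (s : Finset ι) {u : ι → U}
    {c : ι → ⨁ n, gradedCohomology gr δ n} (h : ∀ i ∈ s, m.Represents n (u i) (c i)) :
    m.Represents n (∑ i ∈ s, u i) (∑ i ∈ s, c i) := by
  classical
  induction s using Finset.induction_on with
  | empty => exact represents_zero n
  | insert a s ha ih =>
    rw [Finset.sum_insert ha, Finset.sum_insert ha]
    exact (h a (Finset.mem_insert_self a s)).add
      (ih fun i hi => h i (Finset.mem_insert_of_mem hi))

theorem Represents.bracket {i j : ℤ} {u v : U} {c c' : ⨁ n, gradedCohomology gr δ n}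
    (h : m.Represents i u c) (h' : m.Represents j v c') :
    m.Represents (i + j) (u * v - (i * j).negOnePow • (v * u)) (m.totalBracket c c') := by
  obtain ⟨x, hx, rfl⟩ := h
  obtain ⟨y, hy, rfl⟩ := h'
  exact ⟨_, hx.bracket hy, (m.totalBracket_totalClass x y).symm⟩

theorem Represents.bracket_even {i j : ℤ} (hi : Even i) {u v : U}
    {c c' : ⨁ n, gradedCohomology gr δ n} (h : m.Represents i u c) (h' : m.Represents j v c') :
    m.Represents (i + j) (commutatorMap k U u v) (m.totalBracket c c') := by
  refine (h.bracket h').cast rfl ?_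
  rw [Int.negOnePow_even _ (hi.mul_right j), one_smul, commutatorMap_apply]

theorem Represents.adCoeff {i : ℤ} (hi : Even i) {u v : U}
    {c c' : ⨁ n, gradedCohomology gr δ n} (h : m.Represents i u c) (h' : m.Represents i v c')
    (n j : ℕ) : m.Represents ((n + 1 : ℕ) * i) (_root_.adCoeff (commutatorMap k U) u v n j)
      (_root_.adCoeff m.totalBracket c c' n j) := by
  induction n generalizing j with
  | zero =>
    cases j with
    | zero => exact h.cast (by simp) rfl
    | succ j => exact represents_zero _
  | succ n ih =>
    have e : i + (n + 1 : ℕ) * i = (n + 1 + 1 : ℕ) * i := by push_cast; ring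
    cases j with
    | zero => exact (h'.bracket_even hi (ih 0)).cast e rfl
    | succ j =>
      exact ((h.bracket_even hi (ih j)).cast e rfl).add
        ((h'.bracket_even hi (ih (j + 1))).cast e rfl)

theorem Represents.jacobsonPoly [Fact p.Prime] {i : ℤ} (hi : Even i) {u v : U}
    {c c' : ⨁ n, gradedCohomology gr δ n} (h : m.Represents i u c) (h' : m.Represents i v c') :
    m.Represents (p * i)
      (∑ j ∈ Finset.Ico 1 p, _root_.jacobsonPoly p (commutatorMap k U) j u v)
      (∑ j ∈ Finset.Ico 1 p, _root_.jacobsonPoly p m.totalBracket j c c') := by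
  have hp : p.Prime := Fact.out
  refine Represents.sum _ fun j _ => Represents.smul _ ((h.adCoeff hi h' _ _).cast ?_ rfl)
  rw [Nat.sub_add_cancel hp.one_le]

theorem totalBracket_self {i : ℤ} (hi : Even i) {u : U} {c : ⨁ n, gradedCohomology gr δ n}
    (h : m.Represents i u c) : m.totalBracket c c = 0 :=
  (h.bracket_even hi h).eq (represents_zero _) rfl (by rw [commutatorMap_apply, sub_self])

theorem represents_sq {n : ℤ} (hn : Odd n) (x : cocycles gr δ n) :
    m.Represents (2 * n) (m.ρ n ⟨x, x.2.1⟩ ^ 2)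
      (totalClass gr δ (2 * n) ⟨_, m.sq_mem_cocycles hn x⟩) :=
  ⟨_, (rep_coe (m := m) ⟨x.1, x.2.1⟩).sq hn, rfl⟩

theorem represents_pow {n : ℤ} (hn : Even n) (x : cocycles gr δ n) :
    m.Represents (p * n) (m.ρ n ⟨x, x.2.1⟩ ^ p)
      (totalClass gr δ (p * n) ⟨_, m.pow_mem_cocycles hn x⟩) :=
  ⟨_, (rep_coe (m := m) ⟨x.1, x.2.1⟩).pow hn, rfl⟩

theorem ρ_add_cocycles {n : ℤ} (x y : cocycles gr δ n) :
    m.ρ n ⟨(x + y : cocycles gr δ n), (x + y).2.1⟩ = m.ρ n ⟨x, x.2.1⟩ + m.ρ n ⟨y, y.2.1⟩ := by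
  rw [← map_add]; rfl

theorem totalClass_sq_add {n : ℤ} (hn : Odd n) (x y : cocycles gr δ n) :
    totalClass gr δ (2 * n) ⟨_, m.sq_mem_cocycles hn (x + y)⟩
      = totalClass gr δ (2 * n) ⟨_, m.sq_mem_cocycles hn x⟩
        + totalClass gr δ (2 * n) ⟨_, m.sq_mem_cocycles hn y⟩
        + m.totalBracket (totalClass gr δ n x) (totalClass gr δ n y) := by
  refine (represents_sq hn (x + y)).eq (((represents_sq hn x).add (represents_sq hn y)).add
    (((represents_totalClass x).bracket (represents_totalClass y)).cast (by ring) rfl)) rfl ?_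
  rw [ρ_add_cocycles, Int.negOnePow_odd _ (hn.mul hn), Units.neg_smul, one_smul, sub_neg_eq_add]
  noncomm_ring

theorem totalClass_pow_add [Fact p.Prime] [CharP k p] {n : ℤ} (hn : Even n)
    (x y : cocycles gr δ n) :
    totalClass gr δ (p * n) ⟨_, m.pow_mem_cocycles hn (x + y)⟩
      = totalClass gr δ (p * n) ⟨_, m.pow_mem_cocycles hn x⟩
        + totalClass gr δ (p * n) ⟨_, m.pow_mem_cocycles hn y⟩
        + ∑ j ∈ Finset.Ico 1 p,
          _root_.jacobsonPoly p m.totalBracket j (totalClass gr δ n x) (totalClass gr δ n y) := by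
  refine (represents_pow hn (x + y)).eq (((represents_pow hn x).add (represents_pow hn y)).add
    (Represents.jacobsonPoly hn (represents_totalClass x) (represents_totalClass y))) rfl ?_
  rw [ρ_add_cocycles, add_pow_char_eq_add_jacobsonPoly (k := k)]

theorem totalClass_sq_smul {n : ℤ} (hn : Odd n) (a : k) (x : cocycles gr δ n)
    (m : AssocModel p gr δ circ pw U) :
    totalClass gr δ (2 * n) ⟨_, m.sq_mem_cocycles hn (a • x)⟩
      = a ^ 2 • totalClass gr δ (2 * n) ⟨_, m.sq_mem_cocycles hn x⟩ := by
  refine (represents_sq (m := m) hn (a • x)).eq ((represents_sq (m := m) hn x).smul (a ^ 2))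
    rfl ?_
  have : m.ρ n ⟨(a • x : cocycles gr δ n), (a • x).2.1⟩ = a • m.ρ n ⟨x, x.2.1⟩ := by
    rw [← map_smul]; rfl
  rw [this, smul_pow]

theorem totalClass_pow_smul {n : ℤ} (hn : Even n) (a : k) (x : cocycles gr δ n)
    (m : AssocModel p gr δ circ pw U) :
    totalClass gr δ (p * n) ⟨_, m.pow_mem_cocycles hn (a • x)⟩
      = a ^ p • totalClass gr δ (p * n) ⟨_, m.pow_mem_cocycles hn x⟩ := by
  refine (represents_pow (m := m) hn (a • x)).eq ((represents_pow (m := m) hn x).smul (a ^ p))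
    rfl ?_
  have : m.ρ n ⟨(a • x : cocycles gr δ n), (a • x).2.1⟩ = a • m.ρ n ⟨x, x.2.1⟩ := by
    rw [← map_smul]; rfl
  rw [this, smul_pow]

variable (m)

theorem cohClass_sq_congr {n : ℤ} (hn : Odd n) {x x' : cocycles gr δ n}
    (h : cohClass gr δ n x = cohClass gr δ n x') :
    cohClass gr δ (2 * n) ⟨_, m.sq_mem_cocycles hn x⟩
      = cohClass gr δ (2 * n) ⟨_, m.sq_mem_cocycles hn x'⟩ := by
  obtain ⟨w, hw, hwx⟩ := cohClass_eq_iff.1 h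
  obtain ⟨y, rfl⟩ : ∃ y, x = x' + y := ⟨x - x', by abel⟩
  have hy : (y : M) = δ (n - 1) w := by rw [hwx]; simp
  have hy0 : totalClass gr δ n y = 0 :=
    totalClass_eq_zero ⟨w, hw, hy.symm⟩
  have hy1 : totalClass gr δ (2 * n) ⟨_, m.sq_mem_cocycles hn y⟩ = 0 := by
    refine totalClass_eq_zero ?_
    have := m.sq_boundary n hn w hw
    rw [← hy] at this
    exact this
  apply DirectSum.of_injective (β := gradedCohomology gr δ) (2 * n)
  have := m.totalClass_sq_add hn x' y
  rw [hy0, hy1, map_zero, add_zero, add_zero] at this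
  exact this

theorem cohClass_pow_congr [Fact p.Prime] [CharP k p] {n : ℤ} (hn : Even n)
    {x x' : cocycles gr δ n} (h : cohClass gr δ n x = cohClass gr δ n x') :
    cohClass gr δ (p * n) ⟨_, m.pow_mem_cocycles hn x⟩
      = cohClass gr δ (p * n) ⟨_, m.pow_mem_cocycles hn x'⟩ := by
  have hp : p.Prime := Fact.out
  obtain ⟨w, hw, hwx⟩ := cohClass_eq_iff.1 h
  obtain ⟨y, rfl⟩ : ∃ y, x = x' + y := ⟨x - x', by abel⟩
  have hy : (y : M) = δ (n - 1) w := by rw [hwx]; simp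
  have hy0 : totalClass gr δ n y = 0 :=
    totalClass_eq_zero ⟨w, hw, hy.symm⟩
  have hy1 : totalClass gr δ (p * n) ⟨_, m.pow_mem_cocycles hn y⟩ = 0 := by
    refine totalClass_eq_zero ?_
    have := m.pow_boundary n hn w hw
    rw [← hy] at this
    exact this
  apply DirectSum.of_injective (β := gradedCohomology gr δ) (p * n)
  have := m.totalClass_pow_add hn x' y
  rw [hy0, hy1, add_zero, Finset.sum_eq_zero, add_zero] at this
  · exact this
  · intro j _
    obtain ⟨q, hq⟩ : ∃ q, p - 1 = q + 1 := ⟨p - 2, by have := hp.two_le; omega⟩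
    rw [_root_.jacobsonPoly, hq, adCoeff_zero_right _ _
      (totalBracket_self hn (represents_totalClass (m := m) x')), smul_zero]

/-- The reduced square on classes of odd degree. -/
def cohSq (n : ℤ) (hn : Odd n) (c : gradedCohomology gr δ n) : gradedCohomology gr δ (2 * n) :=
  cohClass gr δ (2 * n)
    ⟨_, m.sq_mem_cocycles hn (Submodule.Quotient.mk_surjective _ c).choose⟩

/-- The `p`-power operation on classes of even degree. -/
def cohPow (n : ℤ) (hn : Even n) (c : gradedCohomology gr δ n) : gradedCohomology gr δ (p * n) :=
  cohClass gr δ (p * n)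
    ⟨_, m.pow_mem_cocycles hn (Submodule.Quotient.mk_surjective _ c).choose⟩

theorem cohSq_cohClass {n : ℤ} (hn : Odd n) (x : cocycles gr δ n) :
    m.cohSq n hn (cohClass gr δ n x) = cohClass gr δ (2 * n) ⟨_, m.sq_mem_cocycles hn x⟩ :=
  m.cohClass_sq_congr hn
    (Submodule.Quotient.mk_surjective _ (cohClass gr δ n x)).choose_spec

theorem cohPow_cohClass [Fact p.Prime] [CharP k p] {n : ℤ} (hn : Even n) (x : cocycles gr δ n) :
    m.cohPow n hn (cohClass gr δ n x) = cohClass gr δ (p * n) ⟨_, m.pow_mem_cocycles hn x⟩ :=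
  m.cohClass_pow_congr hn
    (Submodule.Quotient.mk_surjective _ (cohClass gr δ n x)).choose_spec

theorem represents_lof {n : ℤ} (c : gradedCohomology gr δ n) :
    ∃ u, m.Represents n u (DirectSum.lof k ℤ (gradedCohomology gr δ) n c) := by
  obtain ⟨x, rfl⟩ := Submodule.Quotient.mk_surjective _ c
  exact ⟨_, represents_totalClass x⟩

/-- The restricted graded Lie algebra structure on the cohomology. -/
def restrictedGradedLie [Fact p.Prime] [CharP k p] :
    RestrictedGradedLie k p (gradedCohomology gr δ) where
  bracket := m.totalBracket
  sq := m.cohSq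
  pow := m.cohPow
  bracket_degree i j x y := ⟨m.cohBracket i j x y, m.totalBracket_lof i j x y⟩
  bracket_antisymm i j x y := by
    obtain ⟨u, hu⟩ := m.represents_lof x
    obtain ⟨v, hv⟩ := m.represents_lof y
    rw [← Units.neg_smul]
    refine (hu.bracket hv).eq ((hv.bracket hu).units_smul _) (add_comm i j) ?_
    rw [mul_comm j i, smul_sub, smul_smul]
    simp [Units.neg_smul, sub_eq_add_neg, add_comm]
  bracket_self i hi x := by
    obtain ⟨u, hu⟩ := m.represents_lof x
    exact totalBracket_self hi hu
  jacobi i j l x y z := by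
    obtain ⟨u, hu⟩ := m.represents_lof x
    obtain ⟨v, hv⟩ := m.represents_lof y
    obtain ⟨w, hw⟩ := m.represents_lof z
    refine (hu.bracket (hv.bracket hw)).eq (((hu.bracket hv).bracket hw).add
      (((hv.bracket (hu.bracket hw)).units_smul _).cast (by ring) rfl)) (by ring) ?_
    rw [mul_add i, mul_add j, add_mul i, mul_comm j i, Int.negOnePow_add, Int.negOnePow_add,
      Int.negOnePow_add]
    generalize (i * j).negOnePow = a
    generalize (i * l).negOnePow = b
    generalize (j * l).negOnePow = c
    rcases Int.units_eq_one_or a with rfl | rfl <;> rcases Int.units_eq_one_or b with rfl | rfl <;>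
    rcases Int.units_eq_one_or c with rfl | rfl <;>
    simp only [one_smul, Units.neg_smul, mul_one, mul_neg, neg_neg] <;>
    noncomm_ring
  jacobi_self i hi x := by
    obtain ⟨u, hu⟩ := m.represents_lof x
    refine (hu.bracket (hu.bracket hu)).eq (represents_zero _) rfl ?_
    rw [Int.negOnePow_odd _ (hi.mul hi),
      Int.negOnePow_even (i * (i + i)) ((hi.add_odd hi).mul_left i)]
    simp only [one_smul, Units.neg_smul]
    noncomm_ring
  sq_smul i hi a x := by
    obtain ⟨x, rfl⟩ := Submodule.Quotient.mk_surjective _ x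
    rw [← Submodule.Quotient.mk_smul, cohSq_cohClass, cohSq_cohClass]
    apply DirectSum.of_injective (β := gradedCohomology gr δ) (2 * i)
    exact (totalClass_sq_smul hi a x m).trans (map_smul (totalClass gr δ (2 * i)) _ _).symm
  sq_add i hi x y := by
    obtain ⟨x, rfl⟩ := Submodule.Quotient.mk_surjective _ x
    obtain ⟨y, rfl⟩ := Submodule.Quotient.mk_surjective _ y
    rw [← Submodule.Quotient.mk_add, cohSq_cohClass, cohSq_cohClass, cohSq_cohClass]
    exact m.totalClass_sq_add hi x y
  bracket_sq i hi x z := by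
    obtain ⟨x, rfl⟩ := Submodule.Quotient.mk_surjective _ x
    rw [cohSq_cohClass]
    induction z using DirectSum.induction_on with
    | zero => simp
    | add z z' h h' => simp only [map_add, h, h']
    | of j z =>
      obtain ⟨w, hw⟩ := m.represents_lof z
      have hx := represents_totalClass (m := m) x
      refine ((represents_sq hi x).bracket hw).eq (hx.bracket (hx.bracket hw)) (by ring) ?_
      have e1 : (2 * i * j).negOnePow = 1 := Int.negOnePow_even _ ⟨i * j, by ring⟩
      have e2 : (i * (i + j)).negOnePow = -(i * j).negOnePow := by
        rw [mul_add, Int.negOnePow_add, Int.negOnePow_odd _ (hi.mul hi), neg_mul, one_mul]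
      rw [e1, e2]
      rcases Int.units_eq_one_or (i * j).negOnePow with h | h <;> rw [h] <;>
      simp only [one_smul, Units.neg_smul, neg_neg] <;> noncomm_ring
  pow_smul i hi a x := by
    obtain ⟨x, rfl⟩ := Submodule.Quotient.mk_surjective _ x
    rw [← Submodule.Quotient.mk_smul, cohPow_cohClass, cohPow_cohClass]
    apply DirectSum.of_injective (β := gradedCohomology gr δ) (p * i)
    exact (totalClass_pow_smul hi a x m).trans (map_smul (totalClass gr δ (p * i)) _ _).symm
  bracket_pow i hi x z := by
    obtain ⟨x, rfl⟩ := Submodule.Quotient.mk_surjective _ x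
    rw [cohPow_cohClass]
    have hadd : ∀ n z z', (m.totalBracket (totalClass gr δ i x))^[n] (z + z')
        = (m.totalBracket (totalClass gr δ i x))^[n] z
          + (m.totalBracket (totalClass gr δ i x))^[n] z' := fun n z z' =>
      iterate_map_add _ n z z'
    have hzero : ∀ n, (m.totalBracket (totalClass gr δ i x))^[n] 0 = 0 := fun n =>
      iterate_map_zero _ n
    change m.totalBracket (totalClass gr δ _ _) z = (m.totalBracket (totalClass gr δ i x))^[p] z
    induction z using DirectSum.induction_on with
    | zero => rw [hzero, map_zero]
    | add z z' h h' => rw [hadd, map_add, h, h']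
    | of j z =>
      obtain ⟨w, hw⟩ := m.represents_lof z
      have hx := represents_totalClass (m := m) x
      have hit : ∀ n : ℕ, m.Represents (n * i + j)
          ((commutatorMap k U (m.ρ i ⟨x, x.2.1⟩) ^ n) w)
          ((m.totalBracket (totalClass gr δ i x))^[n] (DirectSum.of _ j z)) := by
        intro n
        induction n with
        | zero => exact hw.cast (by simp) rfl
        | succ n ih =>
          rw [Function.iterate_succ_apply', pow_succ', Module.End.mul_apply]
          exact (hx.bracket_even hi ih).cast (by push_cast; ring) rfl
      refine ((represents_pow hi x).bracket_even (hi.mul_left _) hw).eq (hit p) rfl ?_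
      have e : commutatorMap k U (m.ρ i ⟨x, x.2.1⟩)
          = LinearMap.mulLeft k (m.ρ i ⟨x, x.2.1⟩) - LinearMap.mulRight k (m.ρ i ⟨x, x.2.1⟩) := rfl
      rw [e, Commute.sub_pow_prime (k := k) p (LinearMap.commute_mulLeft_right _ _),
        LinearMap.pow_mulLeft, LinearMap.pow_mulRight]
      rfl
  pow_add i hi x y := by
    obtain ⟨x, rfl⟩ := Submodule.Quotient.mk_surjective _ x
    obtain ⟨y, rfl⟩ := Submodule.Quotient.mk_surjective _ y
    rw [← Submodule.Quotient.mk_add, cohPow_cohClass, cohPow_cohClass, cohPow_cohClass]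
    exact m.totalClass_pow_add hi x y

theorem isInducedBy_restrictedGradedLie [Fact p.Prime] [CharP k p] :
    IsInducedBy m.restrictedGradedLie circ pw where
  bracket _ _ x y := ⟨preBracket_mem_cocycles (m := m) x y, m.totalBracket_totalClass x y⟩
  sq _ hn x := ⟨m.sq_mem_cocycles hn x, m.cohSq_cohClass hn x⟩
  pow _ hn x := ⟨m.pow_mem_cocycles hn x, m.cohPow_cohClass hn x⟩

end AssocModel

theorem IsInducedBy.unique {p : ℕ} {gr : ℤ → Submodule k M} {δ : ℤ → M →ₗ[k] M}
    {R R' : RestrictedGradedLie k p (gradedCohomology gr δ)} {circ : ℤ → M → M → M}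
    {pw : ℤ → M → M} (h : IsInducedBy R circ pw) (h' : IsInducedBy R' circ pw) : R = R' := by
  apply RestrictedGradedLie.ext
  · refine DirectSum.linearMap_ext k fun i => LinearMap.ext fun x => ?_
    refine DirectSum.linearMap_ext k fun j => LinearMap.ext fun y => ?_
    obtain ⟨x, rfl⟩ := Submodule.Quotient.mk_surjective _ x
    obtain ⟨y, rfl⟩ := Submodule.Quotient.mk_surjective _ y
    obtain ⟨_, e⟩ := h.bracket i j x y
    obtain ⟨_, e'⟩ := h'.bracket i j x y
    exact e.trans e'.symm
  · funext n hn x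
    obtain ⟨x, rfl⟩ := Submodule.Quotient.mk_surjective _ x
    obtain ⟨_, e⟩ := h.sq n hn x
    obtain ⟨_, e'⟩ := h'.sq n hn x
    exact e.trans e'.symm
  · funext n hn x
    obtain ⟨x, rfl⟩ := Submodule.Quotient.mk_surjective _ x
    obtain ⟨_, e⟩ := h.pow n hn x
    obtain ⟨_, e'⟩ := h'.pow n hn x
    exact e.trans e'.symm

theorem AssocModel.existsUnique {p : ℕ} [Fact p.Prime] [CharP k p] {gr : ℤ → Submodule k M}
    {δ : ℤ → M →ₗ[k] M} {circ : ℤ → M → M → M} {pw : ℤ → M → M} {U : Type*} [Ring U] [Algebra k U]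
    (m : AssocModel p gr δ circ pw U) :
    ∃! R : RestrictedGradedLie k p (gradedCohomology gr δ), IsInducedBy R circ pw :=
  ⟨m.restrictedGradedLie, m.isInducedBy_restrictedGradedLie,
    fun _ h => h.unique m.isInducedBy_restrictedGradedLie⟩

/-- A chain map that is compatible with the operations on cocycles induces a homomorphism of
restricted graded Lie algebras. -/
theorem exists_isInducedMap {M' : Type*} [AddCommGroup M'] [Module k M'] {p : ℕ}
    {gr : ℤ → Submodule k M} {δ : ℤ → M →ₗ[k] M} {circ : ℤ → M → M → M} {pw : ℤ → M → M}
    {gr' : ℤ → Submodule k M'} {δ' : ℤ → M' →ₗ[k] M'} {circ' : ℤ → M' → M' → M'}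
    {pw' : ℤ → M' → M'} (F : M →ₗ[k] M')
    (hgr : ∀ n, ∀ x ∈ gr n, F x ∈ gr' n) (hδ : ∀ n, ∀ x ∈ gr n, F (δ n x) = δ' n (F x))
    (hbr : ∀ i j, ∀ x ∈ gr i, ∀ y ∈ gr j,
      F (circ j x y - (i * j).negOnePow • circ i y x)
        = circ' j (F x) (F y) - (i * j).negOnePow • circ' i (F y) (F x))
    (hsq : ∀ n, Odd n → ∀ x ∈ gr n, F (circ n x x) = circ' n (F x) (F x))
    (hpow : ∀ n, Even n → ∀ x ∈ gr n, F (pw n x) = pw' n (F x)) :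
    ∃ f : ∀ n, gradedCohomology gr δ n →ₗ[k] gradedCohomology gr' δ' n,
      IsInducedMap f F ∧
      ∀ (R : RestrictedGradedLie k p (gradedCohomology gr δ))
        (S : RestrictedGradedLie k p (gradedCohomology gr' δ')),
        IsInducedBy R circ pw → IsInducedBy S circ' pw' → IsRestrictedLieHom R S f := by
  have hcoc : ∀ n, ∀ x ∈ cocycles gr δ n, F x ∈ cocycles gr' δ' n := fun n x hx =>
    ⟨hgr n x hx.1, LinearMap.mem_ker.2 (by
      rw [← hδ n x hx.1, LinearMap.mem_ker.1 hx.2, map_zero])⟩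
  let f : ∀ n, gradedCohomology gr δ n →ₗ[k] gradedCohomology gr' δ' n := fun n =>
    Submodule.mapQ _ _ (F.restrict (hcoc n)) (by
      rintro x ⟨w, hw, hwx⟩
      exact ⟨F w, hgr _ w hw, by rw [← hδ _ w hw, hwx]; rfl⟩)
  have hf : ∀ n (x : cocycles gr δ n),
      f n (cohClass gr δ n x) = cohClass gr' δ' n ⟨F x, hcoc n x x.2⟩ := fun n x => rfl
  refine ⟨f, fun n x => ⟨hcoc n x x.2, rfl⟩, fun R S hR hS => ⟨?_, ?_, ?_⟩⟩
  · intro x y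
    have key : (R.bracket.compr₂ (DirectSum.lmap f))
        = S.bracket.compl₁₂ (DirectSum.lmap f) (DirectSum.lmap f) := by
      refine DirectSum.linearMap_ext k fun i => LinearMap.ext fun x => ?_
      refine DirectSum.linearMap_ext k fun j => LinearMap.ext fun y => ?_
      obtain ⟨x, rfl⟩ := Submodule.Quotient.mk_surjective _ x
      obtain ⟨y, rfl⟩ := Submodule.Quotient.mk_surjective _ y
      obtain ⟨h1, e⟩ := hR.bracket i j x y
      obtain ⟨h2, e'⟩ := hS.bracket i j ⟨F x, hcoc i x x.2⟩ ⟨F y, hcoc j y y.2⟩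
      simp only [LinearMap.comp_apply, LinearMap.compr₂_apply, LinearMap.compl₁₂_apply,
        DirectSum.lmap_lof]
      rw [hf, hf, e, e', DirectSum.lmap_lof, hf]
      congr 3
      exact hbr i j x x.2.1 y y.2.1
    exact LinearMap.congr_fun₂ key x y
  · intro n hn x
    obtain ⟨x, rfl⟩ := Submodule.Quotient.mk_surjective _ x
    obtain ⟨h1, e⟩ := hR.sq n hn x
    obtain ⟨h2, e'⟩ := hS.sq n hn ⟨F x, hcoc n x x.2⟩
    rw [hf, e, e', hf]
    congr 2
    exact hsq n hn x x.2.1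
  · intro n hn x
    obtain ⟨x, rfl⟩ := Submodule.Quotient.mk_surjective _ x
    obtain ⟨h1, e⟩ := hR.pow n hn x
    obtain ⟨h2, e'⟩ := hS.pow n hn ⟨F x, hcoc n x x.2⟩
    rw [hf, e, e', hf]
    congr 2
    exact hpow n hn x x.2.1

end Model

/-! ### Signs -/

section UnitsSMul

variable {k : Type*} [CommRing k] {N N' : Type*} [AddCommGroup N] [Module k N] [AddCommGroup N']
  [Module k N']

theorem map_intUnits_smul (f : N →ₗ[k] N') (ε : ℤˣ) (b : N) : f (ε • b) = ε • f b := by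
  rcases Int.units_eq_one_or ε with rfl | rfl <;> simp [Units.neg_smul]

theorem intUnits_smul_tmul (ε : ℤˣ) (a : N) (b : N') : (ε • a) ⊗ₜ[k] b = ε • (a ⊗ₜ[k] b) := by
  rcases Int.units_eq_one_or ε with rfl | rfl <;> simp [Units.neg_smul, TensorProduct.neg_tmul]

end UnitsSMul

/-! ### The tensor coalgebra -/

section TensorCoalgebra

variable {k : Type*} [CommRing k] {C : Type*} [AddCommGroup C] [Module k C]

theorem ιInv_one : TensorAlgebra.ιInv (1 : TensorAlgebra k C) = 0 := by
  let _ : Module kᵐᵒᵖ C := Module.compHom _ ((RingHom.id k).fromOpposite mul_comm)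
  have _ : IsCentralScalar k C := ⟨fun r m => rfl⟩
  simp [TensorAlgebra.ιInv]

theorem ιInv_ι (x : C) : TensorAlgebra.ιInv (TensorAlgebra.ι k x) = x :=
  TensorAlgebra.ι_leftInverse x

theorem counit_ι (x : C) : TensorAlgebra.algebraMapInv (TensorAlgebra.ι k x) = 0 := by
  simp [TensorAlgebra.algebraMapInv]

theorem ιInv_ι_mul (x : C) (b : TensorAlgebra k C) :
    TensorAlgebra.ιInv (TensorAlgebra.ι k x * b) = TensorAlgebra.algebraMapInv b • x := by
  let _ : Module kᵐᵒᵖ C := Module.compHom _ ((RingHom.id k).fromOpposite mul_comm)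
  have _ : IsCentralScalar k C := ⟨fun r m => rfl⟩
  have h : (TrivSqZeroExt.fstHom k k C).comp (TensorAlgebra.toTrivSqZeroExt (R := k) (M := C))
      = TensorAlgebra.algebraMapInv := by
    ext y
    simp [counit_ι]
  have h' := DFunLike.congr_fun h b
  simp only [AlgHom.comp_apply, TrivSqZeroExt.fstHom_apply] at h'
  change TrivSqZeroExt.snd (TensorAlgebra.toTrivSqZeroExt (TensorAlgebra.ι k x * b)) = _
  rw [map_mul, TensorAlgebra.toTrivSqZeroExt_ι, TrivSqZeroExt.snd_mul, h']
  simp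

theorem counit_ι_mul (x : C) (b : TensorAlgebra k C) :
    TensorAlgebra.algebraMapInv (TensorAlgebra.ι k x * b) = 0 := by
  rw [map_mul, counit_ι, zero_mul]

theorem deconcatAux_apply_snd (b : TensorAlgebra k C) :
    ∀ z, (deconcatAux k C b z).2 = b * z.2 := by
  induction b using TensorAlgebra.induction with
  | algebraMap r => intro z; simp [Algebra.smul_def]
  | ι x => intro z; simp [deconcatAux]
  | mul a b ha hb => intro z; rw [map_mul, Module.End.mul_apply, ha, hb, mul_assoc]
  | add a b ha hb => intro z; rw [map_add, LinearMap.add_apply, Prod.snd_add, ha, hb, add_mul]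

theorem deconcat_one : deconcat k C 1 = 1 ⊗ₜ 1 := by simp [deconcat]

theorem deconcat_ι_mul (x : C) (b : TensorAlgebra k C) :
    deconcat k C (TensorAlgebra.ι k x * b) = 1 ⊗ₜ (TensorAlgebra.ι k x * b)
      + TensorProduct.map (LinearMap.mulLeft k (TensorAlgebra.ι k x)) LinearMap.id
        (deconcat k C b) := by
  change (deconcatAux k C (TensorAlgebra.ι k x * b) (1 ⊗ₜ 1, 1)).1 = _ + TensorProduct.map _ _
    (deconcatAux k C b (1 ⊗ₜ 1, 1)).1
  have h := deconcatAux_apply_snd b (1 ⊗ₜ 1, 1)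
  rw [map_mul, Module.End.mul_apply]
  generalize deconcatAux k C b (1 ⊗ₜ 1, 1) = z at h ⊢
  obtain ⟨t, a⟩ := z
  simp only [mul_one] at h
  subst h
  simp [deconcatAux, LinearMap.rTensor, add_comm]
  rfl

theorem deconcat_ι (x : C) : deconcat k C (TensorAlgebra.ι k x)
    = 1 ⊗ₜ TensorAlgebra.ι k x + TensorAlgebra.ι k x ⊗ₜ 1 := by
  have h := deconcat_ι_mul (k := k) x 1
  rw [deconcat_one, mul_one] at h
  simpa using h

variable {gr : ℤ → Submodule k C}

namespace HomWord

theorem toBar_nil : HomWord.toBar ([] : HomWord gr) = 1 := rfl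

theorem toBar_cons (l : Σ n : ℤ, gr (n + 1)) (w : HomWord gr) :
    HomWord.toBar (l :: w) = TensorAlgebra.ι k (l.2 : C) * HomWord.toBar w := by
  simp [HomWord.toBar]

theorem toBar_singleton (l : Σ n : ℤ, gr (n + 1)) :
    HomWord.toBar [l] = TensorAlgebra.ι k (l.2 : C) := by
  rw [toBar_cons, toBar_nil, mul_one]

theorem deg_nil : HomWord.deg ([] : HomWord gr) = 0 := rfl

theorem deg_cons (l : Σ n : ℤ, gr (n + 1)) (w : HomWord gr) :
    HomWord.deg (l :: w) = l.1 + HomWord.deg w := by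
  simp [HomWord.deg]

theorem toBar_append (v w : HomWord gr) :
    HomWord.toBar (v ++ w) = HomWord.toBar v * HomWord.toBar w := by
  simp [HomWord.toBar]

theorem deg_append (v w : HomWord gr) :
    HomWord.deg (v ++ w) = HomWord.deg v + HomWord.deg w := by
  simp [HomWord.deg]

theorem deconcat_toBar (w : HomWord gr) :
    deconcat k C w.toBar = ∑ i ∈ Finset.range (w.length + 1),
      HomWord.toBar (w.take i) ⊗ₜ[k] HomWord.toBar (w.drop i) := by
  have h := deconcat_prod k C (w.map fun l => (l.2 : C))
  simp only [List.map_map, List.length_map, ← List.map_take, ← List.map_drop] at h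
  exact h

end HomWord

theorem barGr_one : (1 : TensorAlgebra k C) ∈ barGr gr 0 := Submodule.subset_span ⟨[], rfl, rfl⟩

theorem ι_mem_barGr {n : ℤ} {x : C} (hx : x ∈ gr (n + 1)) : TensorAlgebra.ι k x ∈ barGr gr n :=
  Submodule.subset_span ⟨[⟨n, x, hx⟩], by simp [HomWord.deg], by simp [HomWord.toBar]⟩

theorem mul_mem_barGr {i j : ℤ} {a b : TensorAlgebra k C} (ha : a ∈ barGr gr i)
    (hb : b ∈ barGr gr j) : a * b ∈ barGr gr (i + j) := by
  have h := Submodule.mul_mem_mul ha hb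
  rw [barGr, barGr, Submodule.span_mul_span] at h
  refine Submodule.span_mono ?_ h
  rintro _ ⟨_, ⟨v, rfl, rfl⟩, _, ⟨w, rfl, rfl⟩, rfl⟩
  exact ⟨v ++ w, HomWord.deg_append v w, HomWord.toBar_append v w⟩

theorem ιInv_mem {n : ℤ} {b : TensorAlgebra k C} (hb : b ∈ barGr gr n) :
    TensorAlgebra.ιInv b ∈ gr (n + 1) := by
  induction hb using Submodule.span_induction with
  | mem b hb =>
    obtain ⟨w, rfl, rfl⟩ := hb
    match w with
    | [] => rw [HomWord.toBar_nil, ιInv_one]; exact zero_mem _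
    | [l] =>
      rw [HomWord.toBar_singleton, ιInv_ι, HomWord.deg_cons, HomWord.deg_nil, add_zero]
      exact l.2.2
    | l :: l' :: w =>
      rw [HomWord.toBar_cons, HomWord.toBar_cons, ιInv_ι_mul, counit_ι_mul, zero_smul]
      exact zero_mem _
  | zero => rw [map_zero]; exact zero_mem _
  | add a b _ _ ha hb => rw [map_add]; exact add_mem ha hb
  | smul r a _ ha => rw [map_smul]; exact Submodule.smul_mem _ r ha

/-- The letters of an internally graded module span it, hence the homogeneous words span the
tensor coalgebra. -/
theorem linearMap_ext_toBar (hgr : DirectSum.IsInternal gr) {N : Type*} [AddCommGroup N]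
    [Module k N] {f g : TensorAlgebra k C →ₗ[k] N}
    (h : ∀ w : HomWord gr, f w.toBar = g w.toBar) : f = g := by
  set S := Submodule.span k (Set.range (HomWord.toBar (gr := gr))) with hS
  have hle : S ≤ LinearMap.eqLocus f g := by
    rw [hS, Submodule.span_le]
    rintro _ ⟨w, rfl⟩
    exact h w
  have hι : ∀ x : C, TensorAlgebra.ι k x ∈ S := by
    intro x
    have hx : x ∈ (⊤ : Submodule k C) := trivial
    rw [← hgr.submodule_iSup_eq_top] at hx
    induction hx using Submodule.iSup_induction' with
    | mem i x hx =>
      exact Submodule.subset_span ⟨[⟨i - 1, x, by rwa [sub_add_cancel]⟩], by simp [HomWord.toBar]⟩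
    | zero => rw [map_zero]; exact zero_mem _
    | add x y _ _ hx hy => rw [map_add]; exact add_mem hx hy
  have hmul : ∀ a ∈ S, ∀ b ∈ S, a * b ∈ S := by
    intro a ha b hb
    have h := Submodule.mul_mem_mul ha hb
    rw [hS, Submodule.span_mul_span] at h
    refine Submodule.span_mono ?_ h
    rintro _ ⟨_, ⟨v, rfl⟩, _, ⟨w, rfl⟩, rfl⟩
    exact ⟨v ++ w, HomWord.toBar_append v w⟩
  ext1 b
  refine hle ?_
  induction b using TensorAlgebra.induction with
  | algebraMap r =>
    rw [Algebra.algebraMap_eq_smul_one]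
    exact Submodule.smul_mem _ r (Submodule.subset_span ⟨[], rfl⟩)
  | ι x => exact hι x
  | mul a b ha hb => exact hmul a ha b hb
  | add a b ha hb => exact add_mem ha hb

/-- The left counit law of deconcatenation. -/
theorem counit_deconcat (hgr : DirectSum.IsInternal gr) {N : Type*} [AddCommGroup N] [Module k N]
    (f : TensorAlgebra k C →ₗ[k] N) (b : TensorAlgebra k C) :
    TensorProduct.lift ((LinearMap.lsmul k N).flip.comp f).flip
      (TensorProduct.map TensorAlgebra.algebraMapInv.toLinearMap LinearMap.id (deconcat k C b))
      = f b := by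
  refine DFunLike.congr_fun (f := TensorProduct.lift ((LinearMap.lsmul k N).flip.comp f).flip ∘ₗ
    TensorProduct.map TensorAlgebra.algebraMapInv.toLinearMap LinearMap.id ∘ₗ deconcat k C)
    (linearMap_ext_toBar hgr fun w => ?_) b
  cases w with
  | nil => simp [HomWord.toBar_nil, deconcat_one]
  | cons l w =>
    have h : ∀ t : TensorAlgebra k C ⊗[k] TensorAlgebra k C,
        TensorProduct.map TensorAlgebra.algebraMapInv.toLinearMap LinearMap.id
          (TensorProduct.map (LinearMap.mulLeft k (TensorAlgebra.ι k (l.2 : C))) LinearMap.id t)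
        = (0 : k ⊗[k] TensorAlgebra k C) := by
      intro t
      induction t using TensorProduct.induction_on with
      | zero => simp
      | tmul a b => simp [counit_ι]
      | add a b ha hb => simp only [map_add, ha, hb, add_zero]
    rw [LinearMap.comp_apply, LinearMap.comp_apply, HomWord.toBar_cons, deconcat_ι_mul, map_add,
      h, add_zero]
    simp

/-- An element of the tensor coalgebra is determined by its counit and by splitting off its
first letter. -/
theorem eq_counit_add_firstLetter (hgr : DirectSum.IsInternal gr) (b : TensorAlgebra k C) :
    b = algebraMap k _ (TensorAlgebra.algebraMapInv b)
      + LinearMap.mul' k _ (TensorProduct.map (TensorAlgebra.ι k ∘ₗ TensorAlgebra.ιInv)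
        LinearMap.id (deconcat k C b)) := by
  refine DFunLike.congr_fun (f := LinearMap.id) (g := Algebra.linearMap k _ ∘ₗ
    TensorAlgebra.algebraMapInv.toLinearMap + LinearMap.mul' k _ ∘ₗ
      TensorProduct.map (TensorAlgebra.ι k ∘ₗ TensorAlgebra.ιInv) LinearMap.id ∘ₗ deconcat k C)
    (linearMap_ext_toBar hgr fun w => ?_) b
  cases w with
  | nil => simp [HomWord.toBar_nil, deconcat_one, ιInv_one]
  | cons l w =>
    have h : ∀ t : TensorAlgebra k C ⊗[k] TensorAlgebra k C,
        LinearMap.mul' k _ (TensorProduct.map (TensorAlgebra.ι k ∘ₗ TensorAlgebra.ιInv)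
          LinearMap.id (TensorProduct.map
            (LinearMap.mulLeft k (TensorAlgebra.ι k (l.2 : C))) LinearMap.id t))
        = TensorAlgebra.ι k (l.2 : C) * TensorProduct.lift ((LinearMap.lsmul k _).flip.comp
            (LinearMap.id (M := TensorAlgebra k C))).flip
          (TensorProduct.map TensorAlgebra.algebraMapInv.toLinearMap LinearMap.id t) := by
      intro t
      induction t using TensorProduct.induction_on with
      | zero => simp
      | tmul a b => simp [ιInv_ι_mul]
      | add a b ha hb => simp only [map_add, ha, hb, mul_add]
    rw [HomWord.toBar_cons]
    simp only [LinearMap.add_apply, LinearMap.comp_apply, AlgHom.toLinearMap_apply, counit_ι_mul,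
      map_zero, zero_add, LinearMap.id_apply]
    rw [deconcat_ι_mul, map_add, map_add, h, counit_deconcat hgr]
    simp [ιInv_one]

/-- Primitive elements are words of length one. -/
theorem eq_ι_of_primitive (hgr : DirectSum.IsInternal gr) {b : TensorAlgebra k C}
    (hb : deconcat k C b = 1 ⊗ₜ b + b ⊗ₜ 1) :
    b = TensorAlgebra.ι k (TensorAlgebra.ιInv b) := by
  have h1 := eq_counit_add_firstLetter hgr b
  have h2 := counit_deconcat hgr LinearMap.id b
  rw [hb] at h1 h2
  simp [ιInv_one] at h1 h2
  rw [Algebra.algebraMap_eq_smul_one, h2, zero_add] at h1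
  exact h1

/-- The automorphism of the tensor coalgebra that multiplies homogeneous elements of degree `n`
by `(-1)^{q n}`. -/
def barSign (hgr : DirectSum.IsInternal gr) (q : ℤ) : TensorAlgebra k C →ₐ[k] TensorAlgebra k C :=
  TensorAlgebra.lift k
    (TensorAlgebra.ι k ∘ₗ gradedSign gr hgr fun i => (q * (i - 1)).negOnePow)

theorem barSign_ι (hgr : DirectSum.IsInternal gr) (q n : ℤ) {x : C} (hx : x ∈ gr (n + 1)) :
    barSign hgr q (TensorAlgebra.ι k x) = (q * n).negOnePow • TensorAlgebra.ι k x := by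
  rw [barSign, TensorAlgebra.lift_ι_apply, LinearMap.comp_apply, gradedSign_apply _ _ _ _ _ hx,
    add_sub_cancel_right]
  rcases Int.units_eq_one_or (q * n).negOnePow with h | h <;> rw [h] <;> simp [Units.neg_smul]

theorem counit_barSign (hgr : DirectSum.IsInternal gr) (q : ℤ) (b : TensorAlgebra k C) :
    TensorAlgebra.algebraMapInv (barSign hgr q b) = TensorAlgebra.algebraMapInv b := by
  refine DFunLike.congr_fun (f := TensorAlgebra.algebraMapInv.comp (barSign hgr q)) ?_ b
  ext x
  simp [barSign, counit_ι]

theorem barSign_toBar (hgr : DirectSum.IsInternal gr) (q : ℤ) (w : HomWord gr) :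
    barSign hgr q w.toBar = (q * w.deg).negOnePow • w.toBar := by
  induction w with
  | nil => simp [HomWord.toBar_nil, HomWord.deg_nil]
  | cons l w ih =>
    rw [HomWord.toBar_cons, map_mul, ih, barSign_ι hgr q l.1 l.2.2, HomWord.deg_cons, mul_add,
      Int.negOnePow_add, smul_mul_assoc, mul_smul_comm, smul_smul]

theorem barSign_of_mem (hgr : DirectSum.IsInternal gr) (q n : ℤ) {b : TensorAlgebra k C}
    (hb : b ∈ barGr gr n) : barSign hgr q b = (q * n).negOnePow • b := by
  induction hb using Submodule.span_induction with
  | mem b hb => obtain ⟨w, rfl, rfl⟩ := hb; exact barSign_toBar hgr q w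
  | zero => simp
  | add a b _ _ ha hb => rw [map_add, ha, hb, smul_add]
  | smul r a _ ha => rw [map_smul, ha, smul_comm]

theorem barSign_even (hgr : DirectSum.IsInternal gr) {q : ℤ} (hq : Even q)
    (b : TensorAlgebra k C) : barSign hgr q b = b := by
  refine DFunLike.congr_fun (f := (barSign hgr q).toLinearMap) (g := LinearMap.id)
    (linearMap_ext_toBar hgr fun w => ?_) b
  rw [AlgHom.toLinearMap_apply, barSign_toBar, Int.negOnePow_even _ (hq.mul_right _), one_smul]
  rfl

end TensorCoalgebra

/-! ### Products of letters in a `B_∞`-algebra -/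

namespace BInfStructure

variable {k : Type*} [CommRing k] {C : Type*} [AddCommGroup C] [Module k C]
  {gr : ℤ → Submodule k C} (X : BInfStructure k gr)

theorem d_one : X.d 1 = 0 := by
  have h := X.d_hmul [] 1
  rw [HomWord.toBar_nil, X.one_hmul, X.hmul_one, X.one_hmul, HomWord.deg_nil, Int.negOnePow_zero,
    one_smul] at h
  exact left_eq_add.1 h

/-- Left multiplication by a letter is a graded coderivation. -/
theorem deconcat_hmul_ι (hgr : DirectSum.IsInternal gr) {q : ℤ} {x : C} (hx : x ∈ gr (q + 1))
    (b : TensorAlgebra k C) :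
    deconcat k C (X.hmul (TensorAlgebra.ι k x) b)
      = TensorProduct.map (X.hmul (TensorAlgebra.ι k x)) LinearMap.id (deconcat k C b)
        + TensorProduct.map (barSign hgr q).toLinearMap (X.hmul (TensorAlgebra.ι k x))
          (deconcat k C b) := by
  refine DFunLike.congr_fun (f := deconcat k C ∘ₗ X.hmul (TensorAlgebra.ι k x))
    (g := (TensorProduct.map (X.hmul (TensorAlgebra.ι k x)) LinearMap.id
      + TensorProduct.map (barSign hgr q).toLinearMap (X.hmul (TensorAlgebra.ι k x)))
        ∘ₗ deconcat k C) (linearMap_ext_toBar hgr fun w => ?_) b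
  have h := X.comul_hmul [⟨q, x, hx⟩] w
  rw [HomWord.toBar_singleton] at h
  rw [LinearMap.comp_apply, LinearMap.comp_apply, h, HomWord.deconcat_toBar, map_sum,
    Finset.sum_comm]
  refine Finset.sum_congr rfl fun j _ => ?_
  rw [List.length_singleton, Finset.sum_range_succ, Finset.sum_range_one]
  simp only [List.take_zero, List.drop_zero, HomWord.toBar_nil, X.one_hmul,
    HomWord.toBar_singleton, LinearMap.add_apply, TensorProduct.map_tmul, LinearMap.id_apply,
    AlgHom.toLinearMap_apply, barSign_toBar, intUnits_smul_tmul]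
  rw [add_comm]
  simp [HomWord.deg, HomWord.toBar, X.one_hmul]

theorem deconcat_d (hgr : DirectSum.IsInternal gr) (b : TensorAlgebra k C) :
    deconcat k C (X.d b) = TensorProduct.map X.d LinearMap.id (deconcat k C b)
      + TensorProduct.map (barSign hgr 1).toLinearMap X.d (deconcat k C b) := by
  refine DFunLike.congr_fun (f := deconcat k C ∘ₗ X.d)
    (g := (TensorProduct.map X.d LinearMap.id
      + TensorProduct.map (barSign hgr 1).toLinearMap X.d)
        ∘ₗ deconcat k C) (linearMap_ext_toBar hgr fun w => ?_) b
  rw [LinearMap.comp_apply, LinearMap.comp_apply, X.comul_d, HomWord.deconcat_toBar, map_sum]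
  refine Finset.sum_congr rfl fun i _ => ?_
  simp only [LinearMap.add_apply, TensorProduct.map_tmul, LinearMap.id_apply,
    AlgHom.toLinearMap_apply, barSign_toBar, intUnits_smul_tmul, one_mul]

theorem d_ι (hgr : DirectSum.IsInternal gr) (x : C) :
    X.d (TensorAlgebra.ι k x) = TensorAlgebra.ι k (X.m₁ x) := by
  refine eq_ι_of_primitive hgr ?_
  rw [X.deconcat_d hgr, deconcat_ι]
  simp [d_one, add_comm]

theorem m₁_mem {n : ℤ} {x : C} (hx : x ∈ gr (n + 1)) : X.m₁ x ∈ gr (n + 1 + 1) :=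
  ιInv_mem (X.d_mem _ _ (ι_mem_barGr hx))

theorem d_hmul_ι {n : ℤ} {x : C} (hx : x ∈ gr (n + 1)) (b : TensorAlgebra k C) :
    X.d (X.hmul (TensorAlgebra.ι k x) b)
      = X.hmul (X.d (TensorAlgebra.ι k x)) b
        + n.negOnePow • X.hmul (TensorAlgebra.ι k x) (X.d b) := by
  have h := X.d_hmul [⟨n, x, hx⟩] b
  simpa [HomWord.toBar_singleton, HomWord.deg] using h

/-- The graded commutator of two letters is a letter. -/
theorem hmul_ι_sub (hgr : DirectSum.IsInternal gr) {i j : ℤ} {x y : C} (hx : x ∈ gr (i + 1))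
    (hy : y ∈ gr (j + 1)) :
    X.hmul (TensorAlgebra.ι k x) (TensorAlgebra.ι k y)
        - (i * j).negOnePow • X.hmul (TensorAlgebra.ι k y) (TensorAlgebra.ι k x)
      = TensorAlgebra.ι k (X.circ x y - (i * j).negOnePow • X.circ y x) := by
  have h := eq_ι_of_primitive hgr (b := X.hmul (TensorAlgebra.ι k x) (TensorAlgebra.ι k y)
    - (i * j).negOnePow • X.hmul (TensorAlgebra.ι k y) (TensorAlgebra.ι k x)) ?_
  · rw [h]
    rw [map_sub, map_intUnits_smul]
    rfl
  · rw [map_sub, map_intUnits_smul, X.deconcat_hmul_ι hgr hx, X.deconcat_hmul_ι hgr hy,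
      deconcat_ι, deconcat_ι]
    simp only [map_add, TensorProduct.map_tmul, LinearMap.id_apply, X.hmul_one,
      AlgHom.toLinearMap_apply, map_one, barSign_ι hgr i j hy, barSign_ι hgr j i hx, mul_comm j i]
    rcases Int.units_eq_one_or (i * j).negOnePow with h | h <;> rw [h] <;>
      simp [Units.neg_smul, TensorProduct.tmul_sub, TensorProduct.sub_tmul, TensorProduct.tmul_add,
        TensorProduct.add_tmul, TensorProduct.neg_tmul] <;> abel

/-- The square of a letter of odd degree is a letter, because it is primitive. -/
theorem hmul_ι_self (hgr : DirectSum.IsInternal gr) {n : ℤ} (hn : Odd n) {x : C}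
    (hx : x ∈ gr (n + 1)) :
    X.hmul (TensorAlgebra.ι k x) (TensorAlgebra.ι k x) = TensorAlgebra.ι k (X.circ x x) := by
  refine eq_ι_of_primitive hgr ?_
  rw [X.deconcat_hmul_ι hgr hx, deconcat_ι]
  simp only [map_add, TensorProduct.map_tmul, LinearMap.id_apply, X.hmul_one,
    AlgHom.toLinearMap_apply, map_one, barSign_ι hgr n n hx, Int.negOnePow_odd _ (hn.mul hn),
    Units.neg_smul, one_smul, TensorProduct.neg_tmul]
  abel

theorem barPow_succ' (x : C) (n : ℕ) :
    X.barPow x (n + 1) = X.hmul (TensorAlgebra.ι k x) (X.barPow x n) := by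
  induction n with
  | zero => simp [barPow, X.one_hmul, X.hmul_one]
  | succ n ih =>
    calc X.barPow x (n + 1 + 1)
        = X.hmul (X.hmul (TensorAlgebra.ι k x) (X.barPow x n)) (TensorAlgebra.ι k x) := by
          rw [← ih]; rfl
      _ = X.hmul (TensorAlgebra.ι k x) (X.barPow x (n + 1)) := X.hmul_assoc _ _ _

theorem barPow_eq_iterate (x : C) (n : ℕ) :
    X.barPow x n = (X.hmul (TensorAlgebra.ι k x))^[n] 1 := by
  induction n with
  | zero => rfl
  | succ n ih => rw [barPow_succ', ih, Function.iterate_succ_apply']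

theorem barPow_one (x : C) : X.barPow x 1 = TensorAlgebra.ι k x := by
  rw [barPow, barPow, X.one_hmul]

theorem barPow_mem {n : ℤ} {x : C} (hx : x ∈ gr (n + 1)) (i : ℕ) :
    X.barPow x i ∈ barGr gr (i * n) := by
  induction i with
  | zero => rw [Nat.cast_zero, zero_mul]; exact barGr_one
  | succ i ih =>
    have h := X.hmul_mem _ _ _ ih _ (ι_mem_barGr hx)
    rwa [show (i : ℤ) * n + n = ((i + 1 : ℕ) : ℤ) * n by push_cast; ring] at h

/-- The coproduct of the powers of a letter of even degree. -/
theorem deconcat_barPow (hgr : DirectSum.IsInternal gr) {n : ℤ} (hn : Even n) {x : C}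
    (hx : x ∈ gr (n + 1)) (i : ℕ) :
    deconcat k C (X.barPow x i)
      = binomConv (TensorProduct.mk k _ _) (X.barPow x) (X.barPow x) i := by
  set l := X.hmul (TensorAlgebra.ι k x)
  have hsign : (barSign hgr n).toLinearMap = LinearMap.id := by
    ext1 b
    exact barSign_even hgr hn b
  have h1 : ∀ i, deconcat k C (X.barPow x i) = (fun t =>
      TensorProduct.map l LinearMap.id t + TensorProduct.map LinearMap.id l t)^[i] (1 ⊗ₜ 1) := by
    intro i
    induction i with
    | zero => exact deconcat_one
    | succ i ih =>
      rw [barPow_succ', X.deconcat_hmul_ι hgr hx, ih, Function.iterate_succ_apply', hsign]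
  rw [h1]
  refine (iterate_bilin (TensorProduct.mk k (TensorAlgebra k C) (TensorAlgebra k C)) _ l l
    (fun s t => ?_) (fun a b => ?_) 1 1 i).trans ?_
  · simp only [map_add]; abel
  · simp
  · refine binomConv_congr _ _ _ _ _ _ _ fun i j _ => ?_
    rw [← barPow_eq_iterate, ← barPow_eq_iterate]

/-- The `p`-th power of a letter of even degree is a letter, because it is primitive. -/
theorem barPow_prime (p : ℕ) [Fact p.Prime] [CharP k p] (hgr : DirectSum.IsInternal gr) {n : ℤ}
    (hn : Even n) {x : C} (hx : x ∈ gr (n + 1)) :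
    X.barPow x p = TensorAlgebra.ι k (X.power p x) := by
  refine eq_ι_of_primitive hgr ?_
  rw [X.deconcat_barPow hgr hn hx, binomConv_prime, add_comm]
  rfl

theorem hmul_barPow (x : C) (n : ℕ) :
    X.hmul (X.barPow x n)
      = (X.hmul (TensorAlgebra.ι k x) : Module.End k (TensorAlgebra k C)) ^ n := by
  induction n with
  | zero => ext1 b; exact X.one_hmul b
  | succ n ih =>
    ext1 b
    rw [barPow_succ', X.hmul_assoc, ih, pow_succ', Module.End.mul_apply]

end BInfStructure

/-! ### Powers of boundaries in a `B_∞`-algebra -/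

namespace BInfStructure

variable {k : Type*} [CommRing k] {C : Type*} [AddCommGroup C] [Module k C]
  {gr : ℤ → Submodule k C} (X : BInfStructure k gr)

/-- The right action of the bar construction on `ΣC`: the component in `ΣC` of the differential of
the word `c w`. It collects the higher products of the underlying `A_∞`-algebra. -/
def act (w : TensorAlgebra k C) : Module.End k C where
  toFun c := TensorAlgebra.ιInv (X.d (TensorAlgebra.ι k c * w))
  map_add' c c' := by rw [map_add, add_mul, map_add, map_add]
  map_smul' r c := by rw [map_smul, smul_mul_assoc, map_smul, map_smul, RingHom.id_apply]

/-- The action of the bar construction, as a linear map. -/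
def actHom : TensorAlgebra k C →ₗ[k] Module.End k C where
  toFun := X.act
  map_add' w w' := by
    ext c
    simp only [act, LinearMap.coe_mk, AddHom.coe_mk, LinearMap.add_apply, mul_add, map_add]
  map_smul' r w := by
    ext c
    simp only [act, LinearMap.coe_mk, AddHom.coe_mk, LinearMap.smul_apply, mul_smul_comm,
      map_smul, RingHom.id_apply]

theorem actHom_apply (w : TensorAlgebra k C) (c : C) :
    X.actHom w c = TensorAlgebra.ιInv (X.d (TensorAlgebra.ι k c * w)) := rfl

theorem actHom_one : X.actHom 1 = X.m₁ := by
  ext c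
  rw [actHom_apply, mul_one]
  rfl

theorem actHom_mem {i j : ℤ} {w : TensorAlgebra k C} {c : C} (hw : w ∈ barGr gr i)
    (hc : c ∈ gr (j + 1)) : X.actHom w c ∈ gr (j + i + 1 + 1) :=
  ιInv_mem (X.d_mem _ _ (mul_mem_barGr (ι_mem_barGr hc) hw))

/-- The component in `ΣC` of the differential of a word, by splitting off its first letter. -/
theorem ιInv_d_eq (hgr : DirectSum.IsInternal gr) (w : TensorAlgebra k C) :
    TensorAlgebra.ιInv (X.d w)
      = TensorProduct.lift (X.actHom.flip ∘ₗ TensorAlgebra.ιInv) (deconcat k C w) := by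
  have h := congrArg (TensorAlgebra.ιInv ∘ₗ X.d) (eq_counit_add_firstLetter hgr w)
  rw [Algebra.algebraMap_eq_smul_one, map_add, map_smul] at h
  simp only [LinearMap.comp_apply, X.d_one, map_zero, smul_zero, zero_add] at h
  rw [h]
  generalize deconcat k C w = t
  induction t using TensorProduct.induction_on with
  | zero => simp
  | tmul a b => simp [actHom_apply]
  | add a b ha hb => simp only [map_add, ha, hb]

/-- The differential of a word, by splitting off its first letter. -/
theorem d_ι_mul (hgr : DirectSum.IsInternal gr) {q : ℤ} {c : C} (hc : c ∈ gr (q + 1))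
    (w : TensorAlgebra k C) :
    X.d (TensorAlgebra.ι k c * w)
      = LinearMap.mul' k _ (TensorProduct.map (TensorAlgebra.ι k ∘ₗ X.actHom.flip c) LinearMap.id
          (deconcat k C w))
        + q.negOnePow • (TensorAlgebra.ι k c * X.d w) := by
  have hε : q.negOnePow • (TensorAlgebra.ι k c * X.d w)
      = barSign hgr 1 (TensorAlgebra.ι k c) * X.d w := by
    rw [barSign_ι hgr 1 q hc, one_mul, smul_mul_assoc]
  have hι : barSign hgr 1 (TensorAlgebra.ι k c)
      = TensorAlgebra.ι k (q.negOnePow • c) := by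
    rw [barSign_ι hgr 1 q hc, one_mul]
    rw [map_intUnits_smul]
  have h1 := eq_counit_add_firstLetter hgr (X.d (TensorAlgebra.ι k c * w))
  rw [X.counit_d, map_zero, zero_add, X.deconcat_d hgr, deconcat_ι_mul] at h1
  have h2 := counit_deconcat hgr
    (LinearMap.mulLeft k (barSign hgr 1 (TensorAlgebra.ι k c)) ∘ₗ X.d) w
  rw [LinearMap.comp_apply, LinearMap.mulLeft_apply] at h2
  rw [h1, hε, ← h2]
  simp only [map_add, TensorProduct.map_tmul, X.d_one, LinearMap.comp_apply, map_zero,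
    TensorProduct.zero_tmul, zero_add, AlgHom.toLinearMap_apply, map_one, ιInv_one]
  generalize deconcat k C w = t
  induction t using TensorProduct.induction_on with
  | zero => simp
  | tmul a b =>
    simp only [TensorProduct.map_tmul, LinearMap.id_apply, LinearMap.comp_apply,
      LinearMap.mulLeft_apply, AlgHom.toLinearMap_apply, map_mul, LinearMap.mul'_apply,
      TensorProduct.lift.tmul, LinearMap.flip_apply, LinearMap.lsmul_apply, actHom_apply]
    rw [hι, ιInv_ι_mul, counit_barSign, map_smul, smul_mul_assoc]
  | add a b ha hb =>
    simp only [map_add]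
    rw [add_add_add_comm, ha, hb]
    abel

/-- The relation `d ^ 2 = 0` on words beginning with the letter `c`. -/
theorem act_act (hgr : DirectSum.IsInternal gr) {q : ℤ} {c : C} (hc : c ∈ gr (q + 1))
    (w : TensorAlgebra k C) :
    TensorProduct.lift (X.actHom.flip ∘ₗ X.actHom.flip c) (deconcat k C w)
      = -(q.negOnePow • X.actHom (X.d w) c) := by
  have h := congrArg (TensorAlgebra.ιInv ∘ₗ X.d) (X.d_ι_mul hgr hc w)
  rw [map_add, map_intUnits_smul] at h
  simp only [LinearMap.comp_apply, X.d_d, map_zero] at h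
  rw [← actHom_apply] at h
  rw [← add_eq_zero_iff_eq_neg, h]
  congr 1
  generalize deconcat k C w = t
  induction t using TensorProduct.induction_on with
  | zero => simp
  | tmul a b => simp [actHom_apply]
  | add a b ha hb => simp only [map_add, ha, hb]

theorem d_barPow (hgr : DirectSum.IsInternal gr) {n : ℤ} {x : C} (hx : x ∈ gr (n + 1))
    (hdx : X.m₁ x = 0) (i : ℕ) : X.d (X.barPow x i) = 0 := by
  induction i with
  | zero => exact X.d_one
  | succ i ih => rw [barPow_succ', X.d_hmul_ι hx, ih, X.d_ι hgr, hdx]; simp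

theorem m₁_m₁ (hgr : DirectSum.IsInternal gr) (x : C) : X.m₁ (X.m₁ x) = 0 := by
  have h := X.d_d (TensorAlgebra.ι k x)
  rw [X.d_ι hgr, X.d_ι hgr] at h
  exact (TensorAlgebra.ι_eq_zero_iff k _).1 h

/-- The `p`-th power of a boundary of even degree is a boundary: it is the differential of the
`p`-th coefficient of the holonomy of the gauge flow `t ↦ exp (t [m₁ y])` generated by `y`. -/
theorem power_m₁_mem (p : ℕ) [Fact p.Prime] [CharP k p] (hgr : DirectSum.IsInternal gr) {n : ℤ}
    (hn : Even n) {y : C} (hy : y ∈ gr n) :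
    ∃ z ∈ gr (p * n), X.m₁ z = X.power p (X.m₁ y) := by
  have hy' : y ∈ gr (n - 1 + 1) := by rwa [sub_add_cancel]
  have hn1 : Odd (n - 1) := hn.sub_odd odd_one
  set a := X.m₁ y with ha
  have haM : a ∈ gr (n + 1) := by
    have := X.m₁_mem hy'
    rwa [sub_add_cancel] at this
  have hda : ∀ i, X.d (X.barPow a i) = 0 := X.d_barPow hgr haM (X.m₁_m₁ hgr y)
  -- `exp (t a)` and `y exp (t a)`, whose coproducts are `exp ⊗ exp` and
  -- `y exp ⊗ exp + exp ⊗ y exp`; `d (y exp (t a))` is the derivative of `exp (t a)`.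
  let A : ℕ → TensorAlgebra k C := X.barPow a
  let V : ℕ → TensorAlgebra k C := fun i => X.hmul (TensorAlgebra.ι k y) (A i)
  have hA : ∀ i : ℕ, A i ∈ barGr gr (i * n) := X.barPow_mem haM
  have hV : ∀ i : ℕ, V i ∈ barGr gr (n - 1 + i * n) := fun i =>
    X.hmul_mem _ _ _ (ι_mem_barGr hy') _ (hA i)
  have hdV : ∀ i, X.d (V i) = A (i + 1) := fun i => by
    rw [X.d_hmul_ι hy', hda, X.d_ι hgr, ← ha, ← barPow_succ']; simp [A]
  have hΔA : ∀ i, deconcat k C (A i) = binomConv (TensorProduct.mk k _ _) A A i :=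
    X.deconcat_barPow hgr hn haM
  have hΔV : ∀ i, deconcat k C (V i) = binomConv (TensorProduct.mk k _ _) V A i
      + binomConv (TensorProduct.mk k _ _) A V i := fun i => by
    rw [X.deconcat_hmul_ι hgr hy', hΔA, map_binomConv, map_binomConv]
    congr 1
    · exact binomConv_congr _ _ _ _ _ _ _ fun i j _ => rfl
    refine binomConv_congr _ _ _ _ _ _ _ fun i j _ => ?_
    change barSign hgr (n - 1) (A i) ⊗ₜ V j = A i ⊗ₜ V j
    rw [barSign_of_mem hgr _ _ (hA i), Int.negOnePow_even _ ((hn.mul_left _).mul_left _), one_smul]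
  let g : ℕ → C := fun i => TensorAlgebra.ιInv (A i)
  let h : ℕ → C := fun i => TensorAlgebra.ιInv (V i)
  let G : ℕ → Module.End k C := fun i => X.actHom (A i)
  let H : ℕ → Module.End k C := fun i => X.actHom (V i)
  have hu : ∀ i : ℕ, holonomy h H i ∈ gr (i * n) := by
    refine holonomy_mem h H (fun i : ℕ => gr (i * n)) (fun i => ?_) (fun i j c hc => ?_)
    · have := ιInv_mem (hV i)
      rwa [show n - 1 + i * n + 1 = ((i + 1 : ℕ) : ℤ) * n by push_cast; ring] at this
    · have := X.actHom_mem (j := i * n - 1) (hV j) (by rwa [sub_add_cancel])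
      rwa [show i * n - 1 + (n - 1 + j * n) + 1 + 1 = ((i + j + 1 : ℕ) : ℤ) * n by
        push_cast; ring] at this
  have key := eq_binomConv_holonomy g h G H ιInv_one (fun i => ?_) (fun i j => ?_) p
  · rw [binomConv_prime] at key
    refine ⟨holonomy h H p, hu p, ?_⟩
    rw [holonomy_zero, map_zero, zero_add] at key
    change TensorAlgebra.ιInv (X.barPow a p) = X.actHom 1 _ at key
    rw [actHom_one] at key
    exact key.symm
  · change TensorAlgebra.ιInv (A (i + 1)) = _
    rw [← hdV, X.ιInv_d_eq hgr, hΔV, map_add, map_binomConv, map_binomConv]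
    congr 1
    · rw [← binomConv_flip]
      exact binomConv_congr _ _ _ _ _ _ _ fun i j _ => rfl
    · rw [← binomConv_flip]
      exact binomConv_congr _ _ _ _ _ _ _ fun i j _ => rfl
  · set c := holonomy h H j
    have hc : c ∈ gr (j * n - 1 + 1) := by rw [sub_add_cancel]; exact hu j
    have e := X.act_act hgr hc (V i)
    rw [Int.negOnePow_odd _ ((hn.mul_left _).sub_odd odd_one), Units.neg_smul, one_smul, neg_neg,
      hdV, hΔV, map_add, map_binomConv, map_binomConv] at e
    change X.actHom (A (i + 1)) c = _
    rw [← e]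
    have hap : ∀ K L : ℕ → Module.End k C, binomConv (LinearMap.mul k (Module.End k C)) K L i c
        = binomConv ((LinearMap.mul k (Module.End k C)).compr₂ (LinearMap.applyₗ c)) K L i :=
      fun K L => map_binomConv (LinearMap.applyₗ c) _ K L i
    rw [hap, hap, ← binomConv_flip _ G H]
    congr 1
    · exact binomConv_congr _ _ _ _ _ _ _ fun i j _ => rfl
    · rw [← binomConv_flip _ H G]
      exact binomConv_congr _ _ _ _ _ _ _ fun i j _ => rfl

/-- The circle square of a boundary of odd degree is a boundary. -/
theorem circ_m₁_mem (hgr : DirectSum.IsInternal gr) {n : ℤ} (hn : Odd n) {y : C} (hy : y ∈ gr n) :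
    ∃ z ∈ gr (2 * n), X.m₁ z = X.circ (X.m₁ y) (X.m₁ y) := by
  have hy' : y ∈ gr (n - 1 + 1) := by rwa [sub_add_cancel]
  have hn1 : Even (n - 1) := hn.sub_odd odd_one
  set a := X.m₁ y with ha
  have haM : a ∈ gr (n + 1) := by
    have := X.m₁_mem hy'
    rwa [sub_add_cancel] at this
  have hda : X.d (TensorAlgebra.ι k a) = 0 := by rw [X.d_ι hgr, ha, X.m₁_m₁ hgr, map_zero]
  set v := X.hmul (TensorAlgebra.ι k y) (TensorAlgebra.ι k a) with hv
  have hvM : v ∈ barGr gr (n - 1 + n) := X.hmul_mem _ _ _ (ι_mem_barGr hy') _ (ι_mem_barGr haM)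
  have hdv : X.d v = X.hmul (TensorAlgebra.ι k a) (TensorAlgebra.ι k a) := by
    rw [hv, X.d_hmul_ι hy', hda, X.d_ι hgr, ← ha]; simp
  have hΔv : deconcat k C v = 1 ⊗ₜ v + TensorAlgebra.ι k a ⊗ₜ TensorAlgebra.ι k y
      + TensorAlgebra.ι k y ⊗ₜ TensorAlgebra.ι k a + v ⊗ₜ 1 := by
    rw [hv, X.deconcat_hmul_ι hgr hy', deconcat_ι]
    simp only [map_add, TensorProduct.map_tmul, LinearMap.id_apply, X.hmul_one,
      AlgHom.toLinearMap_apply, barSign_even hgr hn1]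
    abel
  have h1 := X.ιInv_d_eq hgr v
  rw [hdv, hΔv] at h1
  have h2 := X.act_act hgr hy' (TensorAlgebra.ι k y)
  rw [deconcat_ι, Int.negOnePow_even _ hn1, one_smul, X.d_ι hgr] at h2
  simp only [map_add, TensorProduct.lift.tmul, LinearMap.comp_apply, LinearMap.flip_apply,
    actHom_one, ιInv_ι, ιInv_one, map_zero, LinearMap.zero_apply, zero_add, ← ha] at h1 h2
  refine ⟨TensorAlgebra.ιInv v - X.actHom (TensorAlgebra.ι k y) y, sub_mem ?_ ?_, ?_⟩
  · have := ιInv_mem hvM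
    rwa [show n - 1 + n + 1 = 2 * n by ring] at this
  · have := X.actHom_mem (ι_mem_barGr hy') hy'
    rwa [show n - 1 + (n - 1) + 1 + 1 = 2 * n by ring] at this
  · rw [map_sub, circ, h1, ← sub_eq_zero]
    rw [← sub_eq_zero] at h2
    rw [← neg_eq_zero, ← h2]
    abel

/-- Left multiplication in the bar construction embeds `ΣC` in the endomorphisms of `BC`. -/
def assocModel (p : ℕ) [Fact p.Prime] [CharP k p] (hgr : DirectSum.IsInternal gr) :
    AssocModel p X.sgr (fun _ => X.m₁) (fun _ => X.circ) (fun _ => X.power p)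
      (Module.End k (TensorAlgebra k C)) where
  ρ n := X.hmul ∘ₗ TensorAlgebra.ι k ∘ₗ (X.sgr n).subtype
  ρ_injective n x y h := by
    have h1 := LinearMap.congr_fun h 1
    simp only [LinearMap.comp_apply, X.hmul_one] at h1
    exact Subtype.ext ((TensorAlgebra.ι_inj k _ _).1 h1)
  μ := X.d
  ρ_d n x := by
    refine ⟨X.m₁_mem x.2, ?_⟩
    ext1 b
    have h := X.d_hmul_ι x.2 b
    rw [X.d_ι hgr] at h
    exact eq_sub_of_add_eq h.symm
  ρ_bracket i j x y := by
    have h := X.hmul_ι_sub hgr x.2 y.2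
    refine ⟨?_, ?_⟩
    · have h1 : X.circ x y - (i * j).negOnePow • X.circ y x
          = TensorAlgebra.ιInv (X.hmul (TensorAlgebra.ι k x) (TensorAlgebra.ι k y)
            - (i * j).negOnePow • X.hmul (TensorAlgebra.ι k y) (TensorAlgebra.ι k x)) := by
        rw [h, ιInv_ι]
      rw [h1]
      refine ιInv_mem (sub_mem (X.hmul_mem _ _ _ (ι_mem_barGr x.2) _ (ι_mem_barGr y.2)) ?_)
      have h2 := X.hmul_mem _ _ _ (ι_mem_barGr y.2) _ (ι_mem_barGr x.2)
      rw [add_comm j i] at h2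
      rcases Int.units_eq_one_or (i * j).negOnePow with e | e <;> rw [e]
      · rwa [one_smul]
      · rw [Units.neg_smul, one_smul]; exact neg_mem h2
    · change X.hmul (TensorAlgebra.ι k _) = _
      refine (congrArg X.hmul h).symm.trans (LinearMap.ext fun b => ?_)
      rw [map_sub, map_intUnits_smul]
      change X.hmul _ b - (i * j).negOnePow • X.hmul _ b = _
      rw [X.hmul_assoc, X.hmul_assoc]
      rfl
  ρ_sq n hn x := by
    have h := X.hmul_ι_self hgr hn x.2
    refine ⟨?_, ?_⟩
    · have := ιInv_mem (X.hmul_mem _ _ _ (ι_mem_barGr x.2) _ (ι_mem_barGr x.2))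
      rwa [← two_mul] at this
    · change X.hmul (TensorAlgebra.ι k (X.circ x x)) = _
      rw [← h, sq]
      ext1 b
      exact X.hmul_assoc _ _ _
  ρ_pow n hn x := by
    refine ⟨ιInv_mem (X.barPow_mem x.2 p), ?_⟩
    change X.hmul (TensorAlgebra.ι k (X.power p x)) = _
    rw [← X.barPow_prime p hgr hn x.2, hmul_barPow]
    rfl
  sq_boundary n hn y hy := by
    obtain ⟨z, hz, e⟩ := X.circ_m₁_mem hgr hn (y := y) (by rwa [sgr, sub_add_cancel] at hy)
    exact ⟨z, by rw [sgr, sub_add_cancel]; exact hz, e⟩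
  pow_boundary n hn y hy := by
    obtain ⟨z, hz, e⟩ := X.power_m₁_mem p hgr hn (y := y) (by rwa [sgr, sub_add_cancel] at hy)
    exact ⟨z, by rw [sgr, sub_add_cancel]; exact hz, e⟩

/-- In the brace case the product with a letter on the right factors through words of length at
most one. -/
theorem power_eq_iterCirc (hgr : DirectSum.IsInternal gr) (hX : X.IsBrace) {n : ℤ} {x : C}
    (hx : x ∈ gr (n + 1)) (i : ℕ) : X.power (i + 1) x = X.iterCirc x i := by
  have hbr : ∀ b, TensorAlgebra.ιInv (X.hmul b (TensorAlgebra.ι k x))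
      = X.circ (TensorAlgebra.ιInv b) x + TensorAlgebra.algebraMapInv b • x := by
    refine DFunLike.congr_fun (f := TensorAlgebra.ιInv ∘ₗ X.hmul.flip (TensorAlgebra.ι k x))
      (g := TensorAlgebra.ιInv ∘ₗ X.hmul.flip (TensorAlgebra.ι k x) ∘ₗ TensorAlgebra.ι k
        ∘ₗ TensorAlgebra.ιInv + TensorAlgebra.algebraMapInv.toLinearMap.smulRight x)
      (linearMap_ext_toBar hgr fun w => ?_)
    match w with
    | [] => simp [HomWord.toBar_nil, X.one_hmul, ιInv_one, ιInv_ι]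
    | [l] => simp [HomWord.toBar_singleton, ιInv_ι, counit_ι]
    | l :: l' :: w =>
      have h := hX (l :: l' :: w) [⟨n, x, hx⟩] (by simp) (by simp)
      rw [HomWord.toBar_singleton] at h
      simp only [LinearMap.comp_apply, LinearMap.flip_apply, LinearMap.add_apply, h]
      simp [HomWord.toBar_cons, ιInv_ι_mul, counit_ι]
  have hε : ∀ i, TensorAlgebra.algebraMapInv (X.barPow x (i + 1)) = 0 := fun i => by
    rw [barPow, X.counit_hmul, counit_ι, mul_zero]
  induction i with
  | zero => rw [power, barPow_one, ιInv_ι]; rfl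
  | succ i ih => rw [power, barPow, hbr, hε, zero_smul, add_zero, iterCirc, ← ih]; rfl

end BInfStructure

namespace BInfHom

variable {k : Type*} [CommRing k] {C : Type*} [AddCommGroup C] [Module k C]
  {D : Type*} [AddCommGroup D] [Module k D] {gr : ℤ → Submodule k C} {gr' : ℤ → Submodule k D}
  {X : BInfStructure k gr} {Y : BInfStructure k gr'} (F : BInfHom X Y)

theorem toFun_ι (hgr' : DirectSum.IsInternal gr') (x : C) :
    F.toFun (TensorAlgebra.ι k x) = TensorAlgebra.ι k (F.linearPart x) := by
  refine eq_ι_of_primitive hgr' ?_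
  rw [F.map_comul, deconcat_ι, map_add, TensorProduct.map_tmul, TensorProduct.map_tmul, F.map_one]

theorem linearPart_mem {n : ℤ} {x : C} (hx : x ∈ gr (n + 1)) : F.linearPart x ∈ gr' (n + 1) :=
  ιInv_mem (F.map_mem _ _ (ι_mem_barGr hx))

theorem toFun_barPow (hgr' : DirectSum.IsInternal gr') (x : C) (n : ℕ) :
    F.toFun (X.barPow x n) = Y.barPow (F.linearPart x) n := by
  induction n with
  | zero => exact F.map_one
  | succ n ih => rw [BInfStructure.barPow, F.map_hmul, ih, F.toFun_ι hgr']; rfl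

theorem exists_isInducedMap (p : ℕ) [Fact p.Prime] [CharP k p] (hgr : DirectSum.IsInternal gr)
    (hgr' : DirectSum.IsInternal gr') :
    ∃ f : ∀ n, X.shiftedCohomology n →ₗ[k] Y.shiftedCohomology n,
      IsInducedMap f F.linearPart ∧
      ∀ (R : RestrictedGradedLie k p X.shiftedCohomology)
        (S : RestrictedGradedLie k p Y.shiftedCohomology),
        X.Induces R → Y.Induces S → IsRestrictedLieHom R S f := by
  refine _root_.exists_isInducedMap F.linearPart (fun n x hx => F.linearPart_mem hx)
    (fun n x _ => ?_) (fun i j x hx y hy => ?_) (fun n hn x hx => ?_) (fun n hn x hx => ?_)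
  · rw [← TensorAlgebra.ι_inj k, ← F.toFun_ι hgr', ← X.d_ι hgr, ← Y.d_ι hgr', F.map_d,
      F.toFun_ι hgr']
  · rw [← TensorAlgebra.ι_inj k, ← F.toFun_ι hgr', ← X.hmul_ι_sub hgr hx hy,
      ← Y.hmul_ι_sub hgr' (F.linearPart_mem hx) (F.linearPart_mem hy), map_sub,
      map_intUnits_smul, F.map_hmul, F.map_hmul, F.toFun_ι hgr', F.toFun_ι hgr']
  · rw [← TensorAlgebra.ι_inj k, ← F.toFun_ι hgr', ← X.hmul_ι_self hgr hn hx,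
      ← Y.hmul_ι_self hgr' hn (F.linearPart_mem hx), F.map_hmul, F.toFun_ι hgr']
  · rw [← TensorAlgebra.ι_inj k, ← F.toFun_ι hgr', ← X.barPow_prime p hgr hn hx,
      ← Y.barPow_prime p hgr' hn (F.linearPart_mem hx), F.toFun_barPow hgr']

end BInfHom

/-! ### Functions on strings of morphisms -/

namespace DGCat

variable {k : Type u} [CommRing k] {A : DGCat.{u, v, w} k}

/-- The sum of a function over all the ways to cut a string in two. -/
def Str.cutSum {W : Type*} [AddCommMonoid W] : {a c : A.Obj} → (s : A.Str a c) →
    (∀ b : A.Obj, A.Str a b → A.Str b c → W) → W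
  | _, _, .nil a, Φ => Φ a (.nil a) (.nil a)
  | _, _, .cons f s, Φ => Φ _ (.nil _) (.cons f s) + s.cutSum fun b s₁ s₂ => Φ b (.cons f s₁) s₂

/-- The linear map that multiplies a morphism of degree `i` by `(-1)^{n (i - 1)}`: the sign of
moving an operation of degree `n` past it. -/
def sgn (n : ℤ) {a b : A.Obj} : A.Hom a b →ₗ[k] A.Hom a b :=
  gradedSign _ (A.isInternal a b) fun i => (n * (i - 1)).negOnePow

/-- The sign of moving an operation of degree `n` past a string. -/
def Str.sgn (n : ℤ) {a b : A.Obj} (s : A.Str a b) : A.Str a b :=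
  s.signed fun i => (n * (i - 1)).negOnePow

theorem Str.sgn_cons (n : ℤ) {a b c : A.Obj} (f : A.Hom a b) (s : A.Str b c) :
    (Str.cons f s).sgn n = .cons (DGCat.sgn n f) (s.sgn n) := rfl

theorem Str.sgn_nil (n : ℤ) (a : A.Obj) : (Str.nil a).sgn n = .nil a := rfl

/-- The right action of a cochain `x` of degree `n` on functions `F` of strings, evaluated at `s`:
the signed sum of the values of `F` at the strings obtained from `s` by applying `x` to a
substring. The recursion distinguishes whether the substring begins at the first entry; see
`circ_eq_ins`. -/
def ins (n : ℤ) (x : A.PreCochain) {W : Type*} [AddCommMonoid W] : {a c : A.Obj} →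
    (s : A.Str a c) → (A.Str a c → W) → W
  | _, _, .nil a, F => F (.cons (x a a (.nil a)) (.nil a))
  | _, _, .cons f s, F => ins n x s (fun t => F (.cons (sgn n f) t))
      + (Str.cons f s).cutSum fun b s₁ s₂ => F (.cons (x _ b s₁) s₂)

section CutSum

variable {W : Type*} [AddCommMonoid W] {a c : A.Obj}

theorem Str.sum_map_cuts (s : A.Str a c) (Φ : ∀ b : A.Obj, A.Str a b → A.Str b c → W) :
    (s.cuts.map fun z => Φ z.1 z.2.1 z.2.2).sum = s.cutSum Φ := by
  induction s with
  | nil a => simp [Str.cuts, Str.cutSum]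
  | cons f s ih =>
    rw [Str.cuts, Str.cutSum, List.map_cons, List.sum_cons, List.map_map, ← ih]
    rfl

theorem ins_eq_sum_cuts (n : ℤ) (x : A.PreCochain) (s : A.Str a c) (F : A.Str a c → W) :
    (s.cuts.map fun z => (z.2.2.cuts.map fun z' =>
      F ((z.2.1.sgn n).append (.cons (x z.1 z'.1 z'.2.1) z'.2.2))).sum).sum = ins n x s F := by
  induction s with
  | nil a => simp [Str.cuts, ins, Str.append, Str.sgn_nil]
  | cons f s ih =>
    have h1 := Str.sum_map_cuts (Str.cons f s) fun b s₁ s₂ => F (.cons (x _ b s₁) s₂)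
    rw [ins, ← ih, ← h1, add_comm]
    conv_lhs => rw [Str.cuts, List.map_cons, List.sum_cons, List.map_map]
    rfl

theorem circ_eq_ins (n : ℤ) (x y : A.PreCochain) (a b : A.Obj) (s : A.Str a b) :
    circ n x y a b s = ins n y s (x a b) :=
  ins_eq_sum_cuts n y s (x a b)

theorem Str.cutSum_congr (s : A.Str a c) {Φ Ψ : ∀ b : A.Obj, A.Str a b → A.Str b c → W}
    (h : ∀ b s₁ s₂, Φ b s₁ s₂ = Ψ b s₁ s₂) : s.cutSum Φ = s.cutSum Ψ := by
  rw [show Φ = Ψ from funext fun b => funext fun s₁ => funext fun s₂ => h b s₁ s₂]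

theorem Str.cutSum_add (s : A.Str a c) (Φ Ψ : ∀ b : A.Obj, A.Str a b → A.Str b c → W) :
    s.cutSum (fun b s₁ s₂ => Φ b s₁ s₂ + Ψ b s₁ s₂) = s.cutSum Φ + s.cutSum Ψ := by
  induction s with
  | nil a => rfl
  | cons f s ih => rw [Str.cutSum, Str.cutSum, Str.cutSum, ih, add_add_add_comm]

theorem Str.map_cutSum {W' G : Type*} [AddCommMonoid W'] [FunLike G W W']
    [AddMonoidHomClass G W W'] (g : G) (s : A.Str a c)
    (Φ : ∀ b : A.Obj, A.Str a b → A.Str b c → W) :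
    g (s.cutSum Φ) = s.cutSum fun b s₁ s₂ => g (Φ b s₁ s₂) := by
  induction s with
  | nil a => rfl
  | cons f s ih => rw [Str.cutSum, Str.cutSum, map_add, ih]

/-- Coassociativity of cutting strings. -/
theorem Str.cutSum_cutSum (s : A.Str a c)
    (Φ : ∀ b b' : A.Obj, A.Str a b → A.Str b b' → A.Str b' c → W) :
    s.cutSum (fun b s₁ s₂ => s₂.cutSum fun b' t₁ t₂ => Φ b b' s₁ t₁ t₂)
      = s.cutSum fun b' s₁ s₂ => s₁.cutSum fun b t₁ t₂ => Φ b b' t₁ t₂ s₂ := by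
  induction s with
  | nil a => rfl
  | cons f s ih =>
    simp only [Str.cutSum]
    rw [ih, Str.cutSum_add, add_assoc]

theorem Str.HasDeg.cutSum_mem {M : Type*} [AddCommGroup M] [Module k M] {s : A.Str a c} {e : ℤ}
    (hs : s.HasDeg e) (N : Submodule k M) (Φ : ∀ b : A.Obj, A.Str a b → A.Str b c → M)
    (h : ∀ b s₁ s₂ e₁ e₂, Str.HasDeg s₁ e₁ → Str.HasDeg s₂ e₂ → e₁ + e₂ = e → Φ b s₁ s₂ ∈ N) :
    s.cutSum Φ ∈ N := by
  induction hs with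
  | nil a => exact h _ _ _ 0 0 (.nil a) (.nil a) (add_zero 0)
  | cons i e f s hf hs ih =>
    refine add_mem (h _ _ _ 0 _ (.nil _) (.cons i e f s hf hs) (zero_add _)) (ih _ ?_)
    intro b s₁ s₂ e₁ e₂ h₁ h₂ he
    exact h _ _ _ _ e₂ (.cons i e₁ f s₁ hf h₁) h₂ (by rw [← he]; ring)

theorem ins_add (n : ℤ) (x : A.PreCochain) (s : A.Str a c) (F G : A.Str a c → W) :
    ins n x s (F + G) = ins n x s F + ins n x s G := by
  induction s with
  | nil a => rfl
  | cons f s ih =>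
    rw [ins, ins, ins, add_add_add_comm, ← Str.cutSum_add, ← ih]
    rfl
end CutSum

section Linear

variable {W : Type*} [AddCommGroup W] [Module k W] {a c : A.Obj}

theorem map_ins {W' : Type*} [AddCommGroup W'] [Module k W'] (g : W →ₗ[k] W') (n : ℤ)
    (x : A.PreCochain) (s : A.Str a c) (F : A.Str a c → W) :
    g (ins n x s F) = ins n x s fun t => g (F t) := by
  induction s with
  | nil a => rfl
  | cons f s ih => rw [ins, ins, map_add, ih, Str.map_cutSum]

/-- The right action of a cochain `x` of degree `n` on functions of strings. -/
def insL (n : ℤ) (x : A.PreCochain) : Module.End k (A.Str a c → W) where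
  toFun F s := ins n x s F
  map_add' F G := funext fun s => ins_add n x s F G
  map_smul' r F := funext fun s => (map_ins (r • LinearMap.id) n x s F).symm

theorem insL_apply (n : ℤ) (x : A.PreCochain) (F : A.Str a c → W) (s : A.Str a c) :
    insL (k := k) n x F s = ins n x s F := rfl

/-- The product `b ⋆ K` of a function `b` of strings starting at `a` and a family `K` of functions
of strings ending at `c` that depends linearly on a value of `b`: cut the string in two, evaluate
`b` at the first part, then `K` at the second. -/
def star {V : A.Obj → Type*} [∀ b, AddCommGroup (V b)] [∀ b, Module k (V b)] :
    (∀ b, A.Str a b → V b) →ₗ[k] (∀ b, V b →ₗ[k] (A.Str b c → W)) →ₗ[k] (A.Str a c → W) :=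
  LinearMap.mk₂ k (fun β K s => s.cutSum fun b s₁ s₂ => K b (β b s₁) s₂)
    (fun β β' K => funext fun s => by
      simp only [Pi.add_apply, map_add, Str.cutSum_add])
    (fun r β K => funext fun s => by
      simp only [Pi.smul_apply, map_smul]
      exact (Str.map_cutSum (r • LinearMap.id (R := k) (M := W)) s _).symm)
    (fun β K K' => funext fun s => by
      simp only [Pi.add_apply, LinearMap.add_apply, Str.cutSum_add])
    (fun r β K => funext fun s => by
      simp only [Pi.smul_apply, LinearMap.smul_apply]
      exact (Str.map_cutSum (r • LinearMap.id (R := k) (M := W)) s _).symm)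

section Star

variable {V : A.Obj → Type*} [∀ b, AddCommGroup (V b)] [∀ b, Module k (V b)]

theorem star_apply (β : ∀ b, A.Str a b → V b) (K : ∀ b, V b →ₗ[k] (A.Str b c → W))
    (s : A.Str a c) : star β K s = s.cutSum fun b s₁ s₂ => K b (β b s₁) s₂ := rfl

theorem star_nil (β : ∀ b, A.Str a b → V b) (K : ∀ b, V b →ₗ[k] (A.Str b a → W)) :
    star β K (.nil a) = K a (β a (.nil a)) (.nil a) := rfl

theorem star_cons {b : A.Obj} (β : ∀ b, A.Str a b → V b) (K : ∀ b, V b →ₗ[k] (A.Str b c → W))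
    (f : A.Hom a b) (s : A.Str b c) :
    star β K (.cons f s) = K a (β a (.nil a)) (.cons f s)
      + star (fun b t => β b (.cons f t)) K s := rfl

/-- The action of a cochain is a derivation of the product `⋆`. -/
theorem ins_star (n : ℤ) (x : A.PreCochain) (β : ∀ b, A.Str a b → V b)
    (K : ∀ b, V b →ₗ[k] (A.Str b c → W)) (s : A.Str a c) :
    ins n x s (star β K) = star (fun b => insL (k := k) n x (β b)) K s
      + star (fun b t => β b (t.sgn n)) (fun b => insL n x ∘ₗ K b) s := by
  induction s with
  | nil a =>
    simp only [ins, star_cons, star_nil, insL_apply, Str.sgn_nil, LinearMap.comp_apply]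
    rw [add_comm]
  | @cons a b c f s ih =>
    have e1 : (fun t => star β K (.cons (sgn n f) t))
        = (fun t => K a (β a (.nil a)) (.cons (sgn n f) t))
          + star (fun b t => β b (.cons (sgn n f) t)) K := rfl
    have e2 : (fun b' t => insL (k := k) n x (β b') (.cons f t))
        = (fun b' => insL (k := k) n x (fun t => β b' (.cons (sgn n f) t)))
          + fun b' t => (Str.cons f t).cutSum fun b s₁ s₂ => β b' (.cons (x _ b s₁) s₂) := rfl
    have e3 : ((Str.cons f s).cutSum fun b s₁ s₂ => star β K (.cons (x _ b s₁) s₂))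
        = ((Str.cons f s).cutSum fun b s₁ s₂ => K a (β a (.nil a)) (.cons (x _ b s₁) s₂))
          + (Str.cons f s).cutSum fun b s₁ s₂ => s₂.cutSum fun b' t₁ t₂ =>
              K b' (β b' (.cons (x _ b s₁) t₁)) t₂ := by
      rw [← Str.cutSum_add]
      rfl
    have e4 : star (fun b' t => (Str.cons f t).cutSum fun b s₁ s₂ => β b' (.cons (x _ b s₁) s₂)) K s
        = s.cutSum fun b' t s₂ => (Str.cons f t).cutSum fun b s₁ t₂ =>
            K b' (β b' (.cons (x _ b s₁) t₂)) s₂ := by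
      rw [star_apply]
      refine Str.cutSum_congr _ fun b' t s₂ => ?_
      exact Str.map_cutSum ((LinearMap.proj s₂ : (A.Str b' c → W) →ₗ[k] W) ∘ₗ K b') _ _
    rw [ins, e1, ins_add, ih, e3, Str.cutSum_cutSum, star_cons, star_cons, e2, map_add,
      LinearMap.add_apply, Pi.add_apply, e4]
    simp only [insL_apply, LinearMap.comp_apply, ins, Str.sgn_nil, Str.sgn_cons, Str.cutSum]
    abel

end Star

end Linear

/-! ### Multilinear functions of strings -/

section Multilinear

variable {W : Type*} [AddCommGroup W] [Module k W] {a e : A.Obj}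

/-- The function `F` of strings is linear in each entry of the string. -/
def IsMultilinearFun (F : A.Str a e → W) : Prop :=
  ∀ (b c : A.Obj) (s : A.Str a b) (t : A.Str c e) (r : k) (f g : A.Hom b c),
    F (s.append (.cons (r • f + g) t)) = r • F (s.append (.cons f t)) + F (s.append (.cons g t))

theorem IsMultilinear.isMultilinearFun {x : A.PreCochain} (hx : IsMultilinear x) (a b : A.Obj) :
    IsMultilinearFun (x a b) := fun _ _ s t r f g => hx _ _ _ _ s t r f g

namespace IsMultilinearFun

theorem tail {F : A.Str a e → W} (hF : IsMultilinearFun F) {b : A.Obj} (f : A.Hom a b) :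
    IsMultilinearFun fun t => F (.cons f t) := fun _ _ s t r g h => hF _ _ (.cons f s) t r g h

/-- A multilinear function of strings, as a family of functions of the tails of the strings
that depends linearly on the first entry. -/
def head {F : A.Str a e → W} (hF : IsMultilinearFun F) (b : A.Obj) :
    A.Hom a b →ₗ[k] (A.Str b e → W) where
  toFun f t := F (.cons f t)
  map_add' f g := funext fun t => by simpa [Str.append] using hF _ _ (.nil a) t 1 f g
  map_smul' r f := funext fun t => by
    have h0 := hF _ _ (.nil a) t 1 0 (0 : A.Hom a b)
    have h := hF _ _ (.nil a) t r f 0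
    simp only [one_smul, add_zero, left_eq_add, Str.append] at h0 h
    rw [h0, add_zero] at h
    exact h

theorem head_apply {F : A.Str a e → W} (hF : IsMultilinearFun F) {b : A.Obj} (f : A.Hom a b)
    (t : A.Str b e) : hF.head b f t = F (.cons f t) := rfl

theorem map {W' : Type*} [AddCommGroup W'] [Module k W'] (φ : W →ₗ[k] W') {F : A.Str a e → W}
    (hF : IsMultilinearFun F) : IsMultilinearFun fun t => φ (F t) := by
  intro b c s t r f g
  change φ (F _) = r • φ (F _) + φ (F _)
  rw [hF, map_add, map_smul]

theorem cutSum {a c : A.Obj} {Φ : ∀ b : A.Obj, A.Str a b → A.Str b c → W}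
    (h₁ : ∀ b s₂, IsMultilinearFun fun s₁ => Φ b s₁ s₂)
    (h₂ : ∀ b s₁, IsMultilinearFun (Φ b s₁)) : IsMultilinearFun fun s => s.cutSum Φ := by
  intro b e s t r f g
  induction s with
  | nil a =>
    simp only [Str.append, Str.cutSum]
    have e1 := h₂ a (.nil a) _ _ (.nil a) t r f g
    simp only [Str.append] at e1
    have e2 : (t.cutSum fun b s₁ s₂ => Φ b (.cons (r • f + g) s₁) s₂)
        = t.cutSum fun b s₁ s₂ =>
          (r • LinearMap.id (R := k) (M := W)) (Φ b (.cons f s₁) s₂) + Φ b (.cons g s₁) s₂ :=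
      Str.cutSum_congr t fun b s₁ s₂ => h₁ b s₂ _ _ (.nil a) s₁ r f g
    rw [e1, e2, Str.cutSum_add, ← Str.map_cutSum]
    simp only [LinearMap.smul_apply, LinearMap.id_apply, smul_add]
    abel
  | cons f' s ih =>
    simp only [Str.append, Str.cutSum]
    have e1 := h₂ _ (.nil _) _ _ (.cons f' s) t r f g
    simp only [Str.append] at e1
    have e2 := ih (Φ := fun b s₁ s₂ => Φ b (.cons f' s₁) s₂) (fun b s₂ => (h₁ b s₂).tail f')
      (fun b s₁ => h₂ b (.cons f' s₁)) f g
    simp only at e2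
    rw [e1, e2]
    simp only [smul_add]
    abel

theorem star {c : A.Obj} {V : A.Obj → Type*} [∀ b, AddCommGroup (V b)] [∀ b, Module k (V b)]
    {β : ∀ b, A.Str a b → V b} {K : ∀ b, V b →ₗ[k] (A.Str b c → W)}
    (hβ : ∀ b, IsMultilinearFun (β b)) (hK : ∀ b v, IsMultilinearFun (K b v)) :
    IsMultilinearFun (star β K) :=
  cutSum (fun b s₂ => (hβ b).map ((LinearMap.proj s₂ : (A.Str b c → W) →ₗ[k] W) ∘ₗ K b))
    fun b _s₁ => hK b _

/-- Multilinear functions of strings are determined by their values on strings of homogeneous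
morphisms. -/
theorem ext_hasDeg {F G : A.Str a e → W} (hF : IsMultilinearFun F) (hG : IsMultilinearFun G)
    (h : ∀ s i, Str.HasDeg s i → F s = G s) (s : A.Str a e) : F s = G s := by
  induction s with
  | nil a => exact h _ 0 (.nil a)
  | @cons a b c f s ih =>
    have hf : f ∈ (⊤ : Submodule k (A.Hom a b)) := trivial
    rw [← (A.isInternal a b).submodule_iSup_eq_top] at hf
    rw [← hF.head_apply, ← hG.head_apply]
    induction hf using Submodule.iSup_induction' with
    | mem i f hf =>
      exact ih (hF.tail f) (hG.tail f) fun s j hs => h _ _ (.cons i j f s hf hs)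
    | zero => simp
    | add f g _ _ hf hg => rw [map_add, map_add, Pi.add_apply, Pi.add_apply, hf, hg]

theorem smul_sgn {F : A.Str a e → W} (hF : IsMultilinearFun F) (n : ℤ) {s : A.Str a e} {i : ℤ}
    (hs : s.HasDeg i) : F (s.sgn n) = (n * i).negOnePow • F s := by
  induction hs with
  | nil a => simp [Str.sgn_nil]
  | cons i j f s hf hs ih =>
    rw [Str.sgn_cons, sgn, gradedSign_apply _ _ _ _ _ hf]
    have e1 := congrFun (map_intUnits_smul (hF.head _) (n * (i - 1)).negOnePow f) (s.sgn n)
    rw [head_apply] at e1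
    rw [e1, mul_add, Int.negOnePow_add, mul_smul, ← ih (hF.tail f)]
    rfl

theorem comp_sgn {F : A.Str a e → W} (hF : IsMultilinearFun F) (n : ℤ) :
    IsMultilinearFun fun s => F (s.sgn n) := by
  intro b c s t r f g
  induction s with
  | nil a =>
    have := hF _ _ (.nil a) (t.sgn n) r (DGCat.sgn n f) (DGCat.sgn n g)
    simp only [Str.append, Str.sgn_cons, map_add, map_smul] at this ⊢
    exact this
  | cons f' s ih => exact ih (hF.tail (DGCat.sgn n f')) f g

theorem ins {F : A.Str a e → W} (hF : IsMultilinearFun F) (n : ℤ) {x : A.PreCochain}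
    (hx : IsMultilinear x) : IsMultilinearFun fun s => ins n x s F := by
  have hcut : ∀ {a : A.Obj} {F : A.Str a e → W}, IsMultilinearFun F →
      IsMultilinearFun fun s => s.cutSum fun b s₁ s₂ => F (.cons (x _ b s₁) s₂) := by
    intro a F hF
    exact star (fun b => hx.isMultilinearFun a b) (K := hF.head) fun b f => hF.tail f
  intro b c s t r f g
  induction s with
  | nil a =>
    have e1 := hcut hF _ _ (.nil a) t r f g
    simp only [Str.append] at e1 ⊢
    have e2 : (fun t => F (.cons (DGCat.sgn n (r • f + g)) t))
        = (r • (fun t => F (.cons (DGCat.sgn n f) t)) + fun t => F (.cons (DGCat.sgn n g) t)) := by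
      change hF.head _ _ = r • hF.head _ _ + hF.head _ _
      rw [map_add, map_smul, map_add, map_smul]
    rw [DGCat.ins, DGCat.ins, DGCat.ins, e1, e2, ins_add]
    have e3 := congrFun (map_smul (insL (k := k) n x) r fun t => F (.cons (DGCat.sgn n f) t)) t
    rw [insL_apply] at e3
    rw [e3, Pi.smul_apply, insL_apply, smul_add]
    abel
  | cons f' s ih =>
    have e1 := hcut hF _ _ (.cons f' s) t r f g
    simp only [Str.append] at e1 ⊢
    have e2 := ih (hF.tail (DGCat.sgn n f')) f g
    simp only at e2
    rw [DGCat.ins, DGCat.ins, DGCat.ins, e1, e2, smul_add]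
    abel

end IsMultilinearFun

theorem IsMultilinear.circ {x y : A.PreCochain} (hx : IsMultilinear x) (hy : IsMultilinear y)
    (n : ℤ) : IsMultilinear (circ n x y) := by
  intro a b c e s t r f g
  simp only [circ_eq_ins]
  exact (hx.isMultilinearFun a e).ins n hy b c s t r f g

end Multilinear

end DGCat

/-! ### Insertion of cochains as a right action -/

namespace DGCat

variable {k : Type u} [CommRing k] {A : DGCat.{u, v, w} k}

/-- The identity cochain: it sends a string of length one to its entry and vanishes on the other
strings. -/
def ident (A : DGCat.{u, v, w} k) : A.PreCochain := fun _ _ s =>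
  match s with
  | .nil _ => 0
  | .cons f (.nil _) => f
  | .cons _ (.cons _ _) => 0

theorem ident_sgn (n : ℤ) {a b : A.Obj} (s : A.Str a b) :
    A.ident a b (s.sgn n) = sgn n (A.ident a b s) := by
  cases s with
  | nil => exact (map_zero _).symm
  | cons f s =>
    cases s with
    | nil => rfl
    | cons g s => exact (map_zero _).symm

theorem isMultilinear_ident : IsMultilinear A.ident := by
  intro a b c e s t r f g
  cases s with
  | nil => cases t <;> simp [Str.append, ident]
  | cons f' s =>
    cases s with
    | nil => cases t <;> simp [Str.append, ident]
    | cons f'' s => simp [Str.append, ident]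

theorem cutSum_ident {a c : A.Obj} (s : A.Str a c) :
    ∀ {e : A.Obj} (Φ : ∀ b, A.Str a b → A.Hom e b),
      (s.cutSum fun b s₁ s₂ => A.ident e c (.cons (Φ b s₁) s₂)) = Φ c s := by
  induction s with
  | nil a => intro e Φ; rfl
  | cons f s ih =>
    intro e Φ
    rw [Str.cutSum, ih fun b s₁ => Φ b (.cons f s₁)]
    exact zero_add _

theorem ins_congr {W : Type*} [AddCommMonoid W] {a c : A.Obj} (n : ℤ)
    (x : A.PreCochain) (s : A.Str a c) {F G : A.Str a c → W}
    (h : ∀ b (f : A.Hom a b) t, F (.cons f t) = G (.cons f t)) : ins n x s F = ins n x s G := by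
  cases s with
  | nil a => exact h _ _ _
  | cons f s =>
    rw [ins, ins, Str.cutSum_congr _ fun b s₁ s₂ => h _ (x _ b s₁) s₂]
    congr 2
    exact funext fun t => h _ _ _

section Star

variable {W : Type*} [AddCommGroup W] [Module k W] {a c : A.Obj}

theorem insL_ident (n : ℤ) (x : A.PreCochain) :
    insL (k := k) n x (A.ident a c) = x a c := by
  funext s
  cases s with
  | nil a => rfl
  | cons f s =>
    rw [insL_apply, ins, cutSum_ident (Str.cons f s) fun b s₁ => x a b s₁,
      ins_congr n x s (G := 0), ← insL_apply (k := k), map_zero, Pi.zero_apply, zero_add]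
    intros
    rfl

theorem star_ident_nil (K : ∀ b, A.Hom a b →ₗ[k] (A.Str b a → W)) :
    star (A.ident a) K (.nil a) = 0 := by
  rw [star_nil, ident, map_zero]
  rfl

theorem star_ident_cons {b : A.Obj} (K : ∀ b, A.Hom a b →ₗ[k] (A.Str b c → W)) (f : A.Hom a b)
    (t : A.Str b c) : star (A.ident a) K (.cons f t) = K b f t := by
  rw [star_cons, show A.ident a a (.nil a) = 0 from rfl, map_zero, Pi.zero_apply, zero_add]
  cases t with
  | nil => rfl
  | cons g t =>
    rw [star_cons, show (fun b t => A.ident a b (.cons f (.cons g t))) = 0 from rfl, map_zero,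
      LinearMap.zero_apply, Pi.zero_apply, add_zero]
    rfl

/-- Away from the empty string, a multilinear function is the product of the identity cochain and
its `head`. -/
theorem insL_star_ident {F : A.Str a c → W} (hF : IsMultilinearFun F) (n : ℤ) (x : A.PreCochain) :
    insL (k := k) n x (star (A.ident a) hF.head) = insL n x F :=
  funext fun s => ins_congr n x s fun _ f t => star_ident_cons hF.head f t

theorem insL_star {V : A.Obj → Type*} [∀ b, AddCommGroup (V b)] [∀ b, Module k (V b)] (n : ℤ)
    (x : A.PreCochain) (β : ∀ b, A.Str a b → V b) (K : ∀ b, V b →ₗ[k] (A.Str b c → W)) :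
    insL n x (star β K) = star (fun b => insL (k := k) n x (β b)) K
      + star (fun b t => β b (t.sgn n)) (fun b => insL n x ∘ₗ K b) :=
  funext fun s => ins_star n x β K s

/-- A substring of a string either begins at the first entry or lies in the tail. -/
theorem insL_eq_star {F : A.Str a c → W} (hF : IsMultilinearFun F) (n : ℤ) (x : A.PreCochain) :
    insL (k := k) n x F = star (x a) hF.head
      + star (A.ident a) (fun b => insL n x ∘ₗ hF.head b ∘ₗ sgn n) := by
  rw [← insL_star_ident hF, insL_star]
  simp only [insL_ident, ident_sgn]
  rfl

/-- The recursion of `insL_eq_star` determines the action of a cochain on multilinear functions. -/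
theorem eq_insL {z : A.PreCochain} {n : ℤ} (θ : ∀ a, Module.End k (A.Str a c → W))
    (hθ : ∀ a (F : A.Str a c → W) (hF : IsMultilinearFun F), θ a F = star (z a) hF.head
      + star (A.ident a) (fun b => θ b ∘ₗ hF.head b ∘ₗ sgn n))
    {F : A.Str a c → W} (hF : IsMultilinearFun F) : θ a F = insL n z F := by
  funext s
  induction s with
  | nil a => rw [hθ _ _ hF, insL_eq_star hF, Pi.add_apply, Pi.add_apply, star_ident_nil,
      star_ident_nil]
  | cons f s ih =>
    rw [hθ _ _ hF, insL_eq_star hF, Pi.add_apply, Pi.add_apply, star_ident_cons, star_ident_cons]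
    exact congrArg _ (ih θ hθ (hF.tail (sgn n f)))

end Star

theorem sgn_apply (n i : ℤ) {a b : A.Obj} {f : A.Hom a b} (hf : f ∈ A.gr a b i) :
    sgn n f = (n * (i - 1)).negOnePow • f :=
  gradedSign_apply _ _ _ _ _ hf

theorem linearMap_ext_gr {a b : A.Obj} {N : Type*} [AddCommGroup N] [Module k N]
    {φ ψ : A.Hom a b →ₗ[k] N} (h : ∀ i, ∀ f ∈ A.gr a b i, φ f = ψ f) : φ = ψ := by
  refine LinearMap.ext fun f => ?_
  have hf : f ∈ (⊤ : Submodule k (A.Hom a b)) := trivial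
  rw [← (A.isInternal a b).submodule_iSup_eq_top] at hf
  induction hf using Submodule.iSup_induction' with
  | mem i f hf => exact h i f hf
  | zero => simp
  | add f g _ _ hf hg => rw [map_add, map_add, hf, hg]

theorem sgn_comp_sgn (i j : ℤ) {a b : A.Obj} :
    sgn i ∘ₗ sgn j = (sgn (i + j) : A.Hom a b →ₗ[k] A.Hom a b) := by
  refine linearMap_ext_gr fun l f hf => ?_
  rw [LinearMap.comp_apply, sgn_apply j l hf, map_intUnits_smul, sgn_apply i l hf,
    sgn_apply _ l hf, smul_smul, ← Int.negOnePow_add]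
  congr 2
  ring

theorem sgn_of_even {n : ℤ} (hn : Even n) {a b : A.Obj} :
    (sgn n : A.Hom a b →ₗ[k] A.Hom a b) = LinearMap.id := by
  refine linearMap_ext_gr fun l f hf => ?_
  rw [sgn_apply n l hf, Int.negOnePow_even _ (hn.mul_right _), one_smul, LinearMap.id_apply]

theorem Str.sgn_of_even {n : ℤ} (hn : Even n) {a b : A.Obj} (s : A.Str a b) : s.sgn n = s := by
  induction s with
  | nil => rfl
  | cons f s ih => rw [Str.sgn_cons, ih, DGCat.sgn_of_even hn, LinearMap.id_apply]

/-- Moving an operation of degree `j` past the arguments of a cochain of degree `i` differs by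
`(-1)^{i j}` from moving it past the value. -/
theorem apply_sgn_of_mem {i : ℤ} {x : A.PreCochain} (hx : x ∈ A.shiftedCochains i) (j : ℤ)
    {a b : A.Obj} (s : A.Str a b) :
    x a b (s.sgn j) = (j * i).negOnePow • sgn j (x a b s) := by
  have hm := hx.1.isMultilinearFun a b
  refine IsMultilinearFun.ext_hasDeg (hm.comp_sgn j)
    (hm.map ((((j * i).negOnePow : ℤˣ) : ℤ) • sgn j)) (fun s e hs => ?_) s
  change x a b (s.sgn j) = (j * i).negOnePow • sgn j (x a b s)
  rw [hm.smul_sgn j hs, sgn_apply j _ (hx.2 a b s e hs), smul_smul, ← Int.negOnePow_add]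
  congr 1
  rw [Int.negOnePow_eq_iff]
  exact ⟨-(j * i), by ring⟩

section Star

variable {W : Type*} [AddCommGroup W] [Module k W] {a c : A.Obj}

theorem map_insL {W' : Type*} [AddCommGroup W'] [Module k W'] (g : W →ₗ[k] W') (n : ℤ)
    (x : A.PreCochain) (F : A.Str a c → W) :
    insL (k := k) n x (fun s => g (F s)) = fun s => g (insL (k := k) n x F s) :=
  funext fun s => (map_ins g n x s F).symm

/-- Two successive insertions into a string. -/
theorem insL_insL {i : ℤ} {x : A.PreCochain} (hx : x ∈ A.shiftedCochains i) (j : ℤ)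
    (y : A.PreCochain) {F : A.Str a c → W} (hF : IsMultilinearFun F) :
    insL (k := k) j y (insL (k := k) i x F) = star (circ j x y a) hF.head
      + (j * i).negOnePow • star (x a) (fun b => insL j y ∘ₗ hF.head b ∘ₗ sgn j)
      + star (y a) (fun b => insL i x ∘ₗ hF.head b ∘ₗ sgn i)
      + star (A.ident a) (fun b => (insL j y ∘ₗ insL i x) ∘ₗ hF.head b ∘ₗ sgn (i + j)) := by
  have e1 : (fun b => insL (k := k) j y (x a b)) = circ j x y a :=
    funext fun b => funext fun s => (circ_eq_ins j x y a b s).symm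
  have e2 : star (fun b t => x a b (t.sgn j)) (fun b => insL (k := k) j y ∘ₗ hF.head b)
      = (j * i).negOnePow • star (x a) (fun b => insL j y ∘ₗ hF.head b ∘ₗ sgn j) := by
    simp only [apply_sgn_of_mem hx]
    obtain h | h := Int.units_eq_one_or (j * i).negOnePow
    · simp only [h, one_smul]
      rfl
    · simp only [h, Units.neg_smul, one_smul]
      exact LinearMap.congr_fun (map_neg star fun b t => sgn j (x a b t)) _
  rw [insL_eq_star hF, map_add, insL_star, insL_star, e1, e2]
  simp only [insL_ident, ident_sgn]
  rw [← add_assoc]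
  congr 1
  simp only [← sgn_comp_sgn i j]
  rfl

/-- The antisymmetrized circle product acts as the graded commutator of the actions. -/
theorem insL_bracket {i j : ℤ} {x y : A.PreCochain} (hx : x ∈ A.shiftedCochains i)
    (hy : y ∈ A.shiftedCochains j) {F : A.Str a c → W} (hF : IsMultilinearFun F) :
    insL (k := k) j y (insL (k := k) i x F)
        - (i * j).negOnePow • insL (k := k) i x (insL (k := k) j y F)
      = insL (k := k) (i + j) (circ j x y - (i * j).negOnePow • circ i y x) F := by
  refine eq_insL (fun a => insL (W := W) (a := a) (c := c) j y * insL i x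
    - (i * j).negOnePow • (insL i x * insL j y)) (fun a F hF => ?_) hF
  have e1 := insL_insL hx j y hF
  have e2 := insL_insL hy i x hF
  rw [mul_comm j i] at e1
  rw [add_comm j i] at e2
  simp only [LinearMap.sub_apply, Units.smul_def, LinearMap.smul_apply, Module.End.mul_apply,
    Pi.sub_apply, Pi.smul_apply, LinearMap.sub_comp]
  simp only [← Units.smul_def]
  rw [e1, e2]
  obtain h | h := Int.units_eq_one_or (i * j).negOnePow
  · have e3 : ∀ P Q : ∀ b, A.Hom a b →ₗ[k] (A.Str b c → W),
        star (A.ident a) (fun b => P b - Q b) = star (A.ident a) P - star (A.ident a) Q :=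
      fun P Q => map_sub _ _ _
    have e4 := LinearMap.congr_fun (map_sub star (circ j x y a) (circ i y x a)) hF.head
    rw [LinearMap.sub_apply] at e4
    simp only [h, one_smul, e3]
    rw [e4]
    simp only [Module.End.mul_eq_comp]
    abel
  · have e3 : ∀ P Q : ∀ b, A.Hom a b →ₗ[k] (A.Str b c → W),
        star (A.ident a) (fun b => P b + Q b) = star (A.ident a) P + star (A.ident a) Q :=
      fun P Q => map_add _ _ _
    have e4 := LinearMap.congr_fun (map_add star (circ j x y a) (circ i y x a)) hF.head
    rw [LinearMap.add_apply] at e4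
    simp only [h, Units.neg_smul, one_smul, sub_neg_eq_add, LinearMap.neg_comp,
      Module.End.mul_eq_comp, e3]
    rw [e4]
    abel

end Star

/-- Functions of strings with values in a graded module that raise degrees by a constant
continue to do so after the insertion of a cochain. -/
theorem ins_mem {M : Type*} [AddCommGroup M] [Module k M] {j : ℤ} {y : A.PreCochain}
    (hy : y ∈ A.shiftedCochains j) (n : ℤ) {a c : A.Obj} {s : A.Str a c} {e : ℤ} (hs : s.HasDeg e)
    (N : ℤ → Submodule k M) (F : A.Str a c → M) (hF : ∀ t i, Str.HasDeg t i → F t ∈ N i) :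
    ins n y s F ∈ N (e + j) := by
  induction hs generalizing N with
  | nil a =>
    have h := hF _ _ (.cons _ _ _ _ (hy.2 a a (.nil a) 0 (.nil a)) (.nil a))
    rwa [show 0 + j + 1 - 1 + 0 = 0 + j by ring] at h
  | cons i e f s hf hs ih =>
    refine add_mem ?_ ?_
    · have h := ih (fun l => N (i - 1 + l)) (fun t => F (.cons (sgn n f) t)) fun t l ht =>
        hF _ _ (.cons i l _ t (by rw [sgn_apply n i hf]; exact zsmul_mem hf _) ht)
      rwa [← add_assoc] at h
    · refine (Str.HasDeg.cons i e f s hf hs).cutSum_mem _ _ fun b s₁ s₂ e₁ e₂ h₁ h₂ he => ?_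
      have h := hF _ _ (.cons _ e₂ _ _ (hy.2 _ b s₁ e₁ h₁) h₂)
      rwa [show e₁ + j + 1 - 1 + e₂ = i - 1 + e + j by rw [← he]; ring] at h

theorem circ_mem {i j : ℤ} {x y : A.PreCochain} (hx : x ∈ A.shiftedCochains i)
    (hy : y ∈ A.shiftedCochains j) : circ j x y ∈ A.shiftedCochains (i + j) := by
  refine ⟨hx.1.circ hy.1 j, fun a b s e hs => ?_⟩
  rw [circ_eq_ins]
  have h := ins_mem hy j hs (fun l => A.gr a b (l + i + 1)) (x a b) fun t l ht => hx.2 a b t l ht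
  rwa [show e + j + i + 1 = e + (i + j) + 1 by ring] at h

theorem iterCirc_mem {n : ℤ} {x : A.PreCochain} (hx : x ∈ A.shiftedCochains n) (m : ℕ) :
    iterCirc n x m ∈ A.shiftedCochains ((m + 1 : ℕ) * n) := by
  induction m with
  | zero => simpa [iterCirc] using hx
  | succ m ih =>
    have h := circ_mem ih hx
    rwa [show ((m + 1 : ℕ) : ℤ) * n + n = ((m + 1 + 1 : ℕ) : ℤ) * n by push_cast; ring] at h

theorem ident_mem : A.ident ∈ A.shiftedCochains 0 := by
  refine ⟨isMultilinear_ident, fun a b s e hs => ?_⟩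
  cases hs with
  | nil => exact zero_mem _
  | cons i e f s hf hs =>
    cases hs with
    | nil => simpa [ident] using hf
    | cons => exact zero_mem _

section Star

variable {W : Type*} [AddCommGroup W] [Module k W] {a c : A.Obj}

/-- For a cochain of odd degree, the circle square acts as the square of the action. -/
theorem insL_sq {n : ℤ} (hn : Odd n) {x : A.PreCochain} (hx : x ∈ A.shiftedCochains n)
    {F : A.Str a c → W} (hF : IsMultilinearFun F) :
    insL (k := k) n x (insL (k := k) n x F) = insL (k := k) (2 * n) (circ n x x) F := by
  refine eq_insL (fun a => insL (W := W) (a := a) (c := c) n x * insL n x) (fun a F hF => ?_) hF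
  rw [Module.End.mul_apply, insL_insL hx n x hF, Int.negOnePow_odd _ (hn.mul hn), Units.neg_smul,
    one_smul, neg_add_cancel_right, two_mul]
  rfl

theorem iterate_insL_ident (n : ℤ) (x : A.PreCochain) (m : ℕ) :
    (fun (β : ∀ b, A.Str a b → A.Hom a b) b => insL (k := k) n x (β b))^[m + 1] (A.ident a)
      = iterCirc n x m a := by
  induction m with
  | zero => exact funext fun b => insL_ident n x
  | succ m ih =>
    rw [Function.iterate_succ_apply', ih]
    exact funext fun b => funext fun s => (circ_eq_ins n _ x a b s).symm

/-- For a cochain of even degree, the `p`-fold circle product acts as the `p`-th power of the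
action: the action is a derivation of `⋆`, so its `p`-th iterate is a derivation too. -/
theorem insL_pow (p : ℕ) [Fact p.Prime] [CharP k p] {n : ℤ} (hn : Even n) (x : A.PreCochain)
    {F : A.Str a c → W} (hF : IsMultilinearFun F) :
    (insL (k := k) n x ^ p) F = insL (k := k) (p * n) (iterCirc n x (p - 1)) F := by
  refine eq_insL (fun a => insL (W := W) (a := a) (c := c) n x ^ p) (fun a F hF => ?_) hF
  have hp : p - 1 + 1 = p := Nat.sub_add_cancel (Fact.out : p.Prime).one_le
  have hD : ∀ (β : ∀ b, A.Str a b → A.Hom a b) (K : ∀ b, A.Hom a b →ₗ[k] (A.Str b c → W)),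
      insL n x (star β K) = star (fun b => insL (k := k) n x (β b)) K
        + star β (fun b => insL n x ∘ₗ K b) := by
    intro β K
    simp only [insL_star, Str.sgn_of_even hn]
  have key := iterate_bilin (star (k := k)) (insL (k := k) n x)
    (fun (β : ∀ b, A.Str a b → A.Hom a b) b => insL (k := k) n x (β b))
    (fun (K : ∀ b, A.Hom a b →ₗ[k] (A.Str b c → W)) b => insL n x ∘ₗ K b)
    (map_add _) hD (A.ident a) hF.head p
  rw [binomConv_prime] at key
  simp only [Function.iterate_zero, id_eq] at key
  rw [← Module.End.pow_apply, ← hp, pow_succ, Module.End.mul_apply, insL_star_ident,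
    ← Module.End.mul_apply, ← pow_succ, hp] at key
  have hK : ∀ m : ℕ, (fun (K : ∀ b, A.Hom a b →ₗ[k] (A.Str b c → W)) b => insL n x ∘ₗ K b)^[m]
      hF.head = fun b => (insL n x ^ m) ∘ₗ hF.head b := by
    intro m
    induction m with
    | zero => rfl
    | succ m ih =>
      rw [Function.iterate_succ_apply', ih]
      simp only [pow_succ', Module.End.mul_eq_comp, LinearMap.comp_assoc]
  have hI := iterate_insL_ident (k := k) (a := a) n x (p - 1)
  rw [hp] at hI
  simp only [key, hI, hK, sgn_of_even (hn.mul_left _), LinearMap.comp_id]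

end Star

end DGCat

/-! ### The cup product and the structure cochain -/

namespace DGCat

variable {k : Type u} [CommRing k] {A : DGCat.{u, v, w} k}

/-- The linear map that multiplies a morphism of degree `i` by `(-1)^i`. -/
def alt {a b : A.Obj} : A.Hom a b →ₗ[k] A.Hom a b :=
  gradedSign _ (A.isInternal a b) fun i => i.negOnePow

theorem alt_apply (i : ℤ) {a b : A.Obj} {f : A.Hom a b} (hf : f ∈ A.gr a b i) :
    alt f = i.negOnePow • f :=
  gradedSign_apply _ _ _ _ _ hf

theorem alt_mem {i : ℤ} {a b : A.Obj} {f : A.Hom a b} (hf : f ∈ A.gr a b i) :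
    alt f ∈ A.gr a b i := by
  rw [alt_apply i hf]
  exact zsmul_mem hf _

theorem alt_alt {a b : A.Obj} (f : A.Hom a b) : alt (alt f) = f := by
  refine LinearMap.congr_fun (f := alt ∘ₗ alt) (g := LinearMap.id) ?_ f
  refine linearMap_ext_gr fun i f hf => ?_
  rw [LinearMap.comp_apply, alt_apply i (alt_mem hf), alt_apply i hf, smul_smul,
    Int.units_mul_self, one_smul, LinearMap.id_apply]

theorem d_alt {a b : A.Obj} (f : A.Hom a b) : A.d (alt f) = -alt (A.d f) := by
  refine LinearMap.congr_fun (f := A.d ∘ₗ alt) (g := -(alt ∘ₗ A.d)) ?_ f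
  refine linearMap_ext_gr fun i f hf => ?_
  rw [LinearMap.comp_apply, LinearMap.neg_apply, LinearMap.comp_apply,
    alt_apply _ (A.d_mem i f hf), alt_apply i hf, map_intUnits_smul, Int.negOnePow_succ,
    Units.neg_smul, neg_neg]

theorem comp_intUnits_smul {a b c : A.Obj} (ε : ℤˣ) (f : A.Hom a b) (g : A.Hom b c) :
    A.comp (ε • f) g = ε • A.comp f g :=
  map_intUnits_smul (A.comp.flip g) ε f

theorem alt_comp {a b c : A.Obj} (f : A.Hom a b) (g : A.Hom b c) :
    alt (A.comp f g) = A.comp (alt f) (alt g) := by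
  refine LinearMap.congr_fun (f := alt ∘ₗ A.comp.flip g) (g := A.comp.flip (alt g) ∘ₗ alt) ?_ f
  refine linearMap_ext_gr fun i f hf => ?_
  refine LinearMap.congr_fun (f := alt ∘ₗ A.comp f) (g := A.comp (alt f) ∘ₗ alt) ?_ g
  refine linearMap_ext_gr fun j g hg => ?_
  simp only [LinearMap.comp_apply]
  rw [alt_apply _ (A.comp_mem i j f hf g hg), alt_apply i hf, alt_apply j hg, map_intUnits_smul,
    comp_intUnits_smul, smul_smul, mul_comm, ← Int.negOnePow_add]

theorem d_comp {a b c : A.Obj} (f : A.Hom a b) (g : A.Hom b c) :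
    A.d (A.comp f g) = A.comp (A.d f) g + A.comp (alt f) (A.d g) := by
  refine LinearMap.congr_fun (f := A.d ∘ₗ A.comp.flip g)
    (g := A.comp.flip g ∘ₗ A.d + A.comp.flip (A.d g) ∘ₗ alt) ?_ f
  refine linearMap_ext_gr fun i f hf => ?_
  simp only [LinearMap.comp_apply, LinearMap.add_apply, LinearMap.flip_apply]
  rw [A.leibniz i f hf, alt_apply i hf, comp_intUnits_smul]

theorem sgn_of_odd {n : ℤ} (hn : Odd n) {a b : A.Obj} (f : A.Hom a b) : sgn n f = -alt f := by
  refine LinearMap.congr_fun (f := sgn n) (g := -alt) ?_ f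
  refine linearMap_ext_gr fun i f hf => ?_
  rw [sgn_apply n i hf, LinearMap.neg_apply, alt_apply i hf, ← Units.neg_smul]
  congr 1
  obtain ⟨l, rfl⟩ := hn
  rw [← Int.negOnePow_succ, Int.negOnePow_eq_iff]
  exact ⟨l * (i - 1) - 1, by ring⟩

/-- The linear map on cochains given by composition with linear maps of the values. -/
def postcomp (φ : ∀ {a b : A.Obj}, A.Hom a b →ₗ[k] A.Hom a b) : Module.End k A.PreCochain where
  toFun x a b s := φ (x a b s)
  map_add' x y := by funext a b s; exact map_add _ _ _
  map_smul' r x := by funext a b s; exact map_smul _ _ _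

/-- The differential of the values of a cochain. -/
def dVal : Module.End k A.PreCochain := postcomp A.d

/-- The sign automorphism applied to the values of a cochain. -/
def altVal : Module.End k A.PreCochain := postcomp alt

/-- The effect on a cochain of moving an operation of degree `n` past its arguments. -/
def twist (n : ℤ) : Module.End k A.PreCochain where
  toFun x a b s := x a b (s.sgn n)
  map_add' _ _ := rfl
  map_smul' _ _ := rfl

/-- The right action `x ↦ x ∘ y` of a cochain `y` of degree `n`. -/
def act (n : ℤ) (y : A.PreCochain) : Module.End k A.PreCochain where
  toFun x := circ n x y
  map_add' x x' := by simpa only [one_smul] using circ_linear_left n x x' y 1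
  map_smul' r x := by
    have h0 := circ_linear_left n 0 0 y (1 : k)
    have h := circ_linear_left n x 0 y r
    simp only [one_smul, add_zero, left_eq_add] at h0 h
    rw [h, h0, add_zero]
    rfl

theorem act_apply (n : ℤ) (x y : A.PreCochain) : act n y x = circ n x y := rfl

theorem act_eq_insL (n : ℤ) (x y : A.PreCochain) (a b : A.Obj) :
    act n y x a b = insL (k := k) n y (x a b) :=
  funext fun s => circ_eq_ins n x y a b s

/-- The cup product without signs: cut the string in two, apply `x` to the first part and `y` to
the second, and compose. -/
def cup : A.PreCochain →ₗ[k] A.PreCochain →ₗ[k] A.PreCochain :=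
  LinearMap.mk₂ k (fun x y _ _ s => s.cutSum fun b s₁ s₂ => A.comp (x _ b s₁) (y b _ s₂))
    (fun x x' y => by
      funext a c s
      simp only [Pi.add_apply, map_add, LinearMap.add_apply, Str.cutSum_add])
    (fun r x y => by
      funext a c s
      simp only [Pi.smul_apply, map_smul, LinearMap.smul_apply]
      exact (Str.map_cutSum (r • LinearMap.id (R := k) (M := A.Hom a c)) s _).symm)
    (fun x y y' => by
      funext a c s
      simp only [Pi.add_apply, map_add, Str.cutSum_add])
    (fun r x y => by
      funext a c s
      simp only [Pi.smul_apply, map_smul]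
      exact (Str.map_cutSum (r • LinearMap.id (R := k) (M := A.Hom a c)) s _).symm)

theorem cup_apply (x y : A.PreCochain) (a c : A.Obj) (s : A.Str a c) :
    cup x y a c s = s.cutSum fun b s₁ s₂ => A.comp (x a b s₁) (y b c s₂) := rfl

theorem cup_eq_star (x y : A.PreCochain) (a c : A.Obj) :
    cup x y a c = star (x a) (fun b => LinearMap.pi fun s => A.comp.flip (y b c s)) := rfl

theorem cup_assoc (x y z : A.PreCochain) : cup (cup x y) z = cup x (cup y z) := by
  funext a c s
  have e1 : cup (cup x y) z a c s = s.cutSum fun b' s₁ s₂ => s₁.cutSum fun b t₁ t₂ =>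
      A.comp (A.comp (x a b t₁) (y b b' t₂)) (z b' c s₂) :=
    Str.cutSum_congr _ fun b' s₁ s₂ => Str.map_cutSum (A.comp.flip (z b' c s₂)) s₁ _
  have e2 : cup x (cup y z) a c s = s.cutSum fun b s₁ s₂ => s₂.cutSum fun b' t₁ t₂ =>
      A.comp (x a b s₁) (A.comp (y b b' t₁) (z b' c t₂)) :=
    Str.cutSum_congr _ fun b s₁ s₂ => Str.map_cutSum (A.comp (x a b s₁)) s₂ _
  rw [e1, e2, Str.cutSum_cutSum]
  simp only [A.assoc]

theorem altVal_altVal (x : A.PreCochain) : altVal (altVal x) = x := by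
  funext a b s
  exact alt_alt _

theorem dVal_dVal (x : A.PreCochain) : dVal (dVal x) = 0 := by
  funext a b s
  exact A.d_d _

theorem dVal_altVal (x : A.PreCochain) : dVal (altVal x) = -altVal (dVal x) := by
  funext a b s
  exact d_alt _

theorem altVal_cup (x y : A.PreCochain) : altVal (cup x y) = cup (altVal x) (altVal y) := by
  funext a c s
  change alt (cup x y a c s) = _
  rw [cup_apply, Str.map_cutSum, cup_apply]
  exact Str.cutSum_congr _ fun b s₁ s₂ => alt_comp _ _

theorem dVal_cup (x y : A.PreCochain) :
    dVal (cup x y) = cup (dVal x) y + cup (altVal x) (dVal y) := by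
  funext a c s
  change A.d (cup x y a c s) = cup (dVal x) y a c s + cup (altVal x) (dVal y) a c s
  rw [cup_apply, Str.map_cutSum, cup_apply, cup_apply, ← Str.cutSum_add]
  exact Str.cutSum_congr _ fun b s₁ s₂ => d_comp _ _

theorem act_postcomp (φ : ∀ {a b : A.Obj}, A.Hom a b →ₗ[k] A.Hom a b) (n : ℤ)
    (x y : A.PreCochain) : act n y (postcomp φ x) = postcomp φ (act n y x) := by
  funext a b
  rw [act_eq_insL]
  change insL n y (fun s => φ (x a b s)) = _
  rw [map_insL, ← act_eq_insL]
  rfl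

theorem act_dVal (n : ℤ) (x y : A.PreCochain) : act n y (dVal x) = dVal (act n y x) :=
  act_postcomp A.d n x y

theorem act_altVal (n : ℤ) (x y : A.PreCochain) : act n y (altVal x) = altVal (act n y x) :=
  act_postcomp alt n x y

/-- The right action of a cochain is a derivation of the cup product. -/
theorem act_cup (n : ℤ) (x y z : A.PreCochain) :
    act n z (cup x y) = cup (act n z x) y + cup (twist n x) (act n z y) := by
  funext a c
  change _ = cup (act n z x) y a c + cup (twist n x) (act n z y) a c
  rw [act_eq_insL, cup_eq_star, insL_star, cup_eq_star, cup_eq_star]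
  congr 1
  · simp only [← act_eq_insL]
  · refine congrArg (star _) (funext fun b => LinearMap.ext fun h => ?_)
    change insL n z (fun s => A.comp h (y b c s)) = _
    rw [map_insL, ← act_eq_insL]
    rfl

theorem act_ident (n : ℤ) (x : A.PreCochain) : act n x A.ident = x := by
  funext a b
  rw [act_eq_insL, insL_ident]

theorem twist_altVal (n : ℤ) (x : A.PreCochain) : twist n (altVal x) = altVal (twist n x) := rfl

theorem twist_of_even {n : ℤ} (hn : Even n) (x : A.PreCochain) : twist n x = x := by
  funext a b s
  exact congrArg _ (Str.sgn_of_even hn s)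

theorem twist_ident {n : ℤ} (hn : Odd n) : twist n A.ident = -altVal A.ident := by
  funext a b s
  exact (ident_sgn n s).trans (sgn_of_odd hn _)

theorem twist_of_mem_odd {i n : ℤ} (hi : Odd i) (hn : Odd n) {x : A.PreCochain}
    (hx : x ∈ A.shiftedCochains i) : twist n x = altVal x := by
  funext a b s
  refine (apply_sgn_of_mem hx n s).trans ?_
  rw [Int.negOnePow_odd _ (hn.mul hi), sgn_of_odd hn, Units.neg_smul, one_smul, neg_neg]
  rfl

theorem twist_of_mem_even {i n : ℤ} (hi : Even i) (hn : Odd n) {x : A.PreCochain}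
    (hx : x ∈ A.shiftedCochains i) : twist n x = -altVal x := by
  funext a b s
  refine (apply_sgn_of_mem hx n s).trans ?_
  rw [Int.negOnePow_even _ (hi.mul_left _), sgn_of_odd hn, one_smul]
  rfl

theorem cup_postcomp_ident_nil (φ : ∀ {a b : A.Obj}, A.Hom a b →ₗ[k] A.Hom a b)
    (x : A.PreCochain) (a : A.Obj) : cup (postcomp φ A.ident) x a a (.nil a) = 0 := by
  change A.comp (φ 0) _ = 0
  rw [map_zero, map_zero, LinearMap.zero_apply]

theorem cup_postcomp_ident_cons (φ : ∀ {a b : A.Obj}, A.Hom a b →ₗ[k] A.Hom a b)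
    (x : A.PreCochain) {a b c : A.Obj} (f : A.Hom a b) (s : A.Str b c) :
    cup (postcomp φ A.ident) x a c (.cons f s) = A.comp (φ f) (x b c s) :=
  star_ident_cons (fun b => (LinearMap.pi fun s => A.comp.flip (x b c s)) ∘ₗ φ) f s

theorem structureCochain_eq :
    A.structureCochain = dVal A.ident + cup (altVal A.ident) A.ident := by
  funext a b s
  change _ = A.d (A.ident a b s) + cup (altVal A.ident) A.ident a b s
  cases s with
  | nil a =>
    rw [altVal, cup_postcomp_ident_nil]
    simp [structureCochain, ident]
  | cons f s =>
    rw [altVal, cup_postcomp_ident_cons]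
    cases s with
    | nil => simp [structureCochain, ident]
    | cons g s => cases s <;> simp [structureCochain, ident, alt]

theorem circ_structureCochain (n : ℤ) (x : A.PreCochain) :
    circ n A.structureCochain x
      = dVal x + cup (altVal x) A.ident + cup (altVal (twist n A.ident)) x := by
  rw [← act_apply, structureCochain_eq, map_add, act_dVal, act_cup, act_altVal, act_ident,
    twist_altVal, add_assoc]

theorem circ_structureCochain_odd {n : ℤ} (hn : Odd n) (x : A.PreCochain) :
    circ n A.structureCochain x = dVal x + cup (altVal x) A.ident - cup A.ident x := by
  rw [circ_structureCochain, twist_ident hn, map_neg, altVal_altVal, map_neg, LinearMap.neg_apply,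
    sub_eq_add_neg]

theorem circ_structureCochain_even {n : ℤ} (hn : Even n) (x : A.PreCochain) :
    circ n A.structureCochain x
      = dVal x + cup (altVal x) A.ident + cup (altVal A.ident) x := by
  rw [circ_structureCochain, twist_of_even hn]

theorem dVal_mem {i : ℤ} {x : A.PreCochain} (hx : x ∈ A.shiftedCochains i) :
    dVal x ∈ A.shiftedCochains (i + 1) := by
  refine ⟨fun a b c e => ((hx.1.isMultilinearFun a e).map A.d) b c, fun a b s e hs => ?_⟩
  have h := A.d_mem _ _ (hx.2 a b s e hs)
  rwa [add_assoc e] at h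

theorem altVal_mem {i : ℤ} {x : A.PreCochain} (hx : x ∈ A.shiftedCochains i) :
    altVal x ∈ A.shiftedCochains i :=
  ⟨fun a b c e => ((hx.1.isMultilinearFun a e).map alt) b c,
    fun a b s e hs => alt_mem (hx.2 a b s e hs)⟩

theorem cup_mem {i j : ℤ} {x y : A.PreCochain} (hx : x ∈ A.shiftedCochains i)
    (hy : y ∈ A.shiftedCochains j) : cup x y ∈ A.shiftedCochains (i + j + 1) := by
  refine ⟨fun a b c e => ?_, fun a c s e hs => ?_⟩
  · have h : IsMultilinearFun (star (x a) fun b =>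
        LinearMap.pi fun s => A.comp.flip (y b e s)) := by
      refine IsMultilinearFun.star (fun b => hx.1.isMultilinearFun a b) fun b h => ?_
      exact (hy.1.isMultilinearFun b e).map (A.comp h)
    exact h b c
  · refine hs.cutSum_mem _ _ fun b s₁ s₂ e₁ e₂ h₁ h₂ he => ?_
    have h := A.comp_mem _ _ _ (hx.2 a b s₁ e₁ h₁) _ (hy.2 b c s₂ e₂ h₂)
    rwa [show e₁ + i + 1 + (e₂ + j + 1) = e + (i + j + 1) + 1 by rw [← he]; ring] at h

theorem structureCochain_mem : A.structureCochain ∈ A.shiftedCochains 1 := by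
  rw [structureCochain_eq]
  have h₁ : dVal A.ident ∈ A.shiftedCochains (0 + 1) := dVal_mem ident_mem
  have h₂ : cup (altVal A.ident) A.ident ∈ A.shiftedCochains (0 + 0 + 1) :=
    cup_mem (altVal_mem ident_mem) ident_mem
  rw [zero_add] at h₁
  rw [add_zero, zero_add] at h₂
  exact add_mem h₁ h₂

/-- The square of the structure cochain vanishes. -/
theorem circ_structureCochain_self : circ 1 A.structureCochain A.structureCochain = 0 := by
  rw [circ_structureCochain_odd odd_one, structureCochain_eq]
  simp only [map_add, dVal_dVal, dVal_cup, dVal_altVal, altVal_cup, altVal_altVal, map_neg,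
    LinearMap.add_apply, LinearMap.neg_apply, cup_assoc]
  abel

theorem hochschildD_apply (n : ℤ) (x : A.PreCochain) : A.hochschildD n x
    = circ n A.structureCochain x - n.negOnePow • circ 1 x A.structureCochain := rfl

theorem hochschildD_mem {n : ℤ} {x : A.PreCochain} (hx : x ∈ A.shiftedCochains n) :
    A.hochschildD n x ∈ A.shiftedCochains (n + 1) := by
  rw [hochschildD_apply]
  have h := circ_mem structureCochain_mem hx
  rw [add_comm] at h
  have h' : circ 1 x A.structureCochain ∈ A.shiftedCochains (n + 1) :=
    circ_mem hx structureCochain_mem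
  obtain hε | hε := Int.units_eq_one_or n.negOnePow
  · rw [hε, one_smul]
    exact sub_mem h h'
  · rw [hε, Units.neg_smul, one_smul, sub_neg_eq_add]
    exact add_mem h h'

end DGCat

/-! ### Powers of Hochschild coboundaries -/

namespace DGCat

variable {k : Type u} [CommRing k] {A : DGCat.{u, v, w} k}

theorem act_bracket {i j : ℤ} {x y : A.PreCochain} (hx : x ∈ A.shiftedCochains i)
    (hy : y ∈ A.shiftedCochains j) {z : A.PreCochain} (hz : IsMultilinear z) :
    act j y (act i x z) - (i * j).negOnePow • act i x (act j y z)
      = act (i + j) (circ j x y - (i * j).negOnePow • circ i y x) z := by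
  funext a b
  have h := insL_bracket hx hy (hz.isMultilinearFun a b)
  rw [act_eq_insL, ← h]
  simp only [← act_eq_insL]
  rfl

theorem act_sq {n : ℤ} (hn : Odd n) {x : A.PreCochain} (hx : x ∈ A.shiftedCochains n)
    {z : A.PreCochain} (hz : IsMultilinear z) :
    act n x (act n x z) = act (2 * n) (circ n x x) z := by
  funext a b
  rw [act_eq_insL, act_eq_insL, act_eq_insL, insL_sq hn hx (hz.isMultilinearFun a b)]

theorem act_pow (p : ℕ) [Fact p.Prime] [CharP k p] {n : ℤ} (hn : Even n) (x : A.PreCochain)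
    {z : A.PreCochain} (hz : IsMultilinear z) :
    (act n x ^ p) z = act (p * n) (iterCirc n x (p - 1)) z := by
  funext a b
  rw [act_eq_insL, ← insL_pow p hn x (hz.isMultilinearFun a b)]
  have h : ∀ m : ℕ, (act n x ^ m) z a b = (insL (k := k) n x ^ m) (z a b) := by
    intro m
    induction m with
    | zero => rfl
    | succ m ih => rw [pow_succ', pow_succ', Module.End.mul_apply, Module.End.mul_apply,
        act_eq_insL, ih]
  exact h p

/-- The action of the structure cochain squares to zero. -/
theorem act_structureCochain_act {z : A.PreCochain} (hz : IsMultilinear z) :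
    act 1 A.structureCochain (act 1 A.structureCochain z) = 0 := by
  rw [act_sq odd_one structureCochain_mem hz, circ_structureCochain_self]
  have h := circ_linear_right (A := A) (2 * 1) z 0 0 hz 1
  rw [one_smul, one_smul, add_zero, left_eq_add] at h
  exact h

/-- The action of a coboundary is the graded commutator of the actions of the cochain and of the
structure cochain. -/
theorem act_hochschildD {n : ℤ} {y : A.PreCochain} (hy : y ∈ A.shiftedCochains n)
    {z : A.PreCochain} (hz : IsMultilinear z) :
    act (n + 1) (A.hochschildD n y) z = act n y (act 1 A.structureCochain z)
      - n.negOnePow • act 1 A.structureCochain (act n y z) := by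
  have h := act_bracket structureCochain_mem hy hz
  rw [one_mul, add_comm 1 n] at h
  exact h.symm

theorem act_multilinear {n : ℤ} {x z : A.PreCochain} (hx : IsMultilinear x)
    (hz : IsMultilinear z) : IsMultilinear (act n x z) := hz.circ hx n

theorem hochschildD_of_odd {n : ℤ} (hn : Odd n) (x : A.PreCochain) :
    A.hochschildD n x = dVal x + cup (altVal x) A.ident - cup A.ident x
      + act 1 A.structureCochain x := by
  rw [hochschildD_apply, circ_structureCochain_odd hn, Int.negOnePow_odd _ hn, Units.neg_smul,
    one_smul, sub_neg_eq_add]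
  rfl

theorem hochschildD_of_even {n : ℤ} (hn : Even n) (x : A.PreCochain) :
    A.hochschildD n x = dVal x + cup (altVal x) A.ident + cup (altVal A.ident) x
      - act 1 A.structureCochain x := by
  rw [hochschildD_apply, circ_structureCochain_even hn, Int.negOnePow_even _ hn, one_smul]
  rfl

/-- The circle square of the coboundary `a` of a cochain `y` of even degree is the coboundary of
`y ∘ a - y' ∪ y`, where `y'` is `y` with its values multiplied by the sign of their degree. -/
theorem circ_hochschildD_mem {n : ℤ} (hn : Even n) {y : A.PreCochain}
    (hy : y ∈ A.shiftedCochains n) :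
    ∃ z ∈ A.shiftedCochains (2 * n + 1),
      A.hochschildD (2 * n + 1) z = circ (n + 1) (A.hochschildD n y) (A.hochschildD n y) := by
  have hn1 : Odd (n + 1) := hn.add_odd odd_one
  set a := A.hochschildD n y with ha
  have haM : a ∈ A.shiftedCochains (n + 1) := hochschildD_mem hy
  have hm : IsMultilinear A.structureCochain := A.structureCochain_isMultilinear
  have ea : a = dVal y + cup (altVal y) A.ident + cup (altVal A.ident) y
      - act 1 A.structureCochain y := hochschildD_of_even hn y
  have hc : ∀ z, IsMultilinear z → act (n + 1) a z
      = act n y (act 1 A.structureCochain z) - act 1 A.structureCochain (act n y z) := by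
    intro z hz
    rw [act_hochschildD hy hz, Int.negOnePow_even _ hn, one_smul]
  have hanti : act (n + 1) a (act 1 A.structureCochain y)
      = -act 1 A.structureCochain (act (n + 1) a y) := by
    rw [hc _ (act_multilinear hm hy.1), hc _ hy.1, map_sub, act_structureCochain_act hy.1, map_zero,
      act_structureCochain_act (act_multilinear hy.1 hy.1), sub_zero, zero_sub]
  refine ⟨act (n + 1) a y - cup (altVal y) y, sub_mem ?_ ?_, ?_⟩
  · have h := circ_mem hy haM
    rwa [show n + (n + 1) = 2 * n + 1 by ring] at h
  · have h := cup_mem (altVal_mem hy) hy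
    rwa [show n + n + 1 = 2 * n + 1 by ring] at h
  have e1 : circ (n + 1) a a = dVal (act (n + 1) a y) + cup (altVal (act (n + 1) a y)) A.ident
      - cup A.ident (act (n + 1) a y) + act 1 A.structureCochain (act (n + 1) a y)
      - cup y a + cup (altVal a) y := by
    refine (congrArg (act (n + 1) a) ea).trans ?_
    simp only [map_add, map_sub, act_dVal, act_cup, act_altVal, act_ident, twist_altVal,
      twist_ident hn1, twist_of_mem_even hn hn1 hy, map_neg, altVal_altVal, LinearMap.neg_apply,
      hanti]
    abel
  have e2 : A.hochschildD (2 * n + 1) (cup (altVal y) y) = cup y a - cup (altVal a) y := by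
    rw [hochschildD_of_odd (by exact ⟨n, rfl⟩), ea]
    simp only [map_add, map_sub, act_cup, act_altVal, twist_altVal,
      twist_of_mem_even hn odd_one hy, map_neg, altVal_altVal, LinearMap.neg_apply, dVal_cup,
      dVal_altVal, altVal_cup, LinearMap.add_apply, LinearMap.sub_apply, cup_assoc]
    abel
  rw [map_sub, e2, e1, hochschildD_of_odd (by exact ⟨n, rfl⟩)]
  abel

/-- The `p`-fold circle product of the coboundary `a` of a cochain `y` of odd degree is a
coboundary: with `e` the identity cochain, `g i = e ∘ a ∘ ⋯ ∘ a` and `h i = y ∘ a ∘ ⋯ ∘ a`, it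
is the coboundary of the `p`-th coefficient of the holonomy of the operators
`c ↦ (-1)^{|c| + 1} c ∪ h i`. -/
theorem iterCirc_hochschildD_mem (p : ℕ) [Fact p.Prime] [CharP k p] {n : ℤ} (hn : Odd n)
    {y : A.PreCochain} (hy : y ∈ A.shiftedCochains n) :
    ∃ z ∈ A.shiftedCochains (p * (n + 1) - 1),
      A.hochschildD (p * (n + 1) - 1) z = iterCirc (n + 1) (A.hochschildD n y) (p - 1) := by
  have hn1 : Even (n + 1) := hn.add_odd odd_one
  set a := A.hochschildD n y with ha
  have haM : a ∈ A.shiftedCochains (n + 1) := hochschildD_mem hy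
  set m := A.structureCochain with hmdef
  have hm : IsMultilinear m := A.structureCochain_isMultilinear
  have ea : a = dVal y + cup (altVal y) A.ident - cup A.ident y + act 1 m y :=
    hochschildD_of_odd hn y
  set R := act (n + 1) a with hR
  have hc : ∀ z, IsMultilinear z → R z = act n y (act 1 m z) + act 1 m (act n y z) := by
    intro z hz
    rw [hR, act_hochschildD hy hz, Int.negOnePow_odd _ hn, Units.neg_smul, one_smul, sub_neg_eq_add]
  have hcomm : ∀ z, IsMultilinear z → R (act 1 m z) = act 1 m (R z) := by
    intro z hz
    rw [hc _ (act_multilinear hm hz), hc _ hz, map_add, act_structureCochain_act hz, map_zero,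
      act_structureCochain_act (act_multilinear hy.1 hz), zero_add, add_zero]
  let g : ℕ → A.PreCochain := fun i => R^[i] A.ident
  let h : ℕ → A.PreCochain := fun i => R^[i] y
  have hgs : ∀ i, g (i + 1) = R^[i] a := fun i => by
    change R^[i + 1] _ = _
    rw [Function.iterate_succ_apply, hR, act_ident]
  have hgi : ∀ i, g (i + 1) = iterCirc (n + 1) a i := fun i => by
    induction i with
    | zero => exact hgs 0
    | succ i ih =>
      change R^[i + 1 + 1] _ = _
      rw [Function.iterate_succ_apply']
      exact congrArg R ih
  have hgM : ∀ i : ℕ, g i ∈ A.shiftedCochains (i * (n + 1)) := fun i => by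
    cases i with
    | zero => simpa [g] using ident_mem
    | succ i => rw [hgi]; exact iterCirc_mem haM i
  have hhM : ∀ i : ℕ, h i ∈ A.shiftedCochains (n + i * (n + 1)) := fun i => by
    induction i with
    | zero => simpa [h] using hy
    | succ i ih =>
      have e := circ_mem ih haM
      rw [show n + i * (n + 1) + (n + 1) = n + (i + 1 : ℕ) * (n + 1) by push_cast; ring] at e
      change R^[i + 1] _ ∈ _
      rw [Function.iterate_succ_apply']
      exact e
  have hhodd : ∀ i : ℕ, Odd (n + i * (n + 1)) := fun i => hn.add_even (hn1.mul_left _)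
  have hRM : ∀ i, R^[i] (act 1 m y) = act 1 m (h i) := fun i => by
    induction i with
    | zero => rfl
    | succ i ih =>
      rw [Function.iterate_succ_apply', ih, hcomm _ (hhM i).1]
      change _ = act 1 m (R^[i + 1] y)
      rw [Function.iterate_succ_apply']
  have hRadd : ∀ i x z, R^[i] (x + z) = R^[i] x + R^[i] z := fun i x z => by
    rw [← Module.End.pow_apply, map_add]
    simp only [Module.End.pow_apply]
  have hRsub : ∀ i x z, R^[i] (x - z) = R^[i] x - R^[i] z := fun i x z => by
    rw [← Module.End.pow_apply, map_sub]
    simp only [Module.End.pow_apply]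
  have hRd : ∀ i x, R^[i] (dVal x) = dVal (R^[i] x) := fun i x =>
    ((show Function.Semiconj dVal R R from fun z => (act_dVal _ z a).symm).iterate_right i x).symm
  have hRalt : ∀ i x, R^[i] (altVal x) = altVal (R^[i] x) := fun i x =>
    ((show Function.Semiconj altVal R R from
      fun z => (act_altVal _ z a).symm).iterate_right i x).symm
  have hRcup : ∀ i x z, R^[i] (cup x z) = binomConv cup (fun i => R^[i] x) (fun i => R^[i] z) i :=
    fun i x z => iterate_bilin cup R R R (map_add R)
      (fun x z => by rw [hR, act_cup, twist_of_even hn1]) x z i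
  -- `G₀ i c = ± c ∪ g i` and `H i c = ± c ∪ h i`, with signs expressed by operators that make
  -- sense for inhomogeneous `c`.
  let G₀ : ℕ → Module.End k A.PreCochain := fun i => cup.flip (g i) ∘ₗ altVal
  let H : ℕ → Module.End k A.PreCochain := fun i => cup.flip (h i) ∘ₗ altVal ∘ₗ twist 1
  have hHeven : ∀ (i : ℕ) (j : ℤ) (c : A.PreCochain), Even j → c ∈ A.shiftedCochains j →
      H i c = -cup c (h i) := fun i j c hj hcM => by
    change cup (altVal (twist 1 c)) (h i) = _
    rw [twist_of_mem_even hj odd_one hcM, map_neg, altVal_altVal, map_neg, LinearMap.neg_apply]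
  have hHodd : ∀ (i : ℕ) (j : ℤ) (c : A.PreCochain), Odd j → c ∈ A.shiftedCochains j →
      H i c = cup c (h i) := fun i j c hj hcM => by
    change cup (altVal (twist 1 c)) (h i) = _
    rw [twist_of_mem_odd hj odd_one hcM, altVal_altVal]
  have hg : ∀ i, g (i + 1) = dVal (h i) + binomConv cup (fun i => altVal (h i)) g i
      - binomConv cup g h i + act 1 m (h i) := fun i => by
    rw [hgs, ea, hRadd, hRsub, hRadd, hRd, hRcup, hRcup, hRM]
    simp only [hRalt]
    rfl
  let D : Module.End k A.PreCochain := A.hochschildD 1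
  have hD : ∀ x, D x = dVal x + cup (altVal x) A.ident - cup A.ident x + act 1 m x :=
    hochschildD_of_odd odd_one
  -- `eq_binomConv_holonomy` requires `g 0 = 0`, and the operator of index zero has to be the
  -- Hochschild differential: the values at zero are adjusted accordingly.
  let G : ℕ → Module.End k A.PreCochain := fun i => G₀ i + if i = 0 then D - G₀ 0 else 0
  let g' : ℕ → A.PreCochain := fun i => g i - if i = 0 then A.ident else 0
  let S : ℕ → Submodule k A.PreCochain := fun i => A.shiftedCochains (i * (n + 1) - 1)
  have hSodd : ∀ i : ℕ, Odd (i * (n + 1) - 1) := fun i => (hn1.mul_left _).sub_odd odd_one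
  have hu : ∀ i : ℕ, holonomy h H i ∈ S i := by
    refine holonomy_mem h H S (fun i => ?_) (fun i j c hcM => ?_)
    · have e := hhM i
      rwa [show n + i * (n + 1) = (i + 1 : ℕ) * (n + 1) - 1 by push_cast; ring] at e
    · rw [hHodd j _ c (hSodd i) hcM]
      have e := cup_mem hcM (hhM j)
      rwa [show i * (n + 1) - 1 + (n + j * (n + 1)) + 1 = ((i + j + 1 : ℕ) : ℤ) * (n + 1) - 1 by
        push_cast; ring] at e
  have key := eq_binomConv_holonomy g' h G H (by simp [g', g]) (fun i => ?_) (fun i j => ?_) p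
  · have hp0 : p ≠ 0 := (Fact.out : p.Prime).ne_zero
    rw [binomConv_prime, holonomy_zero, map_zero, zero_add] at key
    refine ⟨holonomy h H p, hu p, ?_⟩
    simp only [g', G, hp0, if_true, if_false, sub_zero, add_sub_cancel] at key
    rw [← hgi, Nat.sub_add_cancel (Fact.out : p.Prime).one_le, key,
      hochschildD_of_odd (hSodd p)]
    exact (hD _).symm
  · have e1 : binomConv LinearMap.id G₀ h i = binomConv cup (fun i => altVal (h i)) g i := by
      rw [← binomConv_flip]
      exact binomConv_congr _ _ _ _ _ _ _ fun i j _ => rfl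
    have e2 : binomConv LinearMap.id H g i = -binomConv cup g h i := by
      rw [← binomConv_flip, ← binomConv_neg]
      exact binomConv_congr _ _ _ _ _ _ _ fun i j _ => hHeven j _ _ (hn1.mul_left _) (hgM i)
    rw [binomConv_add_left, binomConv_ite_left, binomConv_sub_right, binomConv_ite_right, e1, e2]
    simp only [g', Nat.succ_ne_zero, if_false, sub_zero, LinearMap.id_apply, LinearMap.sub_apply]
    rw [hHeven i _ _ Even.zero ident_mem, hg, hD]
    change _ = _ + (_ - cup (altVal (h i)) A.ident) + _
    abel
  · set u := holonomy h H j with hudef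
    have huM : u ∈ A.shiftedCochains (j * (n + 1) - 1) := hu j
    have huo := hSodd j
    have hG₀u : ∀ l : ℕ, Even (j * (n + 1) - 1 + l * (n + 1) + 1) := fun l =>
      (huo.add_even (hn1.mul_left _)).add_odd odd_one
    have hDu : D u ∈ A.shiftedCochains (j * (n + 1) - 1 + 1) := by
      rw [hD, ← hochschildD_of_odd huo]
      exact hochschildD_mem huM
    have hap : ∀ K L : ℕ → Module.End k A.PreCochain,
        binomConv (LinearMap.mul k (Module.End k A.PreCochain)) K L i u
          = binomConv ((LinearMap.mul k (Module.End k A.PreCochain)).compr₂ (LinearMap.applyₗ u))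
              K L i :=
      fun K L => map_binomConv (LinearMap.applyₗ u) _ K L i
    have e1 : binomConv ((LinearMap.mul k (Module.End k A.PreCochain)).compr₂
        (LinearMap.applyₗ u)) G₀ H i
          = cup (altVal u) (binomConv cup (fun i => altVal (h i)) g i) := by
      rw [map_binomConv, ← binomConv_flip]
      refine binomConv_congr _ _ _ _ _ _ _ fun i l _ => ?_
      change cup (altVal (H i u)) (g l) = cup (altVal u) (cup (altVal (h i)) (g l))
      rw [hHodd i _ u huo huM, altVal_cup, cup_assoc]
    have e2 : binomConv ((LinearMap.mul k (Module.End k A.PreCochain)).compr₂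
        (LinearMap.applyₗ u)) H G₀ i = -cup (altVal u) (binomConv cup g h i) := by
      rw [map_binomConv, ← binomConv_flip, ← binomConv_neg]
      refine binomConv_congr _ _ _ _ _ _ _ fun i l _ => ?_
      change H l (cup (altVal u) (g i)) = -cup (altVal u) (cup (g i) (h l))
      rw [hHeven l _ _ (hG₀u i) (cup_mem (altVal_mem huM) (hgM i)), cup_assoc]
    rw [hap, hap, binomConv_add_left, binomConv_ite_left, binomConv_add_right, binomConv_ite_right,
      e1, e2]
    change (G₀ (i + 1) + 0) u = _ + (D (H i u) - cup (altVal (H i u)) A.ident)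
      + (_ + H i (D u - cup (altVal u) A.ident))
    have e3 := hHeven i _ _ (hG₀u 0) (by simpa using cup_mem (altVal_mem huM) ident_mem)
    rw [map_sub, e3, hHeven i _ _ (huo.add_odd odd_one) hDu, hHodd i _ u huo huM, add_zero]
    change cup (altVal u) (g (i + 1)) = _
    rw [hg, hD, hD]
    simp only [map_add, map_sub, LinearMap.add_apply, LinearMap.sub_apply, act_cup,
      twist_of_mem_odd huo odd_one huM, dVal_cup, altVal_cup, cup_assoc]
    abel

end DGCat

/-! ### The associative model of the Hochschild cochains -/

namespace DGCat

variable {k : Type u} [CommRing k] (A : DGCat.{u, v, w} k)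

/-- The module of multilinear cochains of arbitrary degrees. -/
def multilinearCochains : Submodule k A.PreCochain where
  carrier := {x | IsMultilinear x}
  add_mem' := by
    intro x y hx hy a b c e s t r f g
    simp only [Pi.add_apply, hx a b c e, hy a b c e, smul_add]
    abel
  zero_mem' := fun a b c e s t r f g => by simp
  smul_mem' := by
    intro α x hx a b c e s t r f g
    simp only [Pi.smul_apply, hx a b c e, smul_add, smul_comm α r]

variable {A}

/-- The right action of a cochain of degree `n` on the multilinear cochains, as an element of the
opposite of the endomorphism algebra. -/
def actOp (n : ℤ) : A.shiftedCochains n →ₗ[k] (Module.End k A.multilinearCochains)ᵐᵒᵖ where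
  toFun x := MulOpposite.op ((act n x.1).restrict fun z hz => act_multilinear x.2.1 hz)
  map_add' x y := by
    rw [← MulOpposite.op_add]
    refine congrArg MulOpposite.op (LinearMap.ext fun z => Subtype.ext ?_)
    have h := circ_linear_right n z.1 x.1 y.1 z.2 (1 : k)
    rw [one_smul, one_smul] at h
    exact h
  map_smul' r x := by
    rw [RingHom.id_apply, ← MulOpposite.op_smul]
    refine congrArg MulOpposite.op (LinearMap.ext fun z => Subtype.ext ?_)
    have h0 := circ_linear_right n z.1 0 0 z.2 (1 : k)
    have h := circ_linear_right n z.1 x.1 0 z.2 r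
    simp only [one_smul, add_zero, left_eq_add] at h0 h
    rw [h0, add_zero] at h
    exact h

theorem actOp_unop_apply (n : ℤ) (x : A.shiftedCochains n) (z : A.multilinearCochains) :
    ((actOp n x).unop z : A.PreCochain) = act n x.1 z.1 := rfl

theorem actOp_ext {X Y : (Module.End k A.multilinearCochains)ᵐᵒᵖ}
    (h : ∀ z : A.multilinearCochains, (X.unop z : A.PreCochain) = Y.unop z) : X = Y :=
  MulOpposite.unop_injective (LinearMap.ext fun z => Subtype.ext (h z))

theorem coe_unop_intUnits_smul (ε : ℤˣ) (X : (Module.End k A.multilinearCochains)ᵐᵒᵖ)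
    (z : A.multilinearCochains) :
    ((ε • X).unop z : A.PreCochain) = ε • (X.unop z : A.PreCochain) := by
  obtain rfl | rfl := Int.units_eq_one_or ε <;> simp [Units.neg_smul]

theorem bracket_mem {i j : ℤ} {x y : A.PreCochain} (hx : x ∈ A.shiftedCochains i)
    (hy : y ∈ A.shiftedCochains j) :
    circ j x y - (i * j).negOnePow • circ i y x ∈ A.shiftedCochains (i + j) := by
  have h := circ_mem hy hx
  rw [add_comm] at h
  obtain hε | hε := Int.units_eq_one_or (i * j).negOnePow
  · rw [hε, one_smul]
    exact sub_mem (circ_mem hx hy) h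
  · rw [hε, Units.neg_smul, one_smul, sub_neg_eq_add]
    exact add_mem (circ_mem hx hy) h

theorem actOp_pow (n : ℤ) (x : A.shiftedCochains n) (m : ℕ) (z : A.multilinearCochains) :
    ((actOp n x ^ m).unop z : A.PreCochain) = (act n x.1 ^ m) z.1 := by
  induction m with
  | zero => rfl
  | succ m ih =>
    rw [pow_succ, pow_succ', MulOpposite.unop_mul, Module.End.mul_apply, Module.End.mul_apply,
      actOp_unop_apply, ih]

/-- The Hochschild cochains, acting from the right on the multilinear cochains. The representation
is faithful because the identity cochain is sent to the acting cochain. -/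
def assocModel (A : DGCat.{u, v, w} k) (p : ℕ) [Fact p.Prime] [CharP k p] :
    AssocModel p A.shiftedCochains A.hochschildD circ (fun n x => iterCirc n x (p - 1))
      (Module.End k A.multilinearCochains)ᵐᵒᵖ where
  ρ := actOp
  ρ_injective n := by
    intro x y hxy
    have h := congrArg (fun X : (Module.End k A.multilinearCochains)ᵐᵒᵖ =>
      (X.unop ⟨A.ident, isMultilinear_ident⟩ : A.PreCochain)) hxy
    simp only [actOp_unop_apply, act_ident] at h
    exact Subtype.ext h
  μ := actOp 1 ⟨_, structureCochain_mem⟩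
  ρ_d n x := by
    refine ⟨hochschildD_mem x.2, actOp_ext fun z => ?_⟩
    rw [actOp_unop_apply, act_hochschildD x.2 z.2, MulOpposite.unop_sub, LinearMap.sub_apply,
      Submodule.coe_sub, coe_unop_intUnits_smul]
    rfl
  ρ_bracket i j x y := by
    refine ⟨bracket_mem x.2 y.2, actOp_ext fun z => ?_⟩
    rw [actOp_unop_apply, ← act_bracket x.2 y.2 z.2, MulOpposite.unop_sub, LinearMap.sub_apply,
      Submodule.coe_sub, coe_unop_intUnits_smul]
    rfl
  ρ_sq n hn x := by
    have h := circ_mem x.2 x.2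
    rw [← two_mul] at h
    refine ⟨h, actOp_ext fun z => ?_⟩
    rw [actOp_pow, actOp_unop_apply, ← act_sq hn x.2 z.2, sq]
    rfl
  ρ_pow n hn x := by
    have h := iterCirc_mem x.2 (p - 1)
    rw [Nat.sub_add_cancel (Fact.out : p.Prime).one_le] at h
    refine ⟨h, actOp_ext fun z => ?_⟩
    rw [actOp_pow, actOp_unop_apply, ← act_pow p hn x.1 z.2]
  sq_boundary n hn y hy := by
    obtain ⟨z, hz, h⟩ := circ_hochschildD_mem (hn.sub_odd odd_one) hy
    rw [show 2 * (n - 1) + 1 = 2 * n - 1 by ring] at hz h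
    rw [sub_add_cancel] at h
    exact ⟨z, hz, h⟩
  pow_boundary n hn y hy := by
    obtain ⟨z, hz, h⟩ := iterCirc_hochschildD_mem p (hn.sub_odd odd_one) hy
    rw [sub_add_cancel] at hz h
    exact ⟨z, hz, h⟩

end DGCat

/-! ### Restriction along fully faithful functors -/

namespace DGFunctor

variable {k : Type u} [CommRing k] {A : DGCat.{u, v, w} k} {B : DGCat.{u, v', w'} k}
  (φ : DGFunctor A B) (hφ : φ.FullyFaithful)

theorem mapStr_append {a b c : A.Obj} (s : A.Str a b) (t : A.Str b c) :
    φ.mapStr (s.append t) = (φ.mapStr s).append (φ.mapStr t) := by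
  induction s with
  | nil a => rfl
  | cons f s ih => simp only [DGCat.Str.append, mapStr, ih]

theorem mapStr_hasDeg {a b : A.Obj} {s : A.Str a b} {e : ℤ} (hs : s.HasDeg e) :
    (φ.mapStr s).HasDeg e := by
  induction hs with
  | nil a => exact .nil _
  | cons i e f s hf hs ih => exact .cons i e _ _ (φ.map_mem i f hf) ih

theorem map_sgn (n : ℤ) {a b : A.Obj} (f : A.Hom a b) :
    φ.map (DGCat.sgn n f) = DGCat.sgn n (φ.map f) := by
  refine LinearMap.congr_fun (f := φ.map ∘ₗ DGCat.sgn n) (g := DGCat.sgn n ∘ₗ φ.map) ?_ f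
  refine DGCat.linearMap_ext_gr fun i f hf => ?_
  rw [LinearMap.comp_apply, LinearMap.comp_apply, DGCat.sgn_apply n i hf,
    DGCat.sgn_apply n i (φ.map_mem i f hf), map_intUnits_smul]

theorem map_alt {a b : A.Obj} (f : A.Hom a b) : φ.map (DGCat.alt f) = DGCat.alt (φ.map f) := by
  refine LinearMap.congr_fun (f := φ.map ∘ₗ DGCat.alt) (g := DGCat.alt ∘ₗ φ.map) ?_ f
  refine DGCat.linearMap_ext_gr fun i f hf => ?_
  rw [LinearMap.comp_apply, LinearMap.comp_apply, DGCat.alt_apply i hf,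
    DGCat.alt_apply i (φ.map_mem i f hf), map_intUnits_smul]

variable {φ}

/-- A fully faithful dg functor reflects degrees: the homogeneous components of a morphism are
mapped to those of its image. -/
theorem mem_gr_of_map_mem {a b : A.Obj} (hφ : Function.Injective (φ.map : A.Hom a b →ₗ[k] _))
    {i : ℤ} {f : A.Hom a b} (hf : φ.map f ∈ B.gr (φ.obj a) (φ.obj b) i) : f ∈ A.gr a b i := by
  obtain ⟨x, rfl⟩ := (A.isInternal a b).2 f
  let ψ : (⨁ j, A.gr a b j) →ₗ[k] ⨁ j, B.gr (φ.obj a) (φ.obj b) j :=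
    DirectSum.lmap fun j => φ.map.restrict (φ.map_mem j)
  have hψ : φ.map ∘ₗ DirectSum.coeLinearMap (A.gr a b) = DirectSum.coeLinearMap _ ∘ₗ ψ := by
    refine DirectSum.linearMap_ext _ fun j => LinearMap.ext fun y => ?_
    simp only [ψ, LinearMap.comp_apply, DirectSum.lmap_lof, DirectSum.coeLinearMap_lof]
    rfl
  have h1 : ψ x = DirectSum.lof k ℤ (fun j => B.gr (φ.obj a) (φ.obj b) j) i ⟨_, hf⟩ := by
    refine (B.isInternal _ _).1 ?_
    refine (LinearMap.congr_fun hψ x).symm.trans ?_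
    exact (DirectSum.coeLinearMap_lof _ i ⟨_, hf⟩).symm
  have h2 : x = DirectSum.lof k ℤ (fun j => A.gr a b j) i (x i) := by
    refine DFinsupp.ext fun j => ?_
    by_cases hj : i = j
    · subst hj
      exact (DirectSum.lof_apply (M := fun j => A.gr a b j) k i (x i)).symm
    · have h3 : ψ x j = 0 := by
        rw [h1]
        exact DirectSum.of_eq_of_ne _ _ _ (Ne.symm hj)
      have h4 : φ.map (x j : A.Hom a b) = 0 := congrArg Subtype.val h3
      have h5 : x j = 0 := Subtype.ext (hφ (h4.trans (map_zero _).symm))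
      rw [h5]
      exact (DirectSum.of_eq_of_ne (β := fun j => A.gr a b j) i j (x i) (Ne.symm hj)).symm
  rw [h2]
  refine (congrArg (· ∈ A.gr a b i) (DirectSum.coeLinearMap_lof _ i (x i))).mpr (x i).2

theorem map_restrict (x : B.PreCochain) {a b : A.Obj} (s : A.Str a b) :
    φ.map (φ.restrict hφ x a b s) = x (φ.obj a) (φ.obj b) (φ.mapStr s) :=
  (LinearEquiv.ofBijective φ.map (hφ a b)).apply_symm_apply _

theorem ext_map (hφ : φ.FullyFaithful) {x y : A.PreCochain}
    (h : ∀ (a b : A.Obj) (s : A.Str a b), φ.map (x a b s) = φ.map (y a b s)) : x = y := by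
  funext a b s
  exact (hφ a b).1 (h a b s)

/-- The restriction of cochains as a linear map. -/
def restrictₗ : B.PreCochain →ₗ[k] A.PreCochain where
  toFun := φ.restrict hφ
  map_add' x y := ext_map hφ fun a b s => by
    simp only [map_restrict, Pi.add_apply, map_add]
  map_smul' r x := ext_map hφ fun a b s => by
    simp only [map_restrict, Pi.smul_apply, map_smul, RingHom.id_apply]

theorem restrict_mem {n : ℤ} {x : B.PreCochain} (hx : x ∈ B.shiftedCochains n) :
    φ.restrict hφ x ∈ A.shiftedCochains n := by
  refine ⟨fun a b c e s t r f g => ?_, fun a b s e hs => ?_⟩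
  · refine (hφ _ _).1 ?_
    rw [map_add, map_smul, map_restrict, map_restrict, map_restrict]
    simp only [mapStr_append, mapStr, map_add, map_smul]
    exact hx.1 _ _ _ _ _ _ _ _ _
  · refine mem_gr_of_map_mem (hφ a b).1 ?_
    rw [map_restrict]
    exact hx.2 _ _ _ _ (φ.mapStr_hasDeg hs)

theorem cutSum_mapStr {W : Type*} [AddCommMonoid W] {a c : A.Obj} (s : A.Str a c)
    (Φ : ∀ b : B.Obj, B.Str (φ.obj a) b → B.Str b (φ.obj c) → W) :
    (φ.mapStr s).cutSum Φ
      = s.cutSum fun b s₁ s₂ => Φ (φ.obj b) (φ.mapStr s₁) (φ.mapStr s₂) := by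
  induction s with
  | nil a => rfl
  | cons f s ih => rw [mapStr, DGCat.Str.cutSum, ih]; rfl

theorem ins_mapStr {W : Type*} [AddCommMonoid W] (n : ℤ) (y : B.PreCochain) {a c : A.Obj}
    (s : A.Str a c) (F : B.Str (φ.obj a) (φ.obj c) → W) :
    DGCat.ins n y (φ.mapStr s) F
      = DGCat.ins n (φ.restrict hφ y) s fun t => F (φ.mapStr t) := by
  induction s with
  | nil a => simp only [mapStr, DGCat.ins, map_restrict]
  | cons f s ih =>
    have h := cutSum_mapStr (φ := φ) (.cons f s) fun b s₁ s₂ => F (.cons (y _ b s₁) s₂)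
    simp only [mapStr] at h
    simp only [mapStr, DGCat.ins, ih, h, map_restrict, map_sgn]

theorem restrict_circ (n : ℤ) (x y : B.PreCochain) :
    φ.restrict hφ (DGCat.circ n x y)
      = DGCat.circ n (φ.restrict hφ x) (φ.restrict hφ y) := by
  refine ext_map hφ fun a b s => ?_
  rw [map_restrict, DGCat.circ_eq_ins, DGCat.circ_eq_ins, ins_mapStr hφ, DGCat.map_ins]
  simp only [map_restrict]

theorem restrict_structureCochain :
    φ.restrict hφ B.structureCochain = A.structureCochain := by
  refine ext_map hφ fun a b s => ?_
  rw [map_restrict]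
  cases s with
  | nil a => exact (map_zero _).symm
  | cons f s =>
    cases s with
    | nil => exact (φ.map_d f).symm
    | cons g s =>
      cases s with
      | nil =>
        refine Eq.trans ?_ (φ.map_comp (DGCat.alt f) g).symm
        rw [map_alt]
        rfl
      | cons => exact (map_zero _).symm

theorem restrict_sub_intUnits_smul (ε : ℤˣ) (x y : B.PreCochain) :
    φ.restrict hφ (x - ε • y) = φ.restrict hφ x - ε • φ.restrict hφ y := by
  have h : restrictₗ hφ (x - ε • y) = restrictₗ hφ x - ε • restrictₗ hφ y := by
    rw [map_sub, map_intUnits_smul]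
  exact h

theorem restrict_hochschildD (n : ℤ) (x : B.PreCochain) :
    φ.restrict hφ (B.hochschildD n x) = A.hochschildD n (φ.restrict hφ x) := by
  rw [DGCat.hochschildD_apply, DGCat.hochschildD_apply, restrict_sub_intUnits_smul, restrict_circ,
    restrict_circ, restrict_structureCochain]

theorem restrict_iterCirc (n : ℤ) (x : B.PreCochain) (m : ℕ) :
    φ.restrict hφ (DGCat.iterCirc n x m) = DGCat.iterCirc n (φ.restrict hφ x) m := by
  induction m with
  | zero => rfl
  | succ m ih => rw [DGCat.iterCirc, DGCat.iterCirc, restrict_circ, ih]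

theorem exists_isInducedMap (p : ℕ) :
    ∃ f : ∀ n, B.shiftedHH n →ₗ[k] A.shiftedHH n,
      IsInducedMap f (φ.restrict hφ) ∧
      ∀ (R : RestrictedGradedLie k p B.shiftedHH) (S : RestrictedGradedLie k p A.shiftedHH),
        B.IsGerstenhaber R → A.IsGerstenhaber S → IsRestrictedLieHom R S f := by
  refine _root_.exists_isInducedMap (restrictₗ hφ) (fun n x hx => restrict_mem hφ hx)
    (fun n x _ => restrict_hochschildD hφ n x) (fun i j x _ y _ => ?_)
    (fun n _ x _ => restrict_circ hφ n x x) (fun n _ x _ => restrict_iterCirc hφ n x (p - 1))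
  change φ.restrict hφ (DGCat.circ j x y - (i * j).negOnePow • DGCat.circ i y x) = _
  rw [restrict_sub_intUnits_smul, restrict_circ, restrict_circ]
  rfl

end DGFunctor

end

theorem mainTheorem5 {k : Type u} [CommRing k] (p : ℕ) [Fact p.Prime] [CharP k p] :
    -- the shifted cohomology of a `B_∞`-algebra is a restricted graded Lie algebra
    (∀ (C : Type v) [AddCommGroup C] [Module k C] (gr : ℤ → Submodule k C)
        (_ : DirectSum.IsInternal gr) (X : BInfStructure k gr),
      (∃! R : RestrictedGradedLie k p X.shiftedCohomology, X.Induces R) ∧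
      (X.IsBrace → ∀ n : ℤ, Even n → ∀ x ∈ X.sgr n, X.power p x = X.iterCirc x (p - 1))) ∧
    -- maps of `B_∞`-algebras induce maps of restricted graded Lie algebras
    (∀ (C : Type v) [AddCommGroup C] [Module k C] (D : Type w) [AddCommGroup D] [Module k D]
        (gr : ℤ → Submodule k C) (gr' : ℤ → Submodule k D)
        (_ : DirectSum.IsInternal gr) (_ : DirectSum.IsInternal gr')
        (X : BInfStructure k gr) (Y : BInfStructure k gr') (F : BInfHom X Y),
      ∃ f : ∀ n, X.shiftedCohomology n →ₗ[k] Y.shiftedCohomology n,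
        IsInducedMap f F.linearPart ∧
        ∀ (R : RestrictedGradedLie k p X.shiftedCohomology)
          (S : RestrictedGradedLie k p Y.shiftedCohomology),
          X.Induces R → Y.Induces S → IsRestrictedLieHom R S f) ∧
    -- the shifted Hochschild cohomology of a dg category is a restricted graded Lie algebra
    (∀ A : DGCat.{u, v, w} k,
      ∃! R : RestrictedGradedLie k p A.shiftedHH, A.IsGerstenhaber R) ∧
    -- restriction along fully faithful dg functors is a map of restricted graded Lie algebras
    (∀ (A : DGCat.{u, v, w} k) (B : DGCat.{u, v', w'} k) (φ : DGFunctor A B)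
        (hφ : φ.FullyFaithful),
      ∃ f : ∀ n, B.shiftedHH n →ₗ[k] A.shiftedHH n,
        IsInducedMap f (φ.restrict hφ) ∧
        ∀ (R : RestrictedGradedLie k p B.shiftedHH) (S : RestrictedGradedLie k p A.shiftedHH),
          B.IsGerstenhaber R → A.IsGerstenhaber S → IsRestrictedLieHom R S f) := by
  refine ⟨fun C _ _ gr hgr X => ⟨(X.assocModel p hgr).existsUnique, fun hX n _ x hx => ?_⟩,
    fun C _ _ D _ _ gr gr' hgr hgr' X Y F => F.exists_isInducedMap p hgr hgr',
    fun A => (A.assocModel p).existsUnique, fun A B φ hφ => DGFunctor.exists_isInducedMap hφ p⟩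
  have h := X.power_eq_iterCirc hgr hX hx (p - 1)
  rwa [Nat.sub_add_cancel (Fact.out : p.Prime).one_le] at h
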